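/- Spaces are pointed compactly generated spaces, products are formed in compactly generated spaces, and $[Y,Z]$ is the set of pointed homotopy classes of pointed maps. Let $X$ be path connected with non-degenerate base point $*$ (an NDR pair), and suppose that the reduced diagonal $X\to X\wedge X$ is null homotopic (weak LS-category less than $2$). Let $l,n\ge 1$. $X^{(l)}$ is the $l$-fold smash power of $X$. $J(Z)$ is the James construction, the free topological monoid on $Z$ with the base point as unit, and $J_n(Z)$ is its $n$-th stage, the quotient of $Z^n$ that identifies tuples representing the same word. The product on $[Y,J(X)]$ is induced by that of $J(X)$. For a finite index set $I$ let $K_I$ be the group with generators $x_i$ $(i\in I)$ and relations (1) $[[x_{i_1},\dots,x_{i_k}]=1$ whenever $i_s=i_t$ for some $s<t$, and (2) $[[x_{i_1}^{m_1},\dots,x_{i_k}^{m_k}]=[[x_{i_1},\dots,x_{i_k}]^{m_1\cdots m_k}$ for all integers $m_j$, where $[[a_1,\dots,a_k]=[\cdots[a_1,a_2],\cdots,a_k]$ and $[a,b]=a^{-1}b^{-1}ab$. Let $K_{ln}$ be $K_I$ for $I=\{1,\dots,ln\}$, divided into $n$ consecutive blocks of length $l$. In $[X^{ln},J(X)]$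 let $x_i$ be the class of $X^{ln}\xrightarrow{p_i}X\hookrightarrow J(X)$, and let $K_{ln}(X)$ be the subgroup generated by $x_1,\dots,x_{ln}$. Let $H^{(l)}_n\le K_{ln}$ be the subgroup of all $\alpha$ such that (a) setting any one generator of a block equal to $1$ has the same effect on $\alpha$ as setting all generators of that block equal to $1$, and (b) $D_0\alpha=\dots=D_{n-1}\alpha$, where $D_s:K_{ln}\to K_{l(n-1)}$ sends the generators of the $s$-th block (counted from $0$) to $1$ and renumbers the others in order. Let $q:X^{ln}\to (X^{(l)})^n\to J_n(X^{(l)})$ be the quotient map, and let $H^{(l)}_n(X)\subseteq[J_n(X^{(l)}),J(X)]$ consist of the classes $\beta$ for which $q^*\beta$ lies in $K_{ln}(X)$ and satisfies the analogues of (a) and (b), with "setting $x_i$ equal to $1$" replaced by restriction to the subspace where the $i$-th coordinate is $*$. Then $[X^{ln},J(X)]$ and $[J_n(X^{(l)}),J(X)]$ are groups, and there are homomorphisms $$e_X:K_{ln}\to[X^{ln},J(X)],\quad e_X(x_i)=x_i,\qquad\text{and}\qquad e_X:H^{(l)}_n\to H^{(l)}_n(X)\subseteq[J_n(X^{(l)}),J(X)]$$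 such that $q^*(e_X(h))=e_X(h)$ in $[X^{ln},J(X)]$ for all $h\in H^{(l)}_n$. Moreover, if $h\in H^{(l)}_n$ becomes trivial on setting any single generator $x_i$ equal to $1$, then $q^*(e_X(h))$ is trivial when restricted to any subspace of $X^{ln}$ on which a single coordinate is $*$. -/

import Mathlib

open TopologicalSpace Topology

universe u

/-! ## The combinatorial Cohen group -/

namespace Cohen

/-- The commutator with the convention `[x, y] = x⁻¹ y⁻¹ x y`. -/
def comm {G : Type*} [Group G] (x y : G) : G := x⁻¹ * y⁻¹ * x * y

/-- The left normed iterated commutator `[[a₁, a₂, …, a_k] = [⋯[[a₁, a₂], a₃], ⋯, a_k]`. -/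
def leftComm {G : Type*} [Group G] : List G → G
  | [] => 1
  | a :: as => as.foldl comm a

/-- The defining relators of the Cohen group on generators `x_i`, `i : ι`:
(1) `[[x_{i₁}, …, x_{i_k}]` whenever two of the indices coincide;
(2) `[[x_{i₁}^{n₁}, …, x_{i_k}^{n_k}] = [[x_{i₁}, …, x_{i_k}]^{n₁ ⋯ n_k}` for all integers `n_j`. -/
def relators (ι : Type) : Set (FreeGroup ι) :=
  {r | ∃ L : List ι, ¬ L.Nodup ∧ r = leftComm (L.map FreeGroup.of)} ∪
  {r | ∃ L : List (ι × ℤ), r = leftComm (L.map fun p => FreeGroup.of p.1 ^ p.2) *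
      (leftComm (L.map fun p => FreeGroup.of p.1) ^ (L.map Prod.snd).prod)⁻¹}

/-- The Cohen group on generators indexed by `ι`; `K_n` is `K (Fin n)`, and `K_{ln}` is
`K (Fin n × Fin l)`, where `(s, j)` stands for the `j`-th index of the `s`-th block of length `l`. -/
abbrev K (ι : Type) : Type := PresentedGroup (relators ι)

/-- The generator `x_i`. -/
def K.x {ι : Type} (i : ι) : K ι := PresentedGroup.of i

lemma map_comm {G H : Type*} [Group G] [Group H] (f : G →* H) (x y : G) :
    f (comm x y) = comm (f x) (f y) := by
  simp [comm]

lemma map_leftComm {G H : Type*} [Group G] [Group H] (f : G →* H) (L : List G) :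
    f (leftComm L) = leftComm (L.map f) := by
  cases L with
  | nil => simp [leftComm]
  | cons a as =>
    simp only [leftComm, List.map_cons]
    induction as generalizing a with
    | nil => rfl
    | cons b bs ih => simp only [List.foldl_cons, List.map_cons, ih, map_comm]

lemma foldl_comm_one {G : Type*} [Group G] (L : List G) : L.foldl comm 1 = 1 := by
  induction L with
  | nil => rfl
  | cons b bs ih => simpa [comm] using ih

lemma foldl_comm_of_mem {G : Type*} [Group G] (L : List G) (a : G) (h : (1 : G) ∈ L) :
    L.foldl comm a = 1 := by
  induction L generalizing a with
  | nil => simp at h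
  | cons b bs ih =>
    rcases List.mem_cons.1 h with h | h
    · subst h
      simpa [comm] using foldl_comm_one bs
    · exact ih _ h

lemma leftComm_of_mem {G : Type*} [Group G] (L : List G) (h : (1 : G) ∈ L) :
    leftComm L = 1 := by
  cases L with
  | nil => rfl
  | cons a as =>
    rcases List.mem_cons.1 h with h | h
    · subst h
      exact foldl_comm_one as
    · exact foldl_comm_of_mem as a h

/-- The image of the generator `x_i` under a relabelling `φ`: it is `x_{φ i}`, or `1` if `φ`
deletes the index `i`. -/
def K.relabel {ι κ : Type} (φ : ι → Option κ) (i : ι) : K κ := (φ i).elim 1 K.x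

lemma K.leftComm_eq_one {κ : Type} (L : List κ) (h : ¬ L.Nodup) :
    leftComm (L.map (K.x : κ → K κ)) = 1 := by
  have h1 : PresentedGroup.mk (relators κ) (leftComm (L.map FreeGroup.of)) = 1 :=
    PresentedGroup.one_of_mem (Or.inl ⟨L, h, rfl⟩)
  rw [map_leftComm, List.map_map] at h1
  exact h1

lemma K.leftComm_zpow {κ : Type} (L : List (κ × ℤ)) :
    leftComm (L.map fun p => (K.x p.1 : K κ) ^ p.2) =
      leftComm (L.map fun p => (K.x p.1 : K κ)) ^ (L.map Prod.snd).prod := by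
  have h1 := PresentedGroup.one_of_mem (rels := relators κ) (Or.inr ⟨L, rfl⟩)
  rw [map_mul, map_inv, mul_inv_eq_one, map_zpow, map_leftComm, map_leftComm, List.map_map,
    List.map_map] at h1
  simpa [Function.comp_def, K.x, PresentedGroup.of] using h1

/-- The homomorphism of Cohen groups with `x_i ↦ x_{φ i}`, and `x_i ↦ 1` where `φ` deletes `i`. -/
def K.map {ι κ : Type} (φ : ι → Option κ) : K ι →* K κ :=
  PresentedGroup.toGroup (f := K.relabel φ) <| by
    rintro r (⟨L, hL, rfl⟩ | ⟨L, rfl⟩)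
    · rw [map_leftComm, List.map_map]
      by_cases h : ∃ i ∈ L, φ i = none
      · obtain ⟨i, hi, hn⟩ := h
        exact leftComm_of_mem _ (List.mem_map.2 ⟨i, hi, by simp [K.relabel, hn]⟩)
      · push Not at h
        obtain ⟨M, hM⟩ : ∃ M : List κ, M.map some = L.map φ := by
          refine ⟨L.filterMap φ, ?_⟩
          clear hL
          induction L with
          | nil => rfl
          | cons a as ih =>
            obtain ⟨b, hb⟩ := Option.ne_none_iff_exists'.1 (h a (by simp))
            rw [List.filterMap_cons_some hb, List.map_cons, List.map_cons, hb,
              ih fun i hi => h i (by simp [hi])]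
        have e : L.map (⇑(FreeGroup.lift (K.relabel φ)) ∘ FreeGroup.of) = M.map K.x := by
          have := congrArg (List.map fun o : Option κ => o.elim (1 : K κ) K.x) hM
          rw [List.map_map, List.map_map] at this
          rw [show M.map K.x = _ from this]
          simp [Function.comp_def, K.relabel]
        rw [e]
        refine K.leftComm_eq_one M fun hN => hL ?_
        have : (M.map some).Nodup := hN.map (Option.some_injective _)
        rw [hM] at this
        exact List.Nodup.of_map _ this
    · rw [map_mul, map_inv, mul_inv_eq_one, map_zpow, map_leftComm, map_leftComm, List.map_map,
        List.map_map]
      by_cases h : ∃ p ∈ L, φ p.1 = none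
      · obtain ⟨p, hp, hn⟩ := h
        rw [leftComm_of_mem, leftComm_of_mem, one_zpow]
        · exact List.mem_map.2 ⟨p, hp, by simp [K.relabel, hn]⟩
        · exact List.mem_map.2 ⟨p, hp, by simp [K.relabel, hn]⟩
      · push Not at h
        obtain ⟨M, hM⟩ : ∃ M : List (κ × ℤ),
            M.map (fun p => (some p.1, p.2)) = L.map (fun p => (φ p.1, p.2)) := by
          refine ⟨L.filterMap fun p => (φ p.1).map fun k => (k, p.2), ?_⟩
          induction L with
          | nil => rfl
          | cons a as ih =>
            obtain ⟨b, hb⟩ := Option.ne_none_iff_exists'.1 (h a (by simp))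
            rw [List.filterMap_cons_some (b := (b, a.2)) (by simp [hb]), List.map_cons,
              List.map_cons, hb, ih fun i hi => h i (by simp [hi])]
        have e1 := congrArg (List.map fun o : Option κ × ℤ => (o.1.elim (1 : K κ) K.x) ^ o.2) hM
        have e2 := congrArg (List.map fun o : Option κ × ℤ => (o.1.elim (1 : K κ) K.x)) hM
        have e3 := congrArg (List.map fun o : Option κ × ℤ => o.2) hM
        simp only [List.map_map, Function.comp_def, Option.elim_some] at e1 e2 e3
        simp only [Function.comp_def, map_zpow, FreeGroup.lift_apply_of, K.relabel]
        rw [← e1, ← e2]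
        have e4 : L.map Prod.snd = M.map Prod.snd := e3.symm
        rw [e4]
        exact K.leftComm_zpow M

end Cohen

/-! ## Index bookkeeping -/

/-- Delete the indices in `A`, keep the others. -/
noncomputable def killIdx {ι : Type} (A : Set ι) (i : ι) : Option ι :=
  open Classical in if i ∈ A then none else some i

/-- The `s`-th block of indices. -/
def block {n l : ℕ} (s : Fin n) : Set (Fin n × Fin l) := {p | p.1 = s}

/-- Delete the `s`-th block of indices and close the gap: the blocks before `s` keep their number,
the blocks after `s` move down by one. -/
def deleteBlock {n l : ℕ} (s : Fin n) (p : Fin n × Fin l) : Option (Fin (n - 1) × Fin l) :=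
  if h : p.1 < s then some (⟨(p.1 : ℕ), by omega⟩, p.2)
  else if h' : s < p.1 then some (⟨(p.1 : ℕ) - 1, by omega⟩, p.2)
  else none

namespace Cohen

/-- The combinatorial group `H_n^{(l)}`, a subgroup of `K_{ln}`. An element `α` belongs to it if
* killing one generator of a block has the same effect on `α` as killing the whole block, and
* `D_0 α = ⋯ = D_{n-1} α`, where `D_s : K_{ln} → K_{l(n-1)}` kills the `s`-th block of generators
  and renumbers the remaining ones. -/
def H (l n : ℕ) : Subgroup (K (Fin n × Fin l)) where
  carrier := {α | (∀ s j, K.map (killIdx {(s, j)}) α = K.map (killIdx (block s)) α) ∧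
    ∀ s t, K.map (deleteBlock s) α = K.map (deleteBlock t) α}
  mul_mem' := by
    rintro a b ⟨h1, h2⟩ ⟨h3, h4⟩
    exact ⟨fun s j => by rw [map_mul, map_mul, h1, h3], fun s t => by
      rw [map_mul, map_mul, h2 s t, h4 s t]⟩
  one_mem' := ⟨fun s j => by rw [map_one, map_one], fun s t => by rw [map_one, map_one]⟩
  inv_mem' := by
    rintro a ⟨h1, h2⟩
    exact ⟨fun s j => by rw [map_inv, map_inv, h1], fun s t => by rw [map_inv, map_inv, h2 s t]⟩

end Cohen

/-! ## Pointed compactly generated spaces and homotopy classes of pointed maps -/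

/-- A pointed compactly generated space. -/
structure PtdCG : Type (u + 1) where
  carrier : Type u
  [top : TopologicalSpace carrier]
  [cg : CompactlyGeneratedSpace carrier]
  pt : carrier

namespace PtdCG

instance : CoeSort PtdCG.{u} (Type u) := ⟨PtdCG.carrier⟩

instance (X : PtdCG.{u}) : TopologicalSpace X := X.top

instance (X : PtdCG.{u}) : CompactlyGeneratedSpace X := X.cg

/-- Pointed continuous maps. -/
abbrev PMap (Y Z : PtdCG.{u}) : Type u := {f : C(Y, Z) // f Y.pt = Z.pt}

/-- The constant map to the base point. -/
def PMap.const (Y Z : PtdCG.{u}) : PMap Y Z := ⟨ContinuousMap.const Y Z.pt, rfl⟩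

/-- Pointed homotopy of pointed maps. -/
def PMap.Homotopic {Y Z : PtdCG.{u}} (f g : PMap Y Z) : Prop :=
  ContinuousMap.HomotopicRel f.1 g.1 {Y.pt}

instance homotopySetoid (Y Z : PtdCG.{u}) : Setoid (PMap Y Z) where
  r := PMap.Homotopic
  iseqv := ⟨fun f => ContinuousMap.HomotopicRel.refl f.1, fun h => h.symm, fun h h' => h.trans h'⟩

/-- The set `[Y, Z]` of pointed homotopy classes of pointed maps. -/
abbrev HClass (Y Z : PtdCG.{u}) : Type u := Quotient (homotopySetoid Y Z)

/-- The base point is non-degenerate: `(X, *)` is an NDR pair. -/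
def Nondegenerate (X : PtdCG.{u}) : Prop :=
  ∃ (v : C(X, unitInterval)) (h : C(X × unitInterval, X)),
    (∀ x, v x = 0 ↔ x = X.pt) ∧ (∀ x, h (x, 0) = x) ∧ (∀ t, h (X.pt, t) = X.pt) ∧
      ∀ x, v x < 1 → h (x, 1) = X.pt

/-! ### Products in compactly generated spaces -/

/-- The type of families `ι → X`, to be given the compactly generated product topology. -/
structure KPow (ι : Type) (X : Type u) : Type u where
  coord : ι → X

instance (ι : Type) (X : Type u) : CoeFun (KPow ι X) fun _ => ι → X := ⟨KPow.coord⟩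

/-- The topology of the product `X^ι` in compactly generated spaces: the compactly generated
topology associated with the product topology. -/
instance (ι : Type) (X : Type u) [TopologicalSpace X] : TopologicalSpace (KPow ι X) :=
  TopologicalSpace.coinduced KPow.mk (TopologicalSpace.compactlyGenerated.{u} (ι → X))

section KPow

variable {ι : Type} {X : Type u} [TopologicalSpace X]

lemma continuous_KPow_of_compact {K : Type u} [TopologicalSpace K] [CompactSpace K] [T2Space K]
    {f : K → ι → X} (h : Continuous f) : Continuous fun k => KPow.mk (f k) := by
  refine continuous_def.2 fun U hU => ?_
  have h1 : IsOpen ((fun s : (Σ (i : (S : CompHaus.{u}) × C(S, ι → X)), i.fst) => s.1.2 s.2) ⁻¹'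
      (KPow.mk ⁻¹' U)) := hU
  exact isOpen_sigma_iff.1 h1 ⟨CompHaus.of K, ⟨f, h⟩⟩

lemma continuous_from_KPow {T : Type*} [TopologicalSpace T] {f : KPow ι X → T}
    (h : ∀ (S : Type u) [TopologicalSpace S] [CompactSpace S] [T2Space S] (g : S → ι → X),
      Continuous g → Continuous fun s => f ⟨g s⟩) : Continuous f := by
  refine continuous_coinduced_dom.2 ?_
  exact continuous_from_compactlyGenerated.{u} (X := ι → X) _ fun S g => h S g g.continuous

lemma continuous_coord (i : ι) : Continuous fun v : KPow ι X => v i :=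
  continuous_from_KPow fun _ _ _ _ _ hg => (continuous_apply i).comp hg

lemma continuous_KPow {W : Type u} [TopologicalSpace W] [CompactlyGeneratedSpace W]
    {f : W → KPow ι X} (h : ∀ i, Continuous fun w => f w i) : Continuous f :=
  continuous_from_compactlyGeneratedSpace _ fun _ _ _ _ _ hg =>
    continuous_KPow_of_compact (continuous_pi fun i => (h i).comp hg)

instance : CompactlyGeneratedSpace (KPow ι X) := by
  refine compactlyGeneratedSpace_of_continuous_maps fun f hf => ?_
  refine continuous_from_KPow fun S _ _ _ g hg => ?_
  exact hf S (fun s => ⟨g s⟩) (continuous_KPow_of_compact hg)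

end KPow

/-- The product of a compactly generated space with a compact Hausdorff space is compactly
generated. -/
lemma compactlyGenerated_prod (Y K : Type u) [TopologicalSpace Y] [CompactlyGeneratedSpace Y]
    [TopologicalSpace K] [CompactSpace K] [T2Space K] : CompactlyGeneratedSpace (Y × K) := by
  refine compactlyGeneratedSpace_of_continuous_maps fun {T} _ f hf => ?_
  have h1 : ∀ y, Continuous fun k => f (y, k) := fun y =>
    hf K (fun k => (y, k)) (by fun_prop)
  let F : Y → C(K, T) := fun y => ⟨fun k => f (y, k), h1 y⟩
  have hF : Continuous F := by
    refine continuous_from_compactlyGeneratedSpace _ fun L _ _ _ g hg => ?_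
    refine ContinuousMap.continuous_of_continuous_uncurry _ ?_
    exact hf (L × K) (fun p => (g p.1, p.2)) (by fun_prop)
  exact ContinuousMap.continuous_uncurry_of_continuous ⟨F, hF⟩

/-- The power `X^ι` in pointed compactly generated spaces; `X^n` is `X.pow (Fin n)`. -/
def pow (X : PtdCG.{u}) (ι : Type) : PtdCG.{u} where
  carrier := KPow ι X
  pt := ⟨fun _ => X.pt⟩

/-! ### Topological monoids and the product of homotopy classes -/

/-- A topological monoid in compactly generated spaces, with the unit as base point. -/
class CGMonoid (M : PtdCG.{u}) extends Monoid M.carrier where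
  pt_eq : M.pt = 1
  continuous_mul' : Continuous fun p : KPow (Fin 2) M => p 0 * p 1

section Mul

variable {M : PtdCG.{u}} [CGMonoid M]

lemma CGMonoid.continuous_mul {W : Type u} [TopologicalSpace W] [CompactlyGeneratedSpace W]
    {f g : W → M} (hf : Continuous f) (hg : Continuous g) : Continuous fun w => f w * g w := by
  have : Continuous (fun w => ⟨![f w, g w]⟩ : W → KPow (Fin 2) M) := by
    refine continuous_KPow fun i => ?_
    fin_cases i
    · exact hf
    · exact hg
  exact (CGMonoid.continuous_mul' (M := M)).comp this

/-- The pointwise product of pointed maps into a topological monoid. -/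
def PMap.mul {Y : PtdCG.{u}} (f g : PMap Y M) : PMap Y M :=
  ⟨⟨fun y => f.1 y * g.1 y, CGMonoid.continuous_mul f.1.continuous g.1.continuous⟩, by
    change f.1 Y.pt * g.1 Y.pt = M.pt
    rw [f.2, g.2, CGMonoid.pt_eq, one_mul]⟩

lemma PMap.mul_homotopic {Y : PtdCG.{u}} {f f' g g' : PMap Y M} (hf : PMap.Homotopic f f')
    (hg : PMap.Homotopic g g') : PMap.Homotopic (f.mul g) (f'.mul g') := by
  obtain ⟨F⟩ := hf
  obtain ⟨G⟩ := hg
  have hc : Continuous fun p : unitInterval × Y => F p * G p := by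
    have hI : CompactlyGeneratedSpace (Y × ULift.{u} unitInterval) := compactlyGenerated_prod Y _
    have h1 : Continuous fun p : Y × ULift.{u} unitInterval =>
        F (p.2.down, p.1) * G (p.2.down, p.1) :=
      CGMonoid.continuous_mul (F.continuous.comp (by fun_prop)) (G.continuous.comp (by fun_prop))
    exact h1.comp (g := fun p : Y × ULift.{u} unitInterval => _)
      (f := fun p : unitInterval × Y => (p.2, ULift.up p.1)) (by fun_prop)
  refine ⟨⟨⟨⟨fun p => F p * G p, hc⟩, ?_, ?_⟩, ?_⟩⟩
  · intro y
    change F (0, y) * G (0, y) = f.1 y * g.1 y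
    rw [F.apply_zero, G.apply_zero]
  · intro y
    change F (1, y) * G (1, y) = f'.1 y * g'.1 y
    rw [F.apply_one, G.apply_one]
  · intro t y hy
    change F (t, y) * G (t, y) = f.1 y * g.1 y
    rw [F.eq_fst t hy, G.eq_fst t hy]

/-- The monoid `[Y, M]`, with the multiplication induced by the one of `M`. -/
instance (Y : PtdCG.{u}) : Monoid (HClass Y M) where
  mul := Quotient.map₂ PMap.mul fun _ _ h _ _ h' => PMap.mul_homotopic h h'
  one := ⟦PMap.const Y M⟧
  mul_assoc := by
    rintro ⟨a⟩ ⟨b⟩ ⟨c⟩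
    refine congrArg (Quotient.mk _) (Subtype.ext (ContinuousMap.ext fun y => ?_))
    exact mul_assoc (a.1 y) (b.1 y) (c.1 y)
  one_mul := by
    rintro ⟨a⟩
    refine congrArg (Quotient.mk _) (Subtype.ext (ContinuousMap.ext fun y => ?_))
    change M.pt * a.1 y = a.1 y
    exact (congrArg (· * a.1 y) CGMonoid.pt_eq).trans (one_mul _)
  mul_one := by
    rintro ⟨a⟩
    refine congrArg (Quotient.mk _) (Subtype.ext (ContinuousMap.ext fun y => ?_))
    change a.1 y * M.pt = a.1 y
    exact (congrArg (a.1 y * ·) CGMonoid.pt_eq).trans (mul_one _)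

/-- The homomorphism `g^* : [Y, M] → [Y', M]` induced by a pointed map `g : Y' → Y`. -/
def pullback (M : PtdCG.{u}) [CGMonoid M] {Y Y' : PtdCG.{u}} (g : PMap Y' Y) :
    HClass Y M →* HClass Y' M where
  toFun := Quotient.map (fun f => ⟨f.1.comp g.1, by
      rw [ContinuousMap.comp_apply, g.2, f.2]⟩) (by
    rintro f f' ⟨F⟩
    refine ⟨⟨⟨⟨fun p => F (p.1, g.1 p.2), by fun_prop⟩, ?_, ?_⟩, ?_⟩⟩
    · exact fun y => F.apply_zero _
    · exact fun y => F.apply_one _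
    · intro t y hy
      refine F.eq_fst t ?_
      rw [Set.mem_singleton_iff] at hy ⊢
      rw [hy, g.2])
  map_one' := rfl
  map_mul' := by
    rintro ⟨a⟩ ⟨b⟩
    rfl

end Mul

/-! ### Smash powers -/

/-- Two points of `X^l` are identified in the smash power if they are equal or both lie in the fat
wedge, that is, both have a coordinate equal to the base point. -/
def smashSetoid (X : PtdCG.{u}) (l : ℕ) : Setoid (KPow (Fin l) X) where
  r a b := a = b ∨ ((∃ i, a i = X.pt) ∧ ∃ i, b i = X.pt)
  iseqv := by
    refine ⟨fun a => Or.inl rfl, ?_, ?_⟩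
    · rintro a b (h | ⟨h, h'⟩)
      · exact Or.inl h.symm
      · exact Or.inr ⟨h', h⟩
    · rintro a b c (rfl | ⟨h, h'⟩) (rfl | ⟨h2, h2'⟩)
      · exact Or.inl rfl
      · exact Or.inr ⟨h2, h2'⟩
      · exact Or.inr ⟨h, h'⟩
      · exact Or.inr ⟨h, h2'⟩

/-- The `l`-fold self smash product `X^{(l)}`, for `l > 0`. -/
def smash (X : PtdCG.{u}) (l : ℕ) : PtdCG.{u} where
  carrier := Quotient (X.smashSetoid l)
  pt := Quotient.mk (X.smashSetoid l) ⟨fun _ => X.pt⟩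

/-- The reduced diagonal `X → X ∧ X`. -/
def reducedDiagonal (X : PtdCG.{u}) : PMap X (X.smash 2) :=
  ⟨⟨fun x => Quotient.mk (X.smashSetoid 2) ⟨fun _ => x⟩,
    continuous_quotient_mk'.comp (continuous_KPow fun _ => continuous_id)⟩, rfl⟩

/-- `X` has weak LS-category less than `2`: the reduced diagonal is null homotopic. -/
def WeakCatLtTwo (X : PtdCG.{u}) : Prop :=
  PMap.Homotopic X.reducedDiagonal (PMap.const X (X.smash 2))

/-! ### The James construction -/

/-- The underlying monoid of the James construction: reduced words, that is, words in the points
of `X` other than the base point. This is the free monoid on `X` with the base point as unit. -/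
def Word (X : PtdCG.{u}) : Type u := FreeMonoid {x : X // x ≠ X.pt}

instance (X : PtdCG.{u}) : Monoid X.Word := inferInstanceAs (Monoid (FreeMonoid _))

/-- A point of `X` as an element of the James construction; the base point becomes the unit. -/
noncomputable def letter (X : PtdCG.{u}) (x : X) : X.Word :=
  open Classical in if h : x = X.pt then 1 else FreeMonoid.of ⟨x, h⟩

/-- The element `x₁ x₂ ⋯ x_k` of the James construction. -/
noncomputable def word (X : PtdCG.{u}) {k : ℕ} (v : KPow (Fin k) X) : X.Word :=
  (List.ofFn fun i => X.letter (v i)).prod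

/-- The quotient map from the disjoint union of the powers `X^k` to the James construction. -/
noncomputable def wordSigma (X : PtdCG.{u}) (v : Σ k : ℕ, KPow (Fin k) X) : X.Word := X.word v.2

/-- The James construction has the quotient topology from the disjoint union of the
powers `X^k`. -/
noncomputable instance (X : PtdCG.{u}) : TopologicalSpace X.Word :=
  TopologicalSpace.coinduced X.wordSigma inferInstance

lemma continuous_wordSigma (X : PtdCG.{u}) : Continuous X.wordSigma := continuous_coinduced_rng

lemma continuous_word (X : PtdCG.{u}) (k : ℕ) : Continuous (X.word (k := k)) :=
  X.continuous_wordSigma.comp (continuous_sigmaMk (i := k))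

instance (X : PtdCG.{u}) : CompactlyGeneratedSpace X.Word :=
  uCompactlyGeneratedSpace_of_coinduced X.continuous_wordSigma rfl

lemma letter_pt (X : PtdCG.{u}) : X.letter X.pt = 1 := dif_pos rfl

lemma letter_of_ne (X : PtdCG.{u}) {x : X} (h : x ≠ X.pt) :
    X.letter x = (FreeMonoid.of ⟨x, h⟩ : FreeMonoid {x : X // x ≠ X.pt}) := dif_neg h

/-- Concatenation of families. -/
def appendK {X : Type u} {m n : ℕ} (v : KPow (Fin m) X) (w : KPow (Fin n) X) :
    KPow (Fin (m + n)) X := ⟨Fin.append v.coord w.coord⟩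

lemma word_appendK (X : PtdCG.{u}) {m n : ℕ} (v : KPow (Fin m) X) (w : KPow (Fin n) X) :
    X.word (appendK v w) = X.word v * X.word w := by
  have : (fun i => X.letter ((appendK v w) i)) =
      Fin.append (fun i => X.letter (v i)) (fun i => X.letter (w i)) := by
    funext i
    refine Fin.addCases (fun i => ?_) (fun i => ?_) i <;> simp [appendK]
  rw [word, this, List.ofFn_fin_append, List.prod_append]
  rfl

lemma wordSigma_surjective (X : PtdCG.{u}) : Function.Surjective X.wordSigma := by
  intro w
  refine FreeMonoid.recOn (motive := fun w : FreeMonoid {x : X // x ≠ X.pt} =>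
    ∃ a, X.wordSigma a = w) w ⟨⟨0, ⟨Fin.elim0⟩⟩, rfl⟩ ?_
  rintro x xs ⟨⟨k, v⟩, hv⟩
  refine ⟨⟨1 + k, appendK ⟨fun _ => x.1⟩ v⟩, ?_⟩
  refine (X.word_appendK _ _).trans ?_
  refine congrArg₂ (fun a b : FreeMonoid {x : X // x ≠ X.pt} => a * b) ?_ hv
  refine Eq.trans ?_ (X.letter_of_ne x.2)
  exact mul_one _

lemma isQuotientMap_wordSigma (X : PtdCG.{u}) : IsQuotientMap X.wordSigma :=
  ⟨⟨rfl⟩, X.wordSigma_surjective⟩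

/-- Multiplication on the left by words of fixed length. -/
lemma continuous_word_mul (X : PtdCG.{u}) {m : ℕ} (C : Type u) [TopologicalSpace C]
    [CompactSpace C] [T2Space C] {c : C → KPow (Fin m) X} (hc : Continuous c) :
    Continuous fun p : C × X.Word => X.word (c p.1) * p.2 := by
  refine X.isQuotientMap_wordSigma.continuous_lift_prod_right ?_
  have h : Continuous fun p : (Σ k : ℕ, KPow (Fin k) X) × C =>
      X.word (c p.2) * X.wordSigma p.1 := by
    rw [← (Homeomorph.sigmaProdDistrib (X := fun k : ℕ => KPow (Fin k) X)
      (Y := C)).symm.comp_continuous_iff', continuous_sigma_iff]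
    intro k
    have hk : CompactlyGeneratedSpace (KPow (Fin k) X × C) := compactlyGenerated_prod _ _
    have h1 : Continuous fun p : KPow (Fin k) X × C => appendK (c p.2) p.1 := by
      refine continuous_KPow fun i => ?_
      refine Fin.addCases (fun i => ?_) (fun i => ?_) i
      · simpa [appendK, Function.comp_def] using
          (continuous_coord i).comp (hc.comp continuous_snd)
      · simpa [appendK, Function.comp_def] using
          (continuous_coord i).comp (continuous_fst (X := KPow (Fin k) X) (Y := C))
    refine ((X.continuous_word _).comp h1).congr fun p => ?_
    exact X.word_appendK _ _
  exact h.comp continuous_swap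

lemma continuous_mul_right (X : PtdCG.{u}) (C : Type u) [TopologicalSpace C]
    [CompactSpace C] [T2Space C] {b : C → X.Word} (hb : Continuous b) :
    Continuous fun p : X.Word × C => p.1 * b p.2 := by
  refine X.isQuotientMap_wordSigma.continuous_lift_prod_left ?_
  rw [← (Homeomorph.sigmaProdDistrib (X := fun k : ℕ => KPow (Fin k) X)
      (Y := C)).symm.comp_continuous_iff', continuous_sigma_iff]
  intro k
  have hk : CompactlyGeneratedSpace (KPow (Fin k) X × C) := compactlyGenerated_prod _ _
  refine continuous_from_compactlyGeneratedSpace _ fun S _ _ _ g hg => ?_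
  exact (X.continuous_word_mul S (c := fun s => (g s).1) (continuous_fst.comp hg)).comp
    (continuous_id.prodMk (hb.comp (continuous_snd.comp hg)))

/-- The James construction `J(X)`. -/
noncomputable def James (X : PtdCG.{u}) : PtdCG.{u} where
  carrier := X.Word
  pt := 1

noncomputable instance (X : PtdCG.{u}) : CGMonoid X.James where
  toMonoid := inferInstanceAs (Monoid X.Word)
  pt_eq := rfl
  continuous_mul' := by
    refine continuous_from_compactlyGeneratedSpace _ fun S _ _ _ g hg => ?_
    have h0 := (continuous_coord (X := X.Word) (0 : Fin 2)).comp hg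
    have h1 := (continuous_coord (X := X.Word) (1 : Fin 2)).comp hg
    exact (X.continuous_mul_right S h1).comp (h0.prodMk continuous_id)

/-- The canonical inclusion `E : X → J(X)`. -/
noncomputable def jamesIncl (X : PtdCG.{u}) : PMap X X.James :=
  ⟨⟨X.letter, by
    have h : Continuous fun x : X => X.word (k := 1) ⟨fun _ => x⟩ :=
      (X.continuous_word 1).comp (continuous_KPow fun _ => continuous_id)
    refine h.congr fun x => ?_
    simp [word]⟩, X.letter_pt⟩

/-- The `n`-th stage `J_n(X)` of the James filtration: the quotient of `X^n` in which two families
are identified if they represent the same element of `J(X)`. -/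
noncomputable def JamesFil (X : PtdCG.{u}) (n : ℕ) : PtdCG.{u} where
  carrier := Quotient (Setoid.ker (X.word (k := n)))
  pt := Quotient.mk _ ⟨fun _ => X.pt⟩

/-! ### The geometric groups -/

/-- The map `X^κ → X^ι` whose `i`-th coordinate is the `φ i`-th coordinate of the argument, or the
base point if `φ` deletes `i`. -/
def coordMap (X : PtdCG.{u}) {ι κ : Type} (φ : ι → Option κ) : PMap (X.pow κ) (X.pow ι) :=
  ⟨⟨fun v => ⟨fun i => (φ i).elim X.pt v.coord⟩, by
    refine continuous_KPow (W := KPow κ X) fun i => ?_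
    cases h : φ i with
    | none => simpa [h] using continuous_const
    | some k => simpa [h] using continuous_coord k⟩, by
    refine congrArg KPow.mk (funext fun i => ?_)
    change (φ i).elim X.pt (fun _ => X.pt) = X.pt
    cases φ i <;> rfl⟩

/-- The homomorphism `[X^ι, J(X)] → [X^κ, J(X)]` induced by `coordMap φ`. -/
noncomputable def coordPullback (X : PtdCG.{u}) {ι κ : Type} (φ : ι → Option κ) :
    HClass (X.pow ι) X.James →* HClass (X.pow κ) X.James :=
  pullback X.James (X.coordMap φ)

/-- The coordinate projection `p_i : X^ι → X`. -/
def proj (X : PtdCG.{u}) {ι : Type} (i : ι) : PMap (X.pow ι) X :=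
  ⟨⟨fun v => v.coord i, continuous_coord i⟩, rfl⟩

/-- The class `x_i ∈ [X^ι, J(X)]` of the composite of `p_i : X^ι → X` with `E : X → J(X)`. -/
noncomputable def xClass (X : PtdCG.{u}) {ι : Type} (i : ι) : HClass (X.pow ι) X.James :=
  pullback X.James (X.proj i) ⟦X.jamesIncl⟧

/-- The subgroup `K_n(X)` of `[X^n, J(X)]` generated by the classes `x_i` (the subgroup generated
inside the group of invertible elements). -/
noncomputable def KGeo (X : PtdCG.{u}) (ι : Type) : Submonoid (HClass (X.pow ι) X.James) :=
  (Subgroup.closure {a : (HClass (X.pow ι) X.James)ˣ | ∃ i : ι, a.val = X.xClass i}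
    ).toSubmonoid.map (Units.coeHom _)

/-- The quotient map `X^{ln} → X^{(l)} × ⋯ × X^{(l)} → J_n(X^{(l)})`. -/
noncomputable def quotMap (X : PtdCG.{u}) (l n : ℕ) :
    PMap (X.pow (Fin n × Fin l)) ((X.smash l).JamesFil n) :=
  ⟨⟨fun v => Quotient.mk _ ⟨fun s => Quotient.mk (X.smashSetoid l) ⟨fun j => v.coord (s, j)⟩⟩, by
    refine continuous_quotient_mk'.comp
      (continuous_KPow (W := KPow (Fin n × Fin l) X) (X := X.smash l) fun s => ?_)
    exact continuous_quotient_mk'.comp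
      (continuous_KPow (W := KPow (Fin n × Fin l) X) (X := X) fun j => continuous_coord (s, j))⟩, rfl⟩

/-- The homomorphism `[J_n(X^{(l)}), J(X)] → [X^{ln}, J(X)]` induced by the quotient map. -/
noncomputable def quotPullback (X : PtdCG.{u}) (l n : ℕ) :
    HClass ((X.smash l).JamesFil n) X.James →* HClass (X.pow (Fin n × Fin l)) X.James :=
  pullback X.James (X.quotMap l n)

/-- The group `H_n^{(l)}(X)`: the classes in `[J_n(X^{(l)}), J(X)]` whose image `α` in
`[X^{ln}, J(X)]` lies in `K_{ln}(X)` and satisfies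
* restricting one coordinate of a block to the base point has the same effect on `α` as
  restricting the whole block to the base point, and
* `D_0 α = ⋯ = D_{n-1} α`, where `D_s : [X^{ln}, J(X)] → [X^{l(n-1)}, J(X)]` restricts to the
  subspace where all coordinates of the `s`-th block are the base point. -/
noncomputable def HGeo (X : PtdCG.{u}) (l n : ℕ) :
    Submonoid (HClass ((X.smash l).JamesFil n) X.James) where
  carrier := {β | X.quotPullback l n β ∈ X.KGeo (Fin n × Fin l) ∧
    (∀ s j, X.coordPullback (killIdx {(s, j)}) (X.quotPullback l n β) =
      X.coordPullback (killIdx (block s)) (X.quotPullback l n β)) ∧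
    ∀ s t, X.coordPullback (deleteBlock s) (X.quotPullback l n β) =
      X.coordPullback (deleteBlock t) (X.quotPullback l n β)}
  mul_mem' := by
    rintro a b ⟨h0, h1, h2⟩ ⟨h3, h4, h5⟩
    refine ⟨?_, fun s j => ?_, fun s t => ?_⟩
    · rw [map_mul]
      exact mul_mem h0 h3
    · rw [map_mul, map_mul, map_mul, h1, h4]
    · rw [map_mul, map_mul, map_mul, h2 s t, h5 s t]
  one_mem' := by
    refine ⟨?_, fun s j => ?_, fun s t => ?_⟩
    · rw [map_one]
      exact one_mem _
    · rw [map_one, map_one, map_one]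
    · rw [map_one, map_one, map_one]

end PtdCG

/-!
A null homotopy of the reduced diagonal contracts, near every point of `X`, some coordinate of the
diagonal: `X` is covered by open sets over which the inclusion of a neighbourhood into `X` is
homotopic to a constant. Over these sets a pointed map from `X` to a topological monoid has a right
homotopy inverse, and Dold's section extension argument glues such local inverses. The resulting
map `X → J(X)` extends to an antihomomorphism of `J(X)`, which is a right homotopy inverse of the
identity because the contractions of the letters of a word can be run from the inside out. Hence
`[Y, J(X)]` is a group.

A class on `X^ι` that is trivial where the `i`-th coordinate is `*` is represented by a map that is
trivial near that subspace. The commutator of two such maps factors through the reduced diagonal in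
the `i`-th coordinate, so the two classes commute. The classes in question thus form an abelian
normal subgroup containing `x_i`, and this implies the relations of the Cohen group.

For the lift to the stage `J_n` one shows that `q^*` is injective and that its image contains all
the classes satisfying (a) and (b). Both are inductions on `n` through a correction that is trivial
on the fat wedge of `X^{ln}`; a map trivial there extends to `J(X^{(l)})` as a James–Hopf invariant
does, by multiplying its values over the subwords of length `n`.
-/

namespace PtdCG

section CompactlyGenerated

lemma compactlyGenerated_of_isOpen {W : Type u} [TopologicalSpace W] [CompactlyGeneratedSpace W]
    {U : Set W} (hU : IsOpen U) : CompactlyGeneratedSpace U := by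
  refine compactlyGeneratedSpace_of_isOpen fun s hs => ?_
  suffices h : IsOpen (Subtype.val '' s) by
    rw [← Set.preimage_image_eq s Subtype.val_injective]
    exact h.preimage continuous_subtype_val
  refine CompactlyGeneratedSpace.isOpen' fun S _ _ _ g hg => isOpen_iff_mem_nhds.2 fun p hp => ?_
  obtain ⟨⟨_, hpU⟩, hps, rfl⟩ := hp
  obtain ⟨C, hC, hCc, hCU⟩ := exists_mem_nhds_isCompact_mapsTo hg (hU.mem_nhds hpU)
  have : CompactSpace C := isCompact_iff_compactSpace.1 hCc
  obtain ⟨O, hO, hOs⟩ := isOpen_induced_iff.1 <| hs C (fun c => ⟨g c.1, hCU c.2⟩)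
    ((hg.comp continuous_subtype_val).subtype_mk fun c => hCU c.2)
  have hOs' (x : C) : x.1 ∈ O ↔ (⟨g x.1, hCU x.2⟩ : U) ∈ s := Set.ext_iff.1 hOs x
  have hpO : p ∈ O := (hOs' ⟨p, mem_of_mem_nhds hC⟩).2 hps
  filter_upwards [hC, hO.mem_nhds hpO] with x hx hxO
  exact ⟨_, (hOs' ⟨x, hx⟩).1 hxO, rfl⟩

lemma compactlyGenerated_prod_left (K Y : Type u) [TopologicalSpace Y] [CompactlyGeneratedSpace Y]
    [TopologicalSpace K] [CompactSpace K] [T2Space K] : CompactlyGeneratedSpace (K × Y) := by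
  have := compactlyGenerated_prod Y K
  refine compactlyGeneratedSpace_of_continuous_maps fun {T} _ f hf => ?_
  have hswap : Continuous fun p : Y × K => f (p.2, p.1) :=
    continuous_from_compactlyGeneratedSpace _ fun S _ _ _ g hg =>
      hf S (fun s => ((g s).2, (g s).1)) (by fun_prop)
  exact hswap.comp continuous_swap

lemma compactlyGenerated_prod_of_locallyCompact (Y : Type u) (K : Type) [TopologicalSpace Y]
    [CompactlyGeneratedSpace Y] [TopologicalSpace K] [LocallyCompactSpace K] [T2Space K] :
    CompactlyGeneratedSpace (Y × K) := by
  have hK : LocallyCompactSpace (ULift.{u} K) :=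
    Homeomorph.ulift.isClosedEmbedding.locallyCompactSpace
  refine compactlyGeneratedSpace_of_continuous_maps fun {T} _ f hf => ?_
  have hslice (y : Y) : Continuous fun k => f (y, k) := by
    have : Continuous fun k : ULift.{u} K => f (y, k.down) :=
      continuous_from_compactlyGeneratedSpace _ fun S _ _ _ g hg =>
        hf S (fun s => (y, (g s).down)) (by fun_prop)
    exact this.comp continuous_uliftUp
  let F : Y → C(K, T) := fun y => ⟨fun k => f (y, k), hslice y⟩
  have hF : Continuous F := by
    refine continuous_from_compactlyGeneratedSpace _ fun L _ _ _ g hg => ?_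
    refine ContinuousMap.continuous_of_continuous_uncurry _ ?_
    have : Continuous fun p : L × ULift.{u} K => f (g p.1, p.2.down) :=
      continuous_from_compactlyGeneratedSpace _ fun S _ _ _ g' hg' =>
        hf S (fun s => (g (g' s).1, (g' s).2.down)) (by fun_prop)
    exact this.comp (f := fun p : L × K => (p.1, ULift.up p.2)) (by fun_prop)
  exact ContinuousMap.continuous_uncurry_of_continuous ⟨F, hF⟩

instance (Y : Type u) [TopologicalSpace Y] [CompactlyGeneratedSpace Y] :
    CompactlyGeneratedSpace (Y × ℝ) := compactlyGenerated_prod_of_locallyCompact Y ℝ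

instance (Y : Type u) [TopologicalSpace Y] [CompactlyGeneratedSpace Y] :
    CompactlyGeneratedSpace (Y × unitInterval) := compactlyGenerated_prod_of_locallyCompact Y _

/-- The parameter space `S` and the family `g` are what makes the induction on `m` go through: one
coordinate is descended at a time, the others being absorbed into `S`. -/
lemma continuous_comp_of_isQuotientMap {A B : Type u} [TopologicalSpace A] [TopologicalSpace B]
    [CompactlyGeneratedSpace A] {p : A → B} (hp : IsQuotientMap p) {T : Type*}
    [TopologicalSpace T] (m : ℕ) : ∀ (S : Type u) [TopologicalSpace S] [CompactSpace S] [T2Space S]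
    (F : S → (Fin m → B) → T),
    (Continuous fun q : S × KPow (Fin m) A => F q.1 fun i => p (q.2 i)) →
    ∀ g : S → Fin m → B, Continuous g → Continuous fun s => F s (g s) := by
  induction m with
  | zero =>
    intro S _ _ _ F hF g _
    have hpair : Continuous fun s : S => (s, (⟨Fin.elim0⟩ : KPow (Fin 0) A)) := by fun_prop
    exact (hF.comp hpair).congr fun s => congrArg (F s) (Subsingleton.elim _ _)
  | succ m ih =>
    intro S _ _ _ F hF g hg
    have hfirst : Continuous fun q : S × B => F q.1 (Fin.cons q.2 fun i => g q.1 i.succ) := by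
      refine hp.continuous_lift_prod_right ?_
      have : CompactlyGeneratedSpace (S × A) := compactlyGenerated_prod_left _ _
      refine continuous_from_compactlyGeneratedSpace _ fun S' _ _ _ e he => ?_
      refine ih S' (fun s' c => F (e s').1 (Fin.cons (p (e s').2) c)) ?_
        (fun s' i => g (e s').1 i.succ) (by fun_prop)
      have : CompactlyGeneratedSpace (S' × KPow (Fin m) A) := compactlyGenerated_prod_left _ _
      have hcons : Continuous fun q : S' × KPow (Fin m) A =>
          (⟨Fin.cons (e q.1).2 q.2.coord⟩ : KPow (Fin (m + 1)) A) := by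
        refine continuous_KPow fun i => Fin.cases ?_ (fun i => ?_) i
        · exact continuous_snd.comp (he.comp continuous_fst)
        · exact (continuous_coord i).comp continuous_snd
      refine (hF.comp ((continuous_fst.comp (he.comp continuous_fst)).prodMk hcons)).congr
        fun q => congrArg (F _) (funext fun i => ?_)
      exact Fin.cases rfl (fun _ => rfl) i
    have hzero : Continuous fun s => (s, g s 0) := by fun_prop
    exact (hfirst.comp hzero).congr fun s => congrArg (F s) (Fin.cons_self_tail (g s))

lemma continuous_KPow_of_isQuotientMap {A B : Type u} [TopologicalSpace A] [TopologicalSpace B]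
    [CompactlyGeneratedSpace A] {p : A → B} (hp : IsQuotientMap p) {T : Type*}
    [TopologicalSpace T] {m : ℕ} {F : KPow (Fin m) B → T}
    (hF : Continuous fun v : KPow (Fin m) A => F ⟨fun i => p (v i)⟩) : Continuous F :=
  continuous_from_KPow fun S _ _ _ g hg =>
    continuous_comp_of_isQuotientMap hp m S (fun _ c => F ⟨c⟩) (hF.comp continuous_snd) g hg

end CompactlyGenerated

end PtdCG

/-! ### Dold's section extension property -/

section SectionExtension

/-- A local notion of section: `IsSection U s` says that `s : Y → E` restricts to a section of the
kind in question over `U`; values outside `U` are irrelevant. -/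
structure LocalSections (Y E : Type*) [TopologicalSpace Y] where
  IsSection : Set Y → (Y → E) → Prop
  of_locally_eq : ∀ {U s}, (∀ x ∈ U, ∃ O, IsOpen O ∧ x ∈ O ∧ ∃ s', IsSection O s' ∧
    Set.EqOn s s' O) → IsSection U s

namespace LocalSections

variable {Y E : Type*} [TopologicalSpace Y] {S : LocalSections Y E} {U V : Set Y}

lemma IsSection.mono {s : Y → E} (h : S.IsSection U s) (hU : IsOpen U) (hVU : V ⊆ U) :
    S.IsSection V s :=
  S.of_locally_eq fun _ hx => ⟨U, hU, hVU hx, s, h, fun _ _ => rfl⟩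

/-- Dold's section extension property over `B`: the sections over open subsets of `B` deform into
a fixed section over `B`, with the stage of the deformation prescribed by a function `σ`. -/
def Shrinkable (S : LocalSections Y E) (B : Set Y) : Prop :=
  ∃ c, S.IsSection B c ∧ ∀ U ⊆ B, IsOpen U → ∀ s, S.IsSection U s → ∀ σ : Y → ℝ,
    ContinuousOn σ U → ∃ s', S.IsSection U s' ∧
      ∀ x ∈ U, (σ x ≤ 0 → s' x = s x) ∧ (1 ≤ σ x → s' x = c x)

lemma Shrinkable.mono (h : S.Shrinkable U) (hU : IsOpen U) (hVU : V ⊆ U) : S.Shrinkable V := by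
  obtain ⟨c, hc, hdef⟩ := h
  exact ⟨c, hc.mono hU hVU, fun W hW => hdef W (hW.trans hVU)⟩

open Classical in
lemma isSection_ite {a b : Y → ℝ} (ha : Continuous a) (hb : Continuous b) (ha0 : ∀ x, 0 ≤ a x)
    (hb0 : ∀ x, 0 ≤ b x) {s c t : Y → E} (hs : S.IsSection {x | 0 < a x} s)
    (hc : S.IsSection {x | 0 < b x} c) (ht : S.IsSection ({x | 0 < a x} ∩ {x | 0 < b x}) t)
    (hts : ∀ x, 0 < a x → 0 < b x → 3 * b x ≤ a x → t x = s x)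
    (htc : ∀ x, 0 < a x → 0 < b x → 3 * a x ≤ b x → t x = c x) :
    S.IsSection {x | 0 < a x + b x}
      fun x => if 3 * b x ≤ a x then s x else if 3 * a x ≤ b x then c x else t x := by
  have hApos : IsOpen {x | 0 < a x} := isOpen_lt continuous_const ha
  have hBpos : IsOpen {x | 0 < b x} := isOpen_lt continuous_const hb
  refine S.of_locally_eq fun x (hx : 0 < a x + b x) => ?_
  rcases lt_or_ge (3 * b x) (a x) with hba | hba
  · exact ⟨{y | 3 * b y < a y}, isOpen_lt (by fun_prop) ha, hba, s,
      hs.mono hApos fun y (hy : 3 * b y < a y) => lt_of_le_of_lt (by linarith [hb0 y]) hy,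
      fun y hy => if_pos (le_of_lt hy)⟩
  rcases lt_or_ge (3 * a x) (b x) with hab | hab
  · refine ⟨{y | 3 * a y < b y}, isOpen_lt (by fun_prop) hb, hab, c,
      hc.mono hBpos fun y (hy : 3 * a y < b y) => lt_of_le_of_lt (by linarith [ha0 y]) hy,
      fun y (hy : 3 * a y < b y) => ?_⟩
    have hba : ¬ 3 * b y ≤ a y := by linarith [ha0 y]
    exact (if_neg hba).trans (if_pos hy.le)
  have hax : 0 < a x := by linarith
  have hbx : 0 < b x := by linarith
  refine ⟨_, hApos.inter hBpos, ⟨hax, hbx⟩, t, ht, fun y hy => ?_⟩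
  dsimp only
  split_ifs with hsmall hlarge
  · exact (hts y hy.1 hy.2 hsmall).symm
  · exact (htc y hy.1 hy.2 hlarge).symm
  · rfl

lemma exists_isSection_add {a b : Y → ℝ} (ha : Continuous a) (hb : Continuous b)
    (ha0 : ∀ x, 0 ≤ a x) (hb0 : ∀ x, 0 ≤ b x) {s : Y → E} (hs : S.IsSection {x | 0 < a x} s)
    (hB : S.Shrinkable {x | 0 < b x}) :
    ∃ s', S.IsSection {x | 0 < a x + b x} s' ∧ ∀ x, 3 * b x ≤ a x → s' x = s x := by
  classical
  have hApos : IsOpen {x | 0 < a x} := isOpen_lt continuous_const ha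
  have hBpos : IsOpen {x | 0 < b x} := isOpen_lt continuous_const hb
  obtain ⟨c, hc, hdef⟩ := hB
  have hσ : ContinuousOn (fun x => 2 * b x / (a x + b x) - 1 / 2)
      ({x | 0 < a x} ∩ {x | 0 < b x}) :=
    ((continuous_const.mul hb).continuousOn.div (ha.add hb).continuousOn
      fun x hx => (add_pos hx.1 hx.2).ne').sub continuousOn_const
  obtain ⟨t, ht, hts⟩ := hdef ({x | 0 < a x} ∩ {x | 0 < b x}) Set.inter_subset_right
    (hApos.inter hBpos) s (hs.mono hApos Set.inter_subset_left) _ hσ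
  refine ⟨_, isSection_ite ha hb ha0 hb0 hs hc ht (fun x hax hbx hba => (hts x ⟨hax, hbx⟩).1 ?_)
    fun x hax hbx hab => (hts x ⟨hax, hbx⟩).2 ?_, fun x hx => if_pos hx⟩
  · rw [sub_nonpos, div_le_iff₀ (add_pos hax hbx)]
    linarith
  · rw [le_sub_iff_add_le, le_div_iff₀ (add_pos hax hbx)]
    linarith

/-- The functions `max 0 (w i - i * ∑ j < i, w j)`, where `w i` is `u i` clamped to `[0, 1]`, do the
job. -/
lemma exists_locallyFinite_pos {u : ℕ → Y → ℝ} (hu : ∀ i, Continuous (u i))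
    (hpos : ∀ x, ∃ i, 0 < u i x) :
    ∃ v : ℕ → Y → ℝ, (∀ i, Continuous (v i)) ∧ (∀ i x, 0 ≤ v i x) ∧
      (∀ i x, 0 < v i x → 0 < u i x) ∧ (∀ x, ∃ i, 0 < v i x) ∧
      ∀ x, ∃ O, IsOpen O ∧ x ∈ O ∧ ∃ n, ∀ y ∈ O, ∀ i ≥ n, v i y = 0 := by
  classical
  let w : ℕ → Y → ℝ := fun i x => max 0 (min (u i x) 1)
  have hw (i) : Continuous (w i) := continuous_const.max ((hu i).min continuous_const)
  have hw0 (i x) : 0 ≤ w i x := le_max_left _ _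
  have hw1 (i x) : w i x ≤ 1 := max_le zero_le_one (min_le_right _ _)
  have hwpos (i x) : 0 < w i x ↔ 0 < u i x := by simp [w]
  refine ⟨fun i x => max 0 (w i x - i * ∑ j ∈ Finset.range i, w j x),
    fun i => by fun_prop, fun i x => le_max_left _ _, fun i x h => ?_, fun x => ?_, fun x => ?_⟩
  · have hsum : 0 ≤ i * ∑ j ∈ Finset.range i, w j x :=
      mul_nonneg i.cast_nonneg (Finset.sum_nonneg fun j _ => hw0 j x)
    have : 0 < w i x - i * ∑ j ∈ Finset.range i, w j x := by simpa using h
    exact (hwpos i x).1 (by linarith)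
  · have hex : ∃ i, 0 < w i x := by simpa only [hwpos] using hpos x
    have hsum : ∑ j ∈ Finset.range (Nat.find hex), w j x = 0 := Finset.sum_eq_zero fun j hj =>
      le_antisymm (not_lt.1 (Nat.find_min hex (Finset.mem_range.1 hj))) (hw0 j x)
    exact ⟨Nat.find hex, by simpa [hsum] using Nat.find_spec hex⟩
  · obtain ⟨i, hi⟩ := hpos x
    obtain ⟨n, hn⟩ := exists_nat_one_div_lt ((hwpos i x).2 hi)
    refine ⟨{y | 1 / ((n : ℝ) + 1) < w i y}, isOpen_lt continuous_const (hw i), hn,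
      max (i + 1) (n + 1), fun y (hy : 1 / ((n : ℝ) + 1) < w i y) k hk =>
      max_eq_left (sub_nonpos.2 ?_)⟩
    have hik : i < k := le_of_max_le_left hk
    have hnk : (n : ℝ) + 1 ≤ k := by exact_mod_cast le_of_max_le_right hk
    have hsum : w i y ≤ ∑ j ∈ Finset.range k, w j y :=
      Finset.single_le_sum (f := fun j => w j y) (fun j _ => hw0 j y) (Finset.mem_range.2 hik)
    calc w k y ≤ 1 := hw1 k y
      _ ≤ ((n : ℝ) + 1) * w i y := by
        rw [div_lt_iff₀ (by positivity), mul_comm] at hy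
        exact hy.le
      _ ≤ k * ∑ j ∈ Finset.range k, w j y := by gcongr

theorem exists_isSection_univ {u : ℕ → Y → ℝ} (hu : ∀ i, Continuous (u i))
    (hpos : ∀ x, ∃ i, 0 < u i x) (hS : ∀ i, S.Shrinkable {x | 0 < u i x}) :
    ∃ s, S.IsSection Set.univ s := by
  obtain ⟨v, hv, hv0, hvu, hvpos, hfin⟩ := exists_locallyFinite_pos hu hpos
  have hvS (i) : S.Shrinkable {x | 0 < v i x} :=
    (hS i).mono (isOpen_lt continuous_const (hu i)) fun x => hvu i x
  let a : ℕ → Y → ℝ := fun k x => ∑ i ∈ Finset.range k, v i x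
  have ha (k) : Continuous (a k) := by fun_prop
  have ha0 (k x) : 0 ≤ a k x := Finset.sum_nonneg fun i _ => hv0 i x
  have hstep (k) (s : {s // S.IsSection {x | 0 < a k x} s}) :
      ∃ s' : {s // S.IsSection {x | 0 < a (k + 1) x} s},
        ∀ x, 3 * v k x ≤ a k x → s'.1 x = s.1 x := by
    obtain ⟨s', hs', heq⟩ := exists_isSection_add (ha k) (hv k) (ha0 k) (hv0 k) s.2 (hvS k)
    exact ⟨⟨s', by simpa only [a, Finset.sum_range_succ] using hs'⟩, heq⟩
  choose next hnext using hstep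
  obtain ⟨c, -⟩ := hS 0
  let s : ∀ k, {s // S.IsSection {x | 0 < a k x} s} := fun k =>
    k.rec ⟨c, S.of_locally_eq fun x hx => absurd (show 0 < a 0 x from hx) (by simp [a])⟩ next
  choose O hO hxO n hn using hfin
  have hapos {x y} (hy : y ∈ O x) {k} (hk : n x ≤ k) : 0 < a k y := by
    obtain ⟨i, hi⟩ := hvpos y
    have hik : i < k := by
      by_contra! hki
      exact hi.ne' (hn x y hy i (hk.trans hki))
    exact hi.trans_le
      (Finset.single_le_sum (f := fun i => v i y) (fun i _ => hv0 i y) (Finset.mem_range.2 hik))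
  have hstable {x y} (hy : y ∈ O x) {k} (hk : n x ≤ k) : (s k).1 y = (s (n x)).1 y := by
    induction k, hk using Nat.le_induction with
    | base => rfl
    | succ k hk ih =>
      rw [← ih]
      exact hnext k (s k) y (by rw [hn x y hy k hk, mul_zero]; exact (hapos hy hk).le)
  refine ⟨fun x => (s (n x)).1 x, S.of_locally_eq fun x _ => ⟨O x, hO x, hxO x, (s (n x)).1,
    (s (n x)).2.mono (isOpen_lt continuous_const (ha _)) fun y hy => hapos hy le_rfl,
    fun y hy => ?_⟩⟩
  change (s (n y)).1 y = (s (n x)).1 y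
  rw [← hstable (hxO y) (le_max_left (n y) (n x)), ← hstable hy (le_max_right (n y) (n x))]

end LocalSections

end SectionExtension

namespace PtdCG

/-! ### The homotopy inverse of the James construction -/

section RightInverse

lemma continuousOn_prod_univ_iff {Y Z T : Type*} [TopologicalSpace Y] [TopologicalSpace Z]
    [TopologicalSpace T] {g : Y × Z → T} {U : Set Y} :
    ContinuousOn g (U ×ˢ Set.univ) ↔ Continuous fun p : U × Z => g (p.1, p.2) := by
  refine ⟨fun h => h.comp_continuous (by fun_prop) fun p => ⟨p.1.2, trivial⟩, fun h => ?_⟩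
  rw [continuousOn_iff_continuous_domRestrict]
  exact h.comp (f := fun p : ↥(U ×ˢ (Set.univ : Set Z)) => ((⟨p.1.1, p.2.1⟩ : U), p.1.2))
    (by fun_prop)

variable {M : PtdCG.{u}} [CGMonoid M]

/-- The value at one point of a right homotopy inverse of an `M`-valued function: an element of `M`
and a path along which its product with the given function is contracted to `1`. Paths have the
real line as their domain, so that they can be reparametrised freely. -/
@[ext]
structure RightInv (M : PtdCG.{u}) where
  inv : M
  path : ℝ → M

namespace RightInv

/-- `d` is a right inverse of `a`, up to the path `d.path`, run through in the interval `[0, 1]`. -/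
structure IsInverseOf (d : RightInv M) (a : M) : Prop where
  path_of_nonpos : ∀ t ≤ 0, d.path t = a * d.inv
  path_of_one_le : ∀ t, 1 ≤ t → d.path t = 1

/-- For a contraction `F` of `a` to `1` and a right inverse `d` of `a`, the path from `d.inv` to
`1` that runs backwards through `F * d.inv` and then through `d.path`. -/
noncomputable def connect (F : ℝ → M) (d : RightInv M) (s : ℝ) : M :=
  if s ≤ 1 then F (1 - s) * d.inv else d.path (s - 1)

/-- The deformation of a right inverse `d` of `a` into the one given by a contraction `F` of `a` to
`1`. First `b` runs from `0` to `1`, inserting the path `F * d.inv` and its reverse in front of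
`d.path`; then `ρ` does, moving the inverse along `connect F d`. The factor
`2 * (1 - ρ) + 2 * b - 1` is the total length of the path before it is normalised. -/
noncomputable def deform (F : ℝ → M) (d : RightInv M) (b ρ : ℝ) : RightInv M where
  inv := d.connect F (2 * ρ)
  path t :=
    if (2 * (1 - ρ) + 2 * b - 1) * t ≤ b then
      F ((2 * (1 - ρ) + 2 * b - 1) * t) * d.connect F (2 * ρ)
    else d.connect F ((2 * (1 - ρ) + 2 * b - 1) * t + 2 * ρ - 2 * b + 1)

variable {a : M} {F : ℝ → M} {d : RightInv M}

lemma contraction_of_nonpos (hF : (mk 1 F).IsInverseOf a) {t : ℝ} (ht : t ≤ 0) : F t = a :=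
  (hF.path_of_nonpos t ht).trans (mul_one a)

lemma contraction_of_one_le (hF : (mk 1 F).IsInverseOf a) {t : ℝ} (ht : 1 ≤ t) : F t = 1 :=
  hF.path_of_one_le t ht

lemma connect_zero (hF : (mk 1 F).IsInverseOf a) : d.connect F 0 = d.inv := by
  rw [connect, if_pos zero_le_one, sub_zero, contraction_of_one_le hF le_rfl,
    one_mul]

lemma connect_of_two_le (hd : d.IsInverseOf a) {s : ℝ} (hs : 2 ≤ s) : d.connect F s = 1 := by
  rw [connect, if_neg (by linarith), hd.path_of_one_le _ (by linarith)]

lemma contraction_zero_mul_inv (hF : (mk 1 F).IsInverseOf a) (hd : d.IsInverseOf a) :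
    F 0 * d.inv = d.path 0 := by
  rw [contraction_of_nonpos hF le_rfl, hd.path_of_nonpos 0 le_rfl]

lemma contraction_mul_connect (hF : (mk 1 F).IsInverseOf a) {b ρ : ℝ} (hb : 0 ≤ b)
    (hbρ : b = 1 ∨ ρ = 0) : F b * d.connect F (2 * ρ) = d.connect F (2 * ρ + 1 - b) := by
  rcases hbρ with rfl | rfl
  · rw [contraction_of_one_le hF le_rfl, one_mul, add_sub_cancel_right]
  · rw [mul_zero, connect_zero hF, connect, if_pos (by linarith)]
    ring_nf

lemma deform_isInverseOf (hF : (mk 1 F).IsInverseOf a) (hd : d.IsInverseOf a) {b ρ : ℝ}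
    (hb : 0 ≤ b) (hρ : ρ ≤ 1) (hbρ : b = 1 ∨ ρ = 0) : (d.deform F b ρ).IsInverseOf a := by
  have hlen : b ≤ 2 * (1 - ρ) + 2 * b - 1 ∧ 0 < 2 * (1 - ρ) + 2 * b - 1 := by
    rcases hbρ with rfl | rfl <;> constructor <;> linarith
  refine ⟨fun t ht => ?_, fun t ht => ?_⟩
  · have hle : (2 * (1 - ρ) + 2 * b - 1) * t ≤ 0 := mul_nonpos_of_nonneg_of_nonpos hlen.2.le ht
    simp only [deform]
    rw [if_pos (hle.trans hb), contraction_of_nonpos hF hle]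
  · have hle : 2 * (1 - ρ) + 2 * b - 1 ≤ (2 * (1 - ρ) + 2 * b - 1) * t :=
      le_mul_of_one_le_right hlen.2.le ht
    simp only [deform]
    split_ifs with h
    · rw [le_antisymm h (hlen.1.trans hle), contraction_mul_connect hF hb hbρ,
        connect_of_two_le hd (by linarith [hle.trans h])]
    · exact connect_of_two_le hd (by linarith)

lemma deform_zero_zero (hF : (mk 1 F).IsInverseOf a) (hd : d.IsInverseOf a) :
    d.deform F 0 0 = d := by
  have hlen : 2 - 1 = (1 : ℝ) := by norm_num
  refine RightInv.ext ?_ (funext fun t => ?_)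
  · exact (congrArg (d.connect F) (mul_zero 2)).trans (connect_zero hF)
  · simp only [deform, mul_zero, connect_zero hF, sub_zero, mul_one, hlen, one_mul, add_zero]
    split_ifs with ht
    · rw [contraction_of_nonpos hF ht, hd.path_of_nonpos t ht]
    · rw [connect, if_neg (by linarith), add_sub_cancel_right]

lemma deform_one_one (hF : (mk 1 F).IsInverseOf a) (hd : d.IsInverseOf a) :
    d.deform F 1 1 = ⟨1, F⟩ := by
  have htwo : d.connect F 2 = 1 := connect_of_two_le hd le_rfl
  have hlen : 2 * (1 - 1) + 2 - 1 = (1 : ℝ) := by norm_num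
  refine RightInv.ext ((congrArg (d.connect F) (mul_one 2)).trans htwo) (funext fun t => ?_)
  simp only [deform, mul_one, hlen, one_mul, htwo]
  split_ifs with ht
  · rfl
  · rw [connect_of_two_le hd (by linarith), contraction_of_one_le hF (by linarith)]

lemma deform_trivial (b ρ : ℝ) :
    (mk 1 fun _ => (1 : M)).deform (fun _ => 1) b ρ = ⟨1, fun _ => 1⟩ := by
  simp only [deform, connect, mul_one, ite_self]

section Continuity

variable {W : Type u} [TopologicalSpace W] [CompactlyGeneratedSpace W] {F : W → ℝ → M}
  {d : W → RightInv M} {a : W → M}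

lemma continuous_connect (hF : Continuous fun p : W × ℝ => F p.1 p.2)
    (hinv : Continuous fun w => (d w).inv) (hpath : Continuous fun p : W × ℝ => (d p.1).path p.2)
    (hFa : ∀ w, (mk 1 (F w)).IsInverseOf (a w)) (hda : ∀ w, (d w).IsInverseOf (a w)) {s : W → ℝ}
    (hs : Continuous s) : Continuous fun w => (d w).connect (F w) (s w) := by
  refine Continuous.if_le ?_ ?_ hs continuous_const fun w hw => ?_
  · exact CGMonoid.continuous_mul
      (hF.comp (f := fun w => (w, 1 - s w)) (by fun_prop)) hinv
  · exact hpath.comp (f := fun w => (w, s w - 1)) (by fun_prop)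
  · rw [hw, sub_self, contraction_zero_mul_inv (hFa w) (hda w)]

lemma continuous_deform_path (hF : Continuous fun p : W × ℝ => F p.1 p.2)
    (hinv : Continuous fun w => (d w).inv) (hpath : Continuous fun p : W × ℝ => (d p.1).path p.2)
    (hFa : ∀ w, (mk 1 (F w)).IsInverseOf (a w)) (hda : ∀ w, (d w).IsInverseOf (a w))
    {b ρ : W → ℝ} (hb : Continuous b) (hρ : Continuous ρ) (hb0 : ∀ w, 0 ≤ b w)
    (hbρ : ∀ w, b w = 1 ∨ ρ w = 0) :
    Continuous fun p : W × ℝ => ((d p.1).deform (F p.1) (b p.1) (ρ p.1)).path p.2 := by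
  have hconnect {s : W × ℝ → ℝ} (hs : Continuous s) :
      Continuous fun p : W × ℝ => (d p.1).connect (F p.1) (s p) :=
    continuous_connect (W := W × ℝ) (F := fun p => F p.1) (d := fun p => d p.1)
      (hF.comp (f := fun q : (W × ℝ) × ℝ => (q.1.1, q.2)) (by fun_prop)) (hinv.comp continuous_fst)
      (hpath.comp (f := fun q : (W × ℝ) × ℝ => (q.1.1, q.2)) (by fun_prop)) (fun p => hFa p.1)
      (fun p => hda p.1) hs
  refine Continuous.if_le (CGMonoid.continuous_mul ?_ (hconnect (by fun_prop)))
    (hconnect (by fun_prop)) (by fun_prop) (by fun_prop) fun p hp => ?_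
  · exact hF.comp
      (f := fun p : W × ℝ => (p.1, (2 * (1 - ρ p.1) + 2 * b p.1 - 1) * p.2)) (by fun_prop)
  · rw [hp, contraction_mul_connect (hFa _) (hb0 _) (hbρ _)]
    ring_nf

end Continuity

/-- Over `U`, the `s x` form a right homotopy inverse of `f` that is strictly trivial at the points
of `N`. -/
structure IsInverseOn {Y : Type*} [TopologicalSpace Y] (f : Y → M) (N U : Set Y)
    (s : Y → RightInv M) : Prop where
  continuousOn_inv : ContinuousOn (fun x => (s x).inv) U
  continuousOn_path : ContinuousOn (fun p : Y × ℝ => (s p.1).path p.2) (U ×ˢ Set.univ)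
  isInverseOf : ∀ x ∈ U, (s x).IsInverseOf (f x)
  eq_trivial : ∀ x ∈ U, x ∈ N → s x = ⟨1, fun _ => 1⟩

/-- The right homotopy inverses of `f`, strictly trivial on `N`, as a local notion of section. -/
def sections {Y : Type*} [TopologicalSpace Y] (f : Y → M) (N : Set Y) :
    LocalSections Y (RightInv M) where
  IsSection := IsInverseOn f N
  of_locally_eq {U s} h := by
    have : Nonempty (RightInv M) := ⟨⟨1, fun _ => 1⟩⟩
    choose! O hO hxO s' hs' heq using h
    have heqAt {x} (hx : x ∈ U) : s x = s' x x := heq x hx (hxO x hx)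
    refine ⟨fun x hx => ?_, fun p hp => ?_, fun x hx => ?_, fun x hx hxN => ?_⟩
    · exact (((hs' x hx).continuousOn_inv.congr fun y hy => by rw [heq x hx hy]).continuousAt
        ((hO x hx).mem_nhds (hxO x hx))).continuousWithinAt
    · exact (((hs' p.1 hp.1).continuousOn_path.congr fun y hy => by rw [heq p.1 hp.1 hy.1]
        ).continuousAt (((hO p.1 hp.1).prod isOpen_univ).mem_nhds
          ⟨hxO p.1 hp.1, trivial⟩)).continuousWithinAt
    · rw [heqAt hx]
      exact (hs' x hx).isInverseOf x (hxO x hx)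
    · rw [heqAt hx]
      exact (hs' x hx).eq_trivial x (hxO x hx) hxN

variable {Y : Type u} [TopologicalSpace Y] [CompactlyGeneratedSpace Y] {f : Y → M} {N U : Set Y}

lemma IsInverseOn.deform {F : Y → ℝ → M} {s : Y → RightInv M} {b ρ : Y → ℝ} (hU : IsOpen U)
    (hF : IsInverseOn f N U fun x => ⟨1, F x⟩) (hs : IsInverseOn f N U s)
    (hb : ContinuousOn b U) (hρ : ContinuousOn ρ U) (hb0 : ∀ x, 0 ≤ b x) (hρ1 : ∀ x, ρ x ≤ 1)
    (hbρ : ∀ x, b x = 1 ∨ ρ x = 0) :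
    IsInverseOn f N U fun x => (s x).deform (F x) (b x) (ρ x) := by
  have := compactlyGenerated_of_isOpen hU
  have hFc := continuousOn_prod_univ_iff.1 hF.continuousOn_path
  have hpath := continuousOn_prod_univ_iff.1 hs.continuousOn_path
  have hinv := continuousOn_iff_continuous_domRestrict.1 hs.continuousOn_inv
  have hb := continuousOn_iff_continuous_domRestrict.1 hb
  have hρ := continuousOn_iff_continuous_domRestrict.1 hρ
  have hFa (x : U) := hF.isInverseOf x x.2
  have hsa (x : U) := hs.isInverseOf x x.2
  refine ⟨continuousOn_iff_continuous_domRestrict.2 ?_, continuousOn_prod_univ_iff.2 ?_,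
    fun x hx => ?_, fun x hx hxN => ?_⟩
  · exact continuous_connect (W := U) (F := fun x => F x) (d := fun x => s x) hFc hinv hpath hFa hsa
      (continuous_const.mul hρ)
  · exact continuous_deform_path (W := U) (F := fun x => F x) (d := fun x => s x) hFc hinv hpath hFa
      hsa hb hρ (fun x => hb0 x) fun x => hbρ x
  · exact deform_isInverseOf (hF.isInverseOf x hx) (hs.isInverseOf x hx) (hb0 x) (hρ1 x) (hbρ x)
  · have hFx : F x = fun _ => 1 := congrArg path (hF.eq_trivial x hx hxN)
    rw [hs.eq_trivial x hx hxN, hFx, deform_trivial]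

lemma shrinkable_sections {B : Set Y} (hB : IsOpen B) {F : Y → ℝ → M}
    (hF : IsInverseOn f N B fun x => ⟨1, F x⟩) : (sections f N).Shrinkable B := by
  refine ⟨_, hF, fun U hUB hU s hs σ hσ => ?_⟩
  let clamp (r : ℝ) : ℝ := max 0 (min r 1)
  have hclamp : Continuous clamp := by fun_prop
  refine ⟨fun x => (s x).deform (F x) (clamp (2 * σ x)) (clamp (2 * σ x - 1)),
    IsInverseOn.deform hU (LocalSections.IsSection.mono (S := sections f N) hF hB hUB) hs
      (hclamp.comp_continuousOn (continuousOn_const.mul hσ))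
      (hclamp.comp_continuousOn ((continuousOn_const.mul hσ).sub continuousOn_const))
      (fun x => le_max_left _ _) (fun x => max_le zero_le_one (min_le_right _ _)) fun x => ?_,
    fun x hx => ⟨fun h => ?_, fun h => ?_⟩⟩
  · rcases le_total 1 (2 * σ x) with h | h
    · exact Or.inl (by simp [clamp, h])
    · exact Or.inr (max_eq_left ((min_le_left _ _).trans (by linarith)))
  · have hb : clamp (2 * σ x) = 0 := max_eq_left ((min_le_left _ _).trans (by linarith))
    have hρ : clamp (2 * σ x - 1) = 0 := max_eq_left ((min_le_left _ _).trans (by linarith))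
    dsimp only
    rw [hb, hρ, deform_zero_zero (hF.isInverseOf x (hUB hx)) (hs.isInverseOf x hx)]
  · have hb : clamp (2 * σ x) = 1 := by
      simp only [clamp, min_eq_right (show 1 ≤ 2 * σ x by linarith), max_eq_right zero_le_one]
    have hρ : clamp (2 * σ x - 1) = 1 := by
      simp only [clamp, min_eq_right (show 1 ≤ 2 * σ x - 1 by linarith), max_eq_right zero_le_one]
    dsimp only
    rw [hb, hρ, deform_one_one (hF.isInverseOf x (hUB hx)) (hs.isInverseOf x hx)]

end RightInv

end RightInverse

section FatWedge

/-- The fat wedge in `X^ι`: the points that have a coordinate equal to the base point. -/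
def fatWedge (X : PtdCG.{u}) (ι : Type) : Set (KPow ι X) := {v | ∃ i, v i = X.pt}

variable {X : PtdCG.{u}} {l : ℕ}

/-- The quotient map from `X^l` to the smash power. -/
def smashMk (v : KPow (Fin l) X) : X.smash l := Quotient.mk (X.smashSetoid l) v

lemma isQuotientMap_smashMk : IsQuotientMap (smashMk : KPow (Fin l) X → X.smash l) :=
  isQuotientMap_quotient_mk'

lemma smashMk_eq_iff {v w : KPow (Fin l) X} :
    smashMk v = smashMk w ↔ v = w ∨ v ∈ fatWedge X (Fin l) ∧ w ∈ fatWedge X (Fin l) :=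
  Quotient.eq (r := X.smashSetoid l)

/-- The function on the smash power induced by a function on `X^l` that is constant on the fat
wedge. -/
def smashLift {T : Type*} (g : KPow (Fin l) X → T) (c : T)
    (hg : ∀ v ∈ fatWedge X (Fin l), g v = c) : X.smash l → T :=
  Quotient.lift (s := X.smashSetoid l) g fun v w h => by
    obtain rfl | ⟨hv, hw⟩ := h
    · rfl
    · rw [hg v hv, hg w hw]

lemma continuous_smashLift {T : Type*} [TopologicalSpace T] {g : KPow (Fin l) X → T} {c : T}
    (hg : ∀ v ∈ fatWedge X (Fin l), g v = c) (hcont : Continuous g) :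
    Continuous (smashLift g c hg) :=
  Continuous.quotient_lift (s := X.smashSetoid l) hcont _

end FatWedge

section NDR

/-- The data making `(X, *)` an NDR pair, with a real valued function `ν`. -/
structure NDRData (X : PtdCG.{u}) where
  ν : X → ℝ
  h : C(X × unitInterval, X)
  ν_continuous : Continuous ν
  ν_nonneg : ∀ x, 0 ≤ ν x
  ν_le_one : ∀ x, ν x ≤ 1
  ν_eq_zero : ∀ x, ν x = 0 ↔ x = X.pt
  h_zero : ∀ x, h (x, 0) = x
  h_pt : ∀ t, h (X.pt, t) = X.pt
  h_one : ∀ x, ν x < 1 → h (x, 1) = X.pt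

variable {X : PtdCG.{u}}

lemma Nondegenerate.nonempty_NDRData (hX : X.Nondegenerate) : Nonempty X.NDRData := by
  obtain ⟨v, h, hv, h_zero, h_pt, h_one⟩ := hX
  exact ⟨⟨fun x => v x, h, by fun_prop, fun x => (v x).2.1, fun x => (v x).2.2,
    fun x => by rw [← hv x]; exact Set.Icc.coe_eq_zero, h_zero, h_pt, fun x hx => h_one x hx⟩⟩

namespace NDRData

attribute [fun_prop] ν_continuous

variable (D : X.NDRData)

lemma ν_pt : D.ν X.pt = 0 := (D.ν_eq_zero _).2 rfl

/-- The end of the deformation, retracting a neighbourhood of the base point to the base point. -/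
def r (x : X) : X := D.h (x, 1)

lemma continuous_r : Continuous D.r := D.h.continuous.comp (by fun_prop)

lemma r_pt : D.r X.pt = X.pt := D.h_pt 1

lemma r_eq_pt {x : X} (hx : D.ν x < 1) : D.r x = X.pt := D.h_one x hx

section WedgeDist

variable {ι : Type} [Fintype ι] [Nonempty ι]

/-- The distance of a point of `X^ι` to the fat wedge. -/
noncomputable def wedgeDist (v : KPow ι X) : ℝ :=
  Finset.univ.inf' Finset.univ_nonempty fun i => D.ν (v i)

lemma continuous_wedgeDist : Continuous (D.wedgeDist (ι := ι)) :=
  Continuous.finset_inf'_apply _ fun i _ => D.ν_continuous.comp (continuous_coord i)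

variable {D}

lemma wedgeDist_le_iff {v : KPow ι X} {a : ℝ} : D.wedgeDist v ≤ a ↔ ∃ i, D.ν (v i) ≤ a := by
  simp only [wedgeDist, Finset.inf'_le_iff, Finset.mem_univ, true_and]

lemma wedgeDist_nonneg (v : KPow ι X) : 0 ≤ D.wedgeDist v :=
  (Finset.le_inf'_iff _ _).2 fun i _ => D.ν_nonneg (v i)

lemma wedgeDist_eq_zero {v : KPow ι X} : D.wedgeDist v = 0 ↔ v ∈ fatWedge X ι := by
  rw [← (wedgeDist_nonneg v).ge_iff_eq', wedgeDist_le_iff]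
  exact exists_congr fun i => by rw [(D.ν_nonneg _).ge_iff_eq', D.ν_eq_zero]

end WedgeDist

end NDRData

end NDR

section SmashPower

variable {X : PtdCG.{u}} (D : X.NDRData) {l : ℕ} [NeZero l]

/-- The distance of a point of the smash power to the base point. -/
noncomputable def NDRData.smashDist : X.smash l → ℝ :=
  smashLift D.wedgeDist 0 fun _ => NDRData.wedgeDist_eq_zero.2

lemma NDRData.continuous_smashDist : Continuous (D.smashDist (l := l)) :=
  continuous_smashLift _ D.continuous_wedgeDist

lemma NDRData.smashDist_nonneg (z : X.smash l) : 0 ≤ D.smashDist z := by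
  obtain ⟨v, rfl⟩ := isQuotientMap_smashMk.surjective z
  exact NDRData.wedgeDist_nonneg v

lemma NDRData.smashDist_pt : D.smashDist (X.smash l).pt = 0 :=
  NDRData.wedgeDist_eq_zero.2 ⟨0, rfl⟩

/-- The `i`-th coordinate of a point of the smash power; its value at the base point is junk. -/
noncomputable def smashCoord (i : Fin l) (z : X.smash l) : X :=
  (Quotient.out (s := X.smashSetoid l) z) i

variable {D}

lemma smashCoord_smashMk {v : KPow (Fin l) X} (hv : 0 < D.smashDist (smashMk v)) (i : Fin l) :
    smashCoord i (smashMk v) = v i := by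
  rcases smashMk_eq_iff.1 (Quotient.out_eq (s := X.smashSetoid l) (smashMk v)) with h | ⟨-, h⟩
  · exact congrArg (fun w : KPow (Fin l) X => w i) h
  · exact absurd (NDRData.wedgeDist_eq_zero.2 h) hv.ne'

lemma continuousOn_smashCoord (i : Fin l) :
    ContinuousOn (smashCoord i) {z : X.smash l | 0 < D.smashDist z} := by
  have hO : IsOpen {z : X.smash l | 0 < D.smashDist z} :=
    isOpen_lt continuous_const D.continuous_smashDist
  refine (continuousOn_open_iff hO).2 fun U hU => isQuotientMap_smashMk.isOpen_preimage.1 ?_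
  have hpre : smashMk ⁻¹' ({z : X.smash l | 0 < D.smashDist z} ∩ smashCoord i ⁻¹' U) =
      {v | 0 < D.wedgeDist v} ∩ (fun v : KPow (Fin l) X => v i) ⁻¹' U :=
    Set.ext fun v => and_congr_right fun hv => by
      rw [Set.mem_preimage, smashCoord_smashMk hv, Set.mem_preimage]
  rw [hpre]
  exact (isOpen_lt continuous_const D.continuous_wedgeDist).inter
    (hU.preimage (continuous_coord i))

variable (D) in
/-- A function on the smash power that is positive at the points other than the base point whose
`i`-th coordinate is near the base point of `X`. -/
noncomputable def NDRData.near (i : Fin l) : X.smash l → ℝ :=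
  smashLift (fun v => min (D.wedgeDist v) (1 - D.ν (v i))) 0 fun v hv => by
    rw [NDRData.wedgeDist_eq_zero.2 hv, min_eq_left (sub_nonneg.2 (D.ν_le_one _))]

lemma NDRData.continuous_near (i : Fin l) : Continuous (D.near i) :=
  continuous_smashLift _ <| D.continuous_wedgeDist.min
    (continuous_const.sub (D.ν_continuous.comp (continuous_coord i)))

lemma NDRData.near_pos_iff {i : Fin l} {z : X.smash l} :
    0 < D.near i z ↔ 0 < D.smashDist z ∧ D.ν (smashCoord i z) < 1 := by
  obtain ⟨v, rfl⟩ := isQuotientMap_smashMk.surjective z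
  refine lt_min_iff.trans (and_congr_right fun hv => ?_)
  rw [sub_pos, smashCoord_smashMk hv]

lemma NDRData.exists_near_pos {z : X.smash l} (hz : 0 < D.smashDist z) (hz' : D.smashDist z < 1) :
    ∃ i, 0 < D.near i z := by
  obtain ⟨v, rfl⟩ := isQuotientMap_smashMk.surjective z
  obtain ⟨i, -, hi⟩ := (Finset.inf'_lt_iff Finset.univ_nonempty).1 hz'
  exact ⟨i, near_pos_iff.2 ⟨hz, by rwa [smashCoord_smashMk hz]⟩⟩

end SmashPower

section Cover

/-- The nearest point of the unit interval. -/
noncomputable def projI (t : ℝ) : unitInterval := Set.projIcc 0 1 zero_le_one t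

@[fun_prop]
lemma continuous_projI : Continuous projI := continuous_projIcc (h := zero_le_one)

lemma projI_of_nonpos {t : ℝ} (h : t ≤ 0) : projI t = 0 := Set.projIcc_of_le_left _ h

lemma projI_of_one_le {t : ℝ} (h : 1 ≤ t) : projI t = 1 := Set.projIcc_of_right_le _ h

variable {X M : PtdCG.{u}} [CGMonoid M] {D : X.NDRData} {l : ℕ} [NeZero l]
  (H : C(unitInterval × X, X.smash l))

lemma PMap.apply_pt (g : PMap X M) : g.1 X.pt = 1 := g.2.trans CGMonoid.pt_eq

variable (D) in
/-- Let `H` be a homotopy of the reduced diagonal. This function is positive at the points of `X`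
off a neighbourhood of the base point whose path under `H` avoids the base point up to time `q`,
and then has its `i`-th coordinate near the base point; on this set the `i`-th coordinate
contracts the inclusion into `X`. -/
noncomputable def coverFun (q : unitInterval) (i : Fin l) (x : X) : ℝ :=
  min (D.ν x - 1 / 2)
    (min (sInf ((fun s => D.smashDist (H (s, x))) '' Set.Icc 0 q)) (D.near i (H (q, x))))

lemma continuous_coverFun (q : unitInterval) (i : Fin l) : Continuous (coverFun D H q i) := by
  refine (D.ν_continuous.sub continuous_const).min (Continuous.min ?_ ?_)
  · exact IsCompact.continuous_sInf (f := fun (x : X) s => D.smashDist (H (s, x))) isCompact_Icc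
      (D.continuous_smashDist.comp (H.continuous.comp continuous_swap))
  · exact (NDRData.continuous_near i).comp (H.continuous.comp (by fun_prop))

lemma coverFun_pos_iff {q : unitInterval} {i : Fin l} {x : X} :
    0 < coverFun D H q i x ↔ 1 / 2 < D.ν x ∧ (∀ s ≤ q, 0 < D.smashDist (H (s, x))) ∧
      0 < D.near i (H (q, x)) := by
  have hcont : Continuous fun s => D.smashDist (H (s, x)) :=
    D.continuous_smashDist.comp (H.continuous.comp (by fun_prop))
  rw [coverFun, lt_min_iff, lt_min_iff, sub_pos, isCompact_Icc.lt_sInf_iff_of_continuous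
    ⟨0, le_rfl, unitInterval.nonneg'⟩ hcont.continuousOn]
  simp only [Set.mem_Icc, unitInterval.nonneg', true_and]

/-- At the first time at which the path of `x` reaches the base point the distance is `0`, so just
before that it is positive and less than `1`. -/
lemma exists_coverFun_pos (hzero : ∀ x, H (0, x) = smashMk ⟨fun _ => x⟩)
    (hone : ∀ x, H (1, x) = (X.smash l).pt) {x : X} (hx : 1 / 2 < D.ν x) :
    ∃ (k : ℕ) (i : Fin l), 0 < coverFun D H (denseSeq unitInterval k) i x := by
  have hcont : Continuous fun s => D.smashDist (H (s, x)) :=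
    D.continuous_smashDist.comp (H.continuous.comp (by fun_prop))
  obtain ⟨s₀, hs₀, hmin⟩ := (isClosed_eq hcont continuous_const).isCompact.exists_isLeast
    ⟨1, show D.smashDist (H (1, x)) = 0 by rw [hone, D.smashDist_pt]⟩
  have hs₀_pos : 0 < s₀ := by
    refine unitInterval.pos_iff_ne_zero.2 ?_
    rintro rfl
    rw [Set.mem_ofPred_eq, hzero] at hs₀
    obtain ⟨_, hxpt⟩ := NDRData.wedgeDist_eq_zero.1 hs₀
    rw [show x = X.pt from hxpt, D.ν_pt] at hx
    linarith
  have hbefore : ({s | D.smashDist (H (s, x)) < 1} ∩ Set.Iio s₀).Nonempty := by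
    refine mem_closure_iff.1 ?_ _ (isOpen_lt hcont continuous_const)
      (show D.smashDist (H (s₀, x)) < 1 from hs₀.trans_lt one_pos)
    rw [closure_Iio' (a := s₀) ⟨0, hs₀_pos⟩]
    exact Set.self_mem_Iic
  obtain ⟨k, hk, hks₀⟩ := (denseRange_denseSeq unitInterval).exists_mem_open
    ((isOpen_lt hcont continuous_const).inter isOpen_Iio) hbefore
  have hpos (s) (hs : s ≤ denseSeq unitInterval k) : 0 < D.smashDist (H (s, x)) :=
    (D.smashDist_nonneg _).lt_of_ne fun h => (hmin h.symm).not_gt (hs.trans_lt hks₀)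
  obtain ⟨i, hi⟩ := NDRData.exists_near_pos (hpos _ le_rfl) hk
  exact ⟨k, i, (coverFun_pos_iff H).2 ⟨hx, hpos, hi⟩⟩

lemma isInverseOn_coverFun (hzero : ∀ x, H (0, x) = smashMk ⟨fun _ => x⟩) (g : PMap X M)
    (q : unitInterval) (i : Fin l) :
    RightInv.IsInverseOn (fun x => g.1 (D.r x)) {x | D.ν x ≤ 1 / 2} {x | 0 < coverFun D H q i x}
      fun x => ⟨1, fun t => g.1 (D.r (smashCoord i (H (q * projI t, x))))⟩ := by
  refine ⟨continuousOn_const, ?_, fun x hx => ⟨fun t ht => ?_, fun t ht => ?_⟩, fun x hx hxN => ?_⟩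
  · refine (g.1.continuous.comp D.continuous_r).comp_continuousOn
      ((continuousOn_smashCoord (D := D) i).comp (by fun_prop) fun p hp => ?_)
    exact ((coverFun_pos_iff H).1 hp.1).2.1 _ (mul_le_of_le_one_right' unitInterval.le_one')
  · have hdist := ((coverFun_pos_iff H).1 hx).2.1 0 unitInterval.nonneg'
    rw [hzero] at hdist
    dsimp only
    rw [projI_of_nonpos ht, mul_zero, hzero, smashCoord_smashMk hdist, mul_one]
  · have hnear := NDRData.near_pos_iff.1 ((coverFun_pos_iff H).1 hx).2.2
    dsimp only
    rw [projI_of_one_le ht, mul_one, D.r_eq_pt hnear.2, g.apply_pt]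
  · exact absurd ((coverFun_pos_iff H).1 hx).1 (not_lt.2 hxN)

lemma isInverseOn_near_pt (g : PMap X M) : RightInv.IsInverseOn (fun x => g.1 (D.r x))
    {x | D.ν x ≤ 1 / 2} {x | 0 < 1 - D.ν x} fun _ => ⟨1, fun _ => 1⟩ := by
  refine ⟨continuousOn_const, continuousOn_const, fun x hx => ⟨fun t _ => ?_, fun _ _ => rfl⟩,
    fun _ _ _ => rfl⟩
  rw [D.r_eq_pt (sub_pos.1 hx), g.apply_pt, mul_one]

variable (D) in
theorem exists_isInverseOn_univ (hcat : X.WeakCatLtTwo) (g : PMap X M) :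
    ∃ s, RightInv.IsInverseOn (fun x => g.1 (D.r x)) {x | D.ν x ≤ 1 / 2} Set.univ s := by
  obtain ⟨H⟩ := hcat
  have hzero (x) : H.toContinuousMap (0, x) = smashMk ⟨fun _ => x⟩ := H.apply_zero x
  obtain ⟨e, he⟩ := exists_surjective_nat (Option (ℕ × Fin 2))
  let u : Option (ℕ × Fin 2) → X → ℝ := fun o => o.elim (fun x => 1 - D.ν x)
    fun p => coverFun D H.toContinuousMap (denseSeq unitInterval p.1) p.2
  have hu : ∀ o, Continuous (u o)
    | none => continuous_const.sub D.ν_continuous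
    | some _ => continuous_coverFun _ _ _
  have hshrink : ∀ o, (RightInv.sections (fun x => g.1 (D.r x))
      {x | D.ν x ≤ 1 / 2}).Shrinkable {x | 0 < u o x}
    | none => RightInv.shrinkable_sections (isOpen_lt continuous_const (hu none))
        (isInverseOn_near_pt g)
    | some p => RightInv.shrinkable_sections (isOpen_lt continuous_const (hu (some p)))
        (isInverseOn_coverFun _ hzero g _ _)
  refine LocalSections.exists_isSection_univ (fun k => hu (e k)) (fun x => ?_)
    fun k => hshrink (e k)
  suffices h : ∃ o, 0 < u o x by
    obtain ⟨o, ho⟩ := h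
    obtain ⟨k, rfl⟩ := he o
    exact ⟨k, ho⟩
  rcases lt_or_ge (1 / 2) (D.ν x) with hx | hx
  · obtain ⟨k, i, hki⟩ := exists_coverFun_pos _ hzero (fun x => H.apply_one x) hx
    exact ⟨some (k, i), hki⟩
  · exact ⟨none, sub_pos.2 (by linarith)⟩

end Cover

section Word

variable {X : PtdCG.{u}}

lemma word_zero (v : KPow (Fin 0) X) : X.word v = 1 := by
  simp [word]

lemma word_succ {k : ℕ} (v : KPow (Fin (k + 1)) X) :
    X.word v = X.letter (v 0) * X.word (⟨fun i => v i.succ⟩ : KPow (Fin k) X) := by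
  simp [word, List.ofFn_succ]

lemma continuous_from_word {T : Type*} [TopologicalSpace T] {f : X.Word → T}
    (h : ∀ k, Continuous fun v : KPow (Fin k) X => f (X.word v)) : Continuous f :=
  X.isQuotientMap_wordSigma.continuous_iff.2 (continuous_sigma h)

lemma continuous_from_word_prod {T K : Type*} [TopologicalSpace T] [TopologicalSpace K]
    [LocallyCompactSpace K] {f : X.Word × K → T}
    (h : ∀ k, Continuous fun p : KPow (Fin k) X × K => f (X.word p.1, p.2)) : Continuous f := by
  refine X.isQuotientMap_wordSigma.continuous_lift_prod_left ?_
  rw [← (Homeomorph.sigmaProdDistrib (X := fun k : ℕ => KPow (Fin k) X)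
    (Y := K)).symm.comp_continuous_iff', continuous_sigma_iff]
  exact h

lemma word_induction {p : X.Word → Prop} (one : p 1)
    (letter_mul : ∀ x w, p w → p (X.letter x * w)) (w : X.Word) : p w := by
  obtain ⟨⟨k, v⟩, rfl⟩ := X.wordSigma_surjective w
  change p (X.word v)
  induction k with
  | zero => rwa [word_zero]
  | succ k ih =>
    rw [word_succ]
    exact letter_mul _ _ (ih _)

/-- Recursion on words. It is well behaved if the base point acts trivially on the values that
occur, see `wordRec_letter_mul`. -/
noncomputable def wordRec {S : Type*} (s : S) (step : X → S → S) (w : X.Word) : S :=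
  (FreeMonoid.toList (α := {x : X // x ≠ X.pt}) w).foldr (fun x a => step x a) s

lemma wordRec_one {S : Type*} (s : S) (step : X → S → S) : wordRec s step (1 : X.Word) = s := rfl

lemma wordRec_letter_mul {S : Type*} {s : S} {step : X → S → S} (x : X) {w : X.Word}
    (h : step X.pt (wordRec s step w) = wordRec s step w) :
    wordRec s step (X.letter x * w) = step x (wordRec s step w) := by
  by_cases hx : x = X.pt
  · rw [hx, letter_pt, one_mul, h]
  · rw [letter_of_ne X hx]
    rfl

lemma continuous_wordRec_word {S : Type*} [TopologicalSpace S] {W : Type u} [TopologicalSpace W]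
    [CompactlyGeneratedSpace W] {s : S} {step : W → X → S → S}
    (hpt : ∀ w a, step w X.pt a = a)
    (hstep : ∀ (f : W → X) (g : W → S), Continuous f → Continuous g →
      Continuous fun w => step w (f w) (g w))
    {k : ℕ} {v : W → KPow (Fin k) X} (hv : Continuous v) :
    Continuous fun w => wordRec s (step w) (X.word (v w)) := by
  induction k with
  | zero =>
    simp only [word_zero, wordRec_one]
    exact continuous_const
  | succ k ih =>
    simp only [word_succ, wordRec_letter_mul _ (hpt _ _)]
    exact hstep _ _ ((continuous_coord 0).comp hv)
      (ih (continuous_KPow fun i => (continuous_coord i.succ).comp hv))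

end Word

section PMap

/-- The identity as a pointed map. -/
def PMap.id (Y : PtdCG.{u}) : PMap Y Y := ⟨ContinuousMap.id Y, rfl⟩

/-- The composite of pointed maps. -/
def PMap.comp {Y Z W : PtdCG.{u}} (g : PMap Z W) (f : PMap Y Z) : PMap Y W :=
  ⟨g.1.comp f.1, by rw [ContinuousMap.comp_apply, f.2, g.2]⟩

lemma PMap.homotopic_of {Y Z : PtdCG.{u}} {f g : PMap Y Z} (F : Y × unitInterval → Z)
    (hF : Continuous F) (zero : ∀ y, F (y, 0) = f.1 y) (one : ∀ y, F (y, 1) = g.1 y)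
    (pt : ∀ t, F (Y.pt, t) = Z.pt) : PMap.Homotopic f g := by
  refine ⟨⟨⟨⟨fun p => F (p.2, p.1), hF.comp continuous_swap⟩, zero, one⟩, ?_⟩⟩
  rintro t y rfl
  exact (pt t).trans f.2.symm

end PMap

section JamesLift

variable {X M : PtdCG.{u}} [CGMonoid M]

/-- The homomorphism `J(X) → M` extending a pointed map `X → M`. -/
noncomputable def jamesLift (φ : PMap X M) : PMap X.James M :=
  ⟨⟨wordRec 1 fun x a => φ.1 x * a, continuous_from_word fun _ =>
    continuous_wordRec_word (step := fun _ x a => φ.1 x * a)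
      (fun _ a => by rw [φ.apply_pt, one_mul])
      (fun _ _ hf hg => CGMonoid.continuous_mul (φ.1.continuous.comp hf) hg) continuous_id⟩,
    CGMonoid.pt_eq.symm⟩

/-- The antihomomorphism `J(X) → M` extending a pointed map `X → M`. -/
noncomputable def jamesAntiLift (φ : PMap X M) : PMap X.James M :=
  ⟨⟨wordRec 1 fun x a => a * φ.1 x, continuous_from_word fun _ =>
    continuous_wordRec_word (step := fun _ x a => a * φ.1 x)
      (fun _ a => by rw [φ.apply_pt, mul_one])
      (fun _ _ hf hg => CGMonoid.continuous_mul hg (φ.1.continuous.comp hf)) continuous_id⟩,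
    CGMonoid.pt_eq.symm⟩

lemma jamesLift_letter_mul (φ : PMap X M) (x : X) (w : X.Word) :
    (jamesLift φ).1 (X.letter x * w) = φ.1 x * (jamesLift φ).1 w :=
  wordRec_letter_mul (step := fun x a => φ.1 x * a) x (by rw [φ.apply_pt, one_mul])

lemma jamesAntiLift_letter_mul (φ : PMap X M) (x : X) (w : X.Word) :
    (jamesAntiLift φ).1 (X.letter x * w) = (jamesAntiLift φ).1 w * φ.1 x :=
  wordRec_letter_mul (step := fun x a => a * φ.1 x) x (by rw [φ.apply_pt, mul_one])

lemma jamesLift_jamesIncl : jamesLift X.jamesIncl = PMap.id X.James := by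
  refine Subtype.ext (ContinuousMap.ext fun w => ?_)
  induction w using word_induction with
  | one => rfl
  | letter_mul x w ih => exact (jamesLift_letter_mul _ x w).trans (congrArg (X.letter x * ·) ih)

lemma jamesLift_homotopic {φ ψ : PMap X M} (h : PMap.Homotopic φ ψ) :
    PMap.Homotopic (jamesLift φ) (jamesLift ψ) := by
  obtain ⟨F⟩ := h
  have hpt (t) : F (t, X.pt) = 1 := (F.eq_fst t rfl).trans φ.apply_pt
  refine PMap.homotopic_of (fun p => wordRec 1 (fun x a => F (p.2, x) * a) p.1)
    (continuous_from_word_prod fun k => ?_) (fun w => ?_) (fun w => ?_)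
    fun _ => CGMonoid.pt_eq.symm
  · refine continuous_wordRec_word
      (step := fun (p : KPow (Fin k) X × unitInterval) x a => F (p.2, x) * a)
      (fun p a => by rw [hpt, one_mul]) (fun f g hf hg => ?_) continuous_fst
    exact CGMonoid.continuous_mul (F.continuous.comp (continuous_snd.prodMk hf)) hg
  · simp only [F.apply_zero]
    rfl
  · simp only [F.apply_one]
    rfl

end JamesLift

section MoorePath

/-- A pointed map `e` together with a map `χ` and Moore paths from `e x * χ x` to `1`. -/
structure MooreInverse (X M : PtdCG.{u}) [CGMonoid M] where
  e : PMap X M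
  χ : PMap X M
  path : C(X × ℝ, M)
  length : C(X, ℝ)
  length_nonneg : ∀ x, 0 ≤ length x
  length_pt : length X.pt = 0
  path_zero : ∀ x, path (x, 0) = e.1 x * χ.1 x
  path_of_length_le : ∀ x t, length x ≤ t → path (x, t) = 1

variable {X M : PtdCG.{u}} [CGMonoid M]

theorem exists_mooreInverse (hX : X.Nondegenerate) (hcat : X.WeakCatLtTwo) (g : PMap X M) :
    ∃ P : MooreInverse X M, PMap.Homotopic g P.e := by
  obtain ⟨D⟩ := hX.nonempty_NDRData
  obtain ⟨s, hs⟩ := exists_isInverseOn_univ D hcat g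
  have hnear (x) (hx : D.ν x ≤ 1 / 2) : s x = ⟨1, fun _ => 1⟩ := hs.eq_trivial x trivial hx
  have hpath : Continuous fun p : X × ℝ => (s p.1).path p.2 := by
    have := hs.continuousOn_path
    rwa [Set.univ_prod_univ, continuousOn_univ] at this
  let P : MooreInverse X M :=
    { e := ⟨g.1.comp ⟨D.r, D.continuous_r⟩, by simp only [ContinuousMap.comp_apply,
        ContinuousMap.coe_mk, D.r_pt, g.2]⟩
      χ := ⟨⟨fun x => (s x).inv, continuousOn_univ.1 hs.continuousOn_inv⟩, by
        simp only [ContinuousMap.coe_mk, hnear X.pt (by rw [D.ν_pt]; norm_num), CGMonoid.pt_eq]⟩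
      path := ⟨fun p => (s p.1).path (2 * p.2),
        hpath.comp (f := fun p : X × ℝ => (p.1, 2 * p.2)) (by fun_prop)⟩
      length := ⟨D.ν, D.ν_continuous⟩
      length_nonneg := D.ν_nonneg
      length_pt := D.ν_pt
      path_zero := fun x => (hs.isInverseOf x trivial).path_of_nonpos _ (mul_zero 2).le
      path_of_length_le := fun x t ht => by
        rcases le_or_gt (D.ν x) (1 / 2) with hx | hx
        · exact congrFun (congrArg RightInv.path (hnear x hx)) (2 * t)
        · have ht : D.ν x ≤ t := ht
          exact (hs.isInverseOf x trivial).path_of_one_le _ (by linarith) }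
  refine ⟨P, PMap.homotopic_of (fun p => g.1 (D.h p)) (g.1.comp D.h).continuous (fun x => ?_)
    (fun _ => rfl) fun t => ?_⟩
  · rw [D.h_zero]
  · rw [D.h_pt, g.2]

namespace MooreInverse

variable (P : MooreInverse X M)

/-- The Moore path from `e w * χ w` to `1` for a word `w`, paired with its length: for the word
`x * w` it is `e x * (path of w) * χ x` followed by the path of `x`. -/
noncomputable def wordPath : X.Word → (ℝ → M) × ℝ :=
  wordRec (fun _ => 1, 0) fun x a =>
    (fun t => if t ≤ a.2 then P.e.1 x * a.1 t * P.χ.1 x else P.path (x, t - a.2), P.length x + a.2)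

lemma wordPath_letter_mul_of (x : X) {w : X.Word}
    (hend : ∀ t, (P.wordPath w).2 ≤ t → (P.wordPath w).1 t = 1) :
    P.wordPath (X.letter x * w) = (fun t => if t ≤ (P.wordPath w).2 then
      P.e.1 x * (P.wordPath w).1 t * P.χ.1 x else P.path (x, t - (P.wordPath w).2),
      P.length x + (P.wordPath w).2) := by
  refine wordRec_letter_mul x ?_
  change (fun t => if t ≤ (P.wordPath w).2 then P.e.1 X.pt * (P.wordPath w).1 t * P.χ.1 X.pt
      else P.path (X.pt, t - (P.wordPath w).2), P.length X.pt + (P.wordPath w).2) = P.wordPath w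
  refine Prod.ext (funext fun t => ?_) (by rw [P.length_pt, zero_add])
  dsimp only
  split_ifs with ht
  · rw [P.e.apply_pt, P.χ.apply_pt, one_mul, mul_one]
  · rw [not_le] at ht
    rw [hend t ht.le, P.path_of_length_le _ _ (by rw [P.length_pt]; linarith)]

lemma wordPath_of_length_le (w : X.Word) :
    ∀ t, (P.wordPath w).2 ≤ t → (P.wordPath w).1 t = 1 := by
  induction w using word_induction with
  | one => exact fun _ _ => rfl
  | letter_mul x w ih =>
    intro t ht
    rw [P.wordPath_letter_mul_of x ih] at ht ⊢
    dsimp only at ht ⊢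
    have hx := P.length_nonneg x
    split_ifs with htw
    · rw [ih t (by linarith), mul_one, ← P.path_zero, P.path_of_length_le _ _ (by linarith)]
    · exact P.path_of_length_le _ _ (by linarith)

lemma wordPath_letter_mul (x : X) (w : X.Word) :
    P.wordPath (X.letter x * w) = (fun t => if t ≤ (P.wordPath w).2 then
      P.e.1 x * (P.wordPath w).1 t * P.χ.1 x else P.path (x, t - (P.wordPath w).2),
      P.length x + (P.wordPath w).2) :=
  P.wordPath_letter_mul_of x (P.wordPath_of_length_le w)

lemma wordPath_length_nonneg (w : X.Word) : 0 ≤ (P.wordPath w).2 := by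
  induction w using word_induction with
  | one => exact le_rfl
  | letter_mul x w ih =>
    rw [P.wordPath_letter_mul]
    exact add_nonneg (P.length_nonneg x) ih

lemma wordPath_zero (w : X.Word) :
    (P.wordPath w).1 0 = (jamesLift P.e).1 w * (jamesAntiLift P.χ).1 w := by
  induction w using word_induction with
  | one => exact (mul_one _).symm
  | letter_mul x w ih =>
    rw [P.wordPath_letter_mul, jamesLift_letter_mul, jamesAntiLift_letter_mul]
    dsimp only
    rw [if_pos (P.wordPath_length_nonneg w), ih]
    simp only [mul_assoc]

lemma continuous_wordPath {W : Type u} [TopologicalSpace W] [CompactlyGeneratedSpace W] {k : ℕ}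
    {v : W → KPow (Fin k) X} (hv : Continuous v) :
    Continuous (fun s => (P.wordPath (X.word (v s))).2) ∧ ∀ t : W → ℝ, Continuous t →
      Continuous fun s => (P.wordPath (X.word (v s))).1 (t s) := by
  induction k with
  | zero =>
    simp only [word_zero]
    exact ⟨continuous_const, fun _ _ => continuous_const⟩
  | succ k ih =>
    obtain ⟨hlength, hpath⟩ := ih (v := fun s => ⟨fun i => v s i.succ⟩)
      (continuous_KPow fun i => (continuous_coord i.succ).comp hv)
    have hhead := (continuous_coord 0).comp hv
    simp only [word_succ, P.wordPath_letter_mul]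
    refine ⟨(P.length.continuous.comp hhead).add hlength, fun t ht => ?_⟩
    refine Continuous.if_le ?_ ?_ ht hlength fun s hs => ?_
    · exact CGMonoid.continuous_mul (CGMonoid.continuous_mul (P.e.1.continuous.comp hhead)
        (hpath t ht)) (P.χ.1.continuous.comp hhead)
    · exact P.path.continuous.comp (hhead.prodMk (ht.sub hlength))
    · rw [hs, sub_self, P.path_zero, P.wordPath_of_length_le _ _ le_rfl, mul_one]

lemma jamesLift_mul_homotopic_const :
    PMap.Homotopic ((jamesLift P.e).mul (jamesAntiLift P.χ)) (PMap.const _ _) := by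
  refine PMap.homotopic_of (fun p => (P.wordPath p.1).1 (p.2 * (P.wordPath p.1).2))
    (continuous_from_word_prod fun k => ?_) (fun w => ?_) (fun w => ?_)
    fun _ => CGMonoid.pt_eq.symm
  · obtain ⟨hlength, hpath⟩ := P.continuous_wordPath
      (continuous_fst : Continuous fun p : KPow (Fin k) X × unitInterval => p.1)
    exact hpath _ ((continuous_subtype_val.comp continuous_snd).mul hlength)
  · simp only [Set.Icc.coe_zero, zero_mul]
    exact P.wordPath_zero w
  · simp only [Set.Icc.coe_one, one_mul]
    exact (P.wordPath_of_length_le w _ le_rfl).trans CGMonoid.pt_eq.symm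

end MooreInverse

end MoorePath

section HInverse

variable {M Y : PtdCG.{u}} [CGMonoid M]

lemma mk_mul_mk (f g : PMap Y M) : (⟦f⟧ : HClass Y M) * ⟦g⟧ = ⟦f.mul g⟧ := rfl

lemma pullback_mk {Y' : PtdCG.{u}} (g : PMap Y' Y) (f : PMap Y M) :
    pullback M g ⟦f⟧ = ⟦f.comp g⟧ := rfl

/-- A right inverse `χ` up to homotopy of the identity of a topological monoid, with a homotopy. -/
structure HInverse (M : PtdCG.{u}) [CGMonoid M] where
  χ : PMap M M
  homotopy : C(M × unitInterval, M)
  homotopy_zero : ∀ a, homotopy (a, 0) = a * χ.1 a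
  homotopy_one : ∀ a, homotopy (a, 1) = 1
  homotopy_unit : ∀ t, homotopy (1, t) = 1

theorem nonempty_hInverse_james {X : PtdCG.{u}} (hX : X.Nondegenerate) (hcat : X.WeakCatLtTwo) :
    Nonempty (HInverse X.James) := by
  obtain ⟨P, hP⟩ := exists_mooreInverse hX hcat X.jamesIncl
  obtain ⟨H⟩ : PMap.Homotopic ((PMap.id X.James).mul (jamesAntiLift P.χ)) (PMap.const _ _) := by
    rw [← jamesLift_jamesIncl]
    exact (PMap.mul_homotopic (jamesLift_homotopic hP) (ContinuousMap.HomotopicRel.refl _)).trans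
      P.jamesLift_mul_homotopic_const
  exact ⟨⟨jamesAntiLift P.χ, ⟨fun p => H (p.2, p.1), H.continuous.comp continuous_swap⟩,
    fun a => H.apply_zero a, fun a => H.apply_one a, fun t =>
      (H.eq_fst t (x := X.James.pt) rfl).trans ((PMap.id X.James).mul _).2⟩⟩

lemma isUnit_of_forall_exists_mul_eq_one {G : Type*} [Monoid G] (h : ∀ a : G, ∃ b, a * b = 1)
    (a : G) : IsUnit a := by
  obtain ⟨b, hb⟩ := h a
  obtain ⟨c, hc⟩ := h b
  exact ⟨⟨a, b, hb, by rw [left_inv_eq_right_inv hb hc, hc]⟩, rfl⟩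

namespace HInverse

variable (I : HInverse M)

lemma χ_one : I.χ.1 1 = 1 := by
  rw [← CGMonoid.pt_eq]
  exact I.χ.2

lemma mk_mul_mk_comp (f : PMap Y M) : (⟦f⟧ : HClass Y M) * ⟦I.χ.comp f⟧ = 1 := by
  refine Quotient.sound (PMap.homotopic_of (fun p => I.homotopy (f.1 p.1, p.2)) (by fun_prop)
    (fun y => I.homotopy_zero _) (fun y => (I.homotopy_one _).trans CGMonoid.pt_eq.symm)
    fun t => ?_)
  rw [f.apply_pt, I.homotopy_unit, CGMonoid.pt_eq]

include I in
lemma isUnit (a : HClass Y M) : IsUnit a :=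
  isUnit_of_forall_exists_mul_eq_one (Quotient.ind fun f => ⟨_, I.mk_mul_mk_comp f⟩) a

end HInverse

end HInverse

/-! ### Classes trivial on coordinate subspaces -/

section SetCoord

variable {X : PtdCG.{u}} {ι : Type} [DecidableEq ι]

/-- Replace the `i`-th coordinate of `v` by `x`. -/
def setCoord (v : KPow ι X) (i : ι) (x : X) : KPow ι X := ⟨Function.update v.coord i x⟩

lemma setCoord_same (v : KPow ι X) (i : ι) (x : X) : setCoord v i x i = x :=
  Function.update_self _ _ _

lemma setCoord_of_ne (v : KPow ι X) {i j : ι} (h : j ≠ i) (x : X) : setCoord v i x j = v j :=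
  Function.update_of_ne h _ _

lemma setCoord_self (v : KPow ι X) (i : ι) : setCoord v i (v i) = v :=
  congrArg KPow.mk (Function.update_eq_self _ _)

lemma setCoord_pt (i : ι) : setCoord (X.pow ι).pt i X.pt = (X.pow ι).pt :=
  setCoord_self (X.pow ι).pt i

lemma continuous_setCoord {W : Type u} [TopologicalSpace W] [CompactlyGeneratedSpace W]
    {v : W → KPow ι X} {x : W → X} (i : ι) (hv : Continuous v) (hx : Continuous x) :
    Continuous fun s => setCoord (v s) i (x s) := by
  refine continuous_KPow fun j => ?_
  by_cases h : j = i
  · subst h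
    simpa only [setCoord_same] using hx
  · simpa only [setCoord_of_ne _ h, Function.comp_def] using (continuous_coord j).comp hv

lemma coordMap_killIdx_singleton (i : ι) (v : KPow ι X) :
    (X.coordMap (killIdx {i})).1 v = setCoord v i X.pt := by
  refine congrArg KPow.mk (funext fun j => ?_)
  by_cases h : j = i
  · subst h
    simp [killIdx]
  · simp [killIdx, h]

lemma setCoord_mem_fatWedge {v : KPow ι X} (i : ι) {x : X} (h : ∃ j, j ≠ i ∧ v j = X.pt) :
    setCoord v i x ∈ fatWedge X ι := by
  obtain ⟨j, hj, hv⟩ := h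
  exact ⟨j, by rw [setCoord_of_ne _ hj, hv]⟩

lemma setCoord_pt_mem_fatWedge (v : KPow ι X) (i : ι) : setCoord v i X.pt ∈ fatWedge X ι :=
  ⟨i, setCoord_same _ _ _⟩

end SetCoord

section Cut

variable {X M : PtdCG.{u}} [CGMonoid M] {ι : Type}

lemma PMap.homotopic_of_pow {f g : PMap (X.pow ι) M} (F : KPow ι X × unitInterval → M)
    (hF : Continuous F) (zero : ∀ v : KPow ι X, F (v, 0) = f.1 v)
    (one : ∀ v : KPow ι X, F (v, 1) = g.1 v) (pt : ∀ t, F ((X.pow ι).pt, t) = 1) :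
    PMap.Homotopic f g :=
  PMap.homotopic_of (Y := X.pow ι) F hF zero one fun t => (pt t).trans CGMonoid.pt_eq.symm

variable [DecidableEq ι] (D : X.NDRData) (I : HInverse M)

/-- The product of `α` (precomposed with the retraction `D.r` in the `i`-th coordinate) with the
inverse of its restriction to the subspace where the `i`-th coordinate is the base point. Near that
subspace this is the product of an element and its inverse, and as `u` runs from `0` to `1` it is
deformed there to be trivial. -/
noncomputable def cut (i : ι) (u : unitInterval) (α : KPow ι X → M) (v : KPow ι X) : M :=
  if D.ν (v i) ≤ 1 / 2 then
    I.homotopy (α (setCoord v i X.pt), u * projI (2 - 4 * D.ν (v i)))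
  else α (setCoord v i (D.r (v i))) * I.χ.1 (α (setCoord v i X.pt))

lemma continuous_cut (i : ι) {W : Type u} [TopologicalSpace W] [CompactlyGeneratedSpace W]
    {α : W → KPow ι X → M}
    (hα : ∀ f : W → KPow ι X, Continuous f → Continuous fun s => α s (f s))
    {u : W → unitInterval} (hu : Continuous u) {v : W → KPow ι X} (hv : Continuous v) :
    Continuous fun s => cut D I i (u s) (α s) (v s) := by
  have hcoord : Continuous fun s => v s i := (continuous_coord i).comp hv
  have hrestrict : Continuous fun s => α s (setCoord (v s) i X.pt) :=
    hα _ (continuous_setCoord i hv continuous_const)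
  refine Continuous.if_le ?_ ?_ (D.ν_continuous.comp hcoord) continuous_const fun s hs => ?_
  · exact I.homotopy.continuous.comp (hrestrict.prodMk (by fun_prop))
  · exact CGMonoid.continuous_mul (hα _ (continuous_setCoord i hv (D.continuous_r.comp hcoord)))
      (I.χ.1.continuous.comp hrestrict)
  · rw [hs, projI_of_nonpos (by norm_num), mul_zero, I.homotopy_zero, D.r_eq_pt (by linarith)]

lemma cut_eq_one {i : ι} {u : unitInterval} {α : KPow ι X → M} {v : KPow ι X}
    (hpt : α (setCoord v i X.pt) = 1) (hr : α (setCoord v i (D.r (v i))) = 1) :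
    cut D I i u α v = 1 := by
  rw [cut, hpt, hr, I.homotopy_unit, I.χ_one, mul_one, ite_self]

lemma cut_one_of_ν_le {i : ι} {α : KPow ι X → M} {v : KPow ι X} (h : D.ν (v i) ≤ 1 / 4) :
    cut D I i 1 α v = 1 := by
  rw [cut, if_pos (by linarith), projI_of_one_le (by linarith), mul_one, I.homotopy_one]

lemma cut_zero (i : ι) (α : KPow ι X → M) (v : KPow ι X) :
    cut D I i 0 α v = α (setCoord v i (D.r (v i))) * I.χ.1 (α (setCoord v i X.pt)) := by
  rw [cut, zero_mul, I.homotopy_zero, ite_eq_right_iff]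
  intro hv
  rw [D.r_eq_pt (by linarith)]

lemma cut_of_eq_one {i : ι} {u : unitInterval} {α : KPow ι X → M} {v : KPow ι X}
    (hpt : α (setCoord v i X.pt) = 1) : cut D I i u α v = α (setCoord v i (D.r (v i))) := by
  rw [cut, hpt, I.homotopy_unit, I.χ_one, mul_one, ite_eq_right_iff]
  intro hv
  rw [D.r_eq_pt (by linarith), hpt]

/-- The iteration of `cut`, at the end of its deformation, over a list of coordinates. -/
noncomputable def cutList (L : List ι) (α : KPow ι X → M) : KPow ι X → M :=
  L.foldr (fun i => cut D I i 1) α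

lemma continuous_cutList {W : Type u} [TopologicalSpace W] [CompactlyGeneratedSpace W]
    {α : W → KPow ι X → M} (hα : ∀ f : W → KPow ι X, Continuous f → Continuous fun s => α s (f s))
    (L : List ι) : ∀ {v : W → KPow ι X}, Continuous v →
    Continuous fun s => cutList D I L (α s) (v s) := by
  induction L with
  | nil => exact fun hv => hα _ hv
  | cons i L ih => exact fun hv => continuous_cut D I i (fun f hf => ih hf) continuous_const hv

lemma cutList_eq_one {L : List ι} {α : KPow ι X → M} {v : KPow ι X} {i : ι} (hi : i ∈ L)
    (h : v i = X.pt) : cutList D I L α v = 1 := by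
  induction L generalizing v with
  | nil => exact absurd hi List.not_mem_nil
  | cons j L ih =>
    by_cases hij : i = j
    · subst hij
      refine cut_one_of_ν_le D I ?_
      rw [h, D.ν_pt]
      norm_num
    · have hiL : i ∈ L := (List.mem_cons.1 hi).resolve_left hij
      exact cut_eq_one D I (ih hiL (by rw [setCoord_of_ne _ hij, h]))
        (ih hiL (by rw [setCoord_of_ne _ hij, h]))

lemma cutList_one (L : List ι) : cutList D I L (fun _ => 1) = fun _ => 1 := by
  induction L with
  | nil => rfl
  | cons i L ih =>
    funext v
    change cut D I i 1 (cutList D I L fun _ => 1) v = 1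
    rw [ih]
    exact cut_eq_one D I rfl rfl

/-- `cutList` on continuous maps. -/
noncomputable def cutListMap (L : List ι) (α : C(KPow ι X, M)) : C(KPow ι X, M) :=
  ⟨cutList D I L α, continuous_cutList D I (α := fun _ => α)
    (fun _ hf => α.continuous.comp hf) L continuous_id⟩

lemma homotopicRel_cutListMap (L : List ι) {α : C(KPow ι X, M)} (hα : ∀ v ∈ fatWedge X ι, α v = 1) :
    ContinuousMap.HomotopicRel α (cutListMap D I L α) (fatWedge X ι) := by
  induction L with
  | nil => exact ContinuousMap.HomotopicRel.refl _
  | cons i L ih =>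
    refine ih.trans ?_
    have hβ : ∀ v ∈ fatWedge X ι, cutListMap D I L α v = 1 := by
      obtain ⟨F⟩ := ih
      exact fun v hv => (F.fst_eq_snd hv).symm.trans (hα v hv)
    refine ⟨⟨⟨⟨fun p => cutListMap D I L α (setCoord p.2 i (D.h (p.2 i, p.1))), ?_⟩,
      fun v => ?_, fun v => ?_⟩, fun t v hv => ?_⟩⟩
    · have hcont : Continuous fun p : KPow ι X × unitInterval =>
          setCoord p.1 i (D.h (p.1 i, p.2)) :=
        continuous_setCoord i continuous_fst (D.h.continuous.comp
          (((continuous_coord i).comp continuous_fst).prodMk continuous_snd))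
      exact (cutListMap D I L α).continuous.comp (hcont.comp continuous_swap)
    · simp only [D.h_zero, setCoord_self]
    · exact (cut_of_eq_one D I (hβ _ (setCoord_pt_mem_fatWedge v i))).symm
    · refine (hβ _ ?_).trans (hβ v hv).symm
      obtain ⟨j, hj⟩ := hv
      by_cases hji : j = i
      · subst hji
        simp only [hj, D.h_pt]
        exact setCoord_pt_mem_fatWedge _ _
      · exact setCoord_mem_fatWedge i ⟨j, hji, hj⟩

lemma cut_pt (i : ι) (u : unitInterval) (α : PMap (X.pow ι) M) :
    cut D I i u α.1 (X.pow ι).pt = 1 := by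
  have hpt : α.1 (setCoord (X.pow ι).pt i X.pt) = 1 :=
    (congrArg α.1 (setCoord_pt i)).trans α.apply_pt
  refine cut_eq_one D I hpt ?_
  change α.1 (setCoord (X.pow ι).pt i (D.r X.pt)) = 1
  rw [D.r_pt, hpt]

/-- `cut` on pointed maps. -/
noncomputable def cutMap (i : ι) (u : unitInterval) (α : PMap (X.pow ι) M) : PMap (X.pow ι) M :=
  ⟨⟨cut D I i u α.1, continuous_cut D I i (α := fun _ => α.1)
    (fun _ hf => α.1.continuous.comp hf) continuous_const continuous_id⟩,
    (cut_pt D I i u α).trans CGMonoid.pt_eq.symm⟩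

lemma cutMap_zero_homotopic_cutMap_one (i : ι) (α : PMap (X.pow ι) M) :
    PMap.Homotopic (cutMap D I i 0 α) (cutMap D I i 1 α) :=
  PMap.homotopic_of_pow (fun p => cut D I i p.2 α.1 p.1)
    (continuous_cut D I i (α := fun _ => α.1) (fun _ hf => α.1.continuous.comp hf)
      continuous_snd continuous_fst) (fun _ => rfl) (fun _ => rfl) fun t => cut_pt D I i t α

lemma mul_inv_restriction_homotopic_cutMap_zero (i : ι) (α : PMap (X.pow ι) M) :
    PMap.Homotopic (α.mul (I.χ.comp (α.comp (X.coordMap (killIdx {i}))))) (cutMap D I i 0 α) := by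
  refine PMap.homotopic_of_pow (fun p => α.1 (setCoord p.1 i (D.h (p.1 i, p.2))) *
    I.χ.1 (α.1 (setCoord p.1 i X.pt))) ?_ (fun v => ?_) (fun v => ?_) fun t => ?_
  · have hcoord : Continuous fun p : KPow ι X × unitInterval => p.1 i :=
      (continuous_coord i).comp continuous_fst
    exact CGMonoid.continuous_mul (W := KPow ι X × unitInterval) (α.1.continuous.comp
      (continuous_setCoord i continuous_fst (D.h.continuous.comp (hcoord.prodMk continuous_snd))))
      (I.χ.1.continuous.comp
        (α.1.continuous.comp (continuous_setCoord i continuous_fst continuous_const)))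
  · dsimp only
    rw [D.h_zero, setCoord_self, ← coordMap_killIdx_singleton]
    rfl
  · exact (cut_zero D I i α.1 v).symm
  · change α.1 (setCoord (X.pow ι).pt i (D.h (X.pt, t))) *
      I.χ.1 (α.1 (setCoord (X.pow ι).pt i X.pt)) = 1
    rw [D.h_pt, show α.1 (setCoord (X.pow ι).pt i X.pt) = 1 from
      (congrArg α.1 (setCoord_pt i)).trans α.apply_pt, I.χ_one, mul_one]

lemma mk_cutMap_one {i : ι} {α : PMap (X.pow ι) M}
    (h : pullback M (X.coordMap (killIdx {i})) (⟦α⟧ : HClass (X.pow ι) M) = 1) :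
    (⟦cutMap D I i 1 α⟧ : HClass (X.pow ι) M) = ⟦α⟧ := by
  have hinv := I.mk_mul_mk_comp (α.comp (X.coordMap (killIdx {i})))
  rw [← pullback_mk, h, one_mul] at hinv
  rw [← Quotient.sound (cutMap_zero_homotopic_cutMap_one D I i α),
    ← Quotient.sound (mul_inv_restriction_homotopic_cutMap_zero D I i α), ← mk_mul_mk, hinv,
    mul_one]

end Cut

section FatWedgeExtension

variable {X M : PtdCG.{u}} [CGMonoid M] {ι : Type} [Finite ι]

theorem homotopicRel_fatWedge_of_null (D : X.NDRData) (I : HInverse M) {α : PMap (X.pow ι) M}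
    (hα : ∀ v ∈ fatWedge X ι, α.1 v = 1) (hnull : PMap.Homotopic α (PMap.const _ _)) :
    ContinuousMap.HomotopicRel α.1 (ContinuousMap.const _ 1) (fatWedge X ι) := by
  classical
  have := Fintype.ofFinite ι
  obtain ⟨F⟩ := hnull
  let L : List ι := Finset.univ.toList
  refine (homotopicRel_cutListMap D I L hα).trans ?_
  have htrivial (s) (v) (hv : v ∈ fatWedge X ι) : cutList D I L (fun v => F (s, v)) v = 1 :=
    hv.elim fun i hi => cutList_eq_one D I (by simp [L]) hi
  have hcont : Continuous fun p : KPow ι X × unitInterval =>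
      cutList D I L (fun v => F (p.2, v)) p.1 :=
    continuous_cutList D I (α := fun (p : KPow ι X × unitInterval) v => F (p.2, v))
      (fun f hf => F.continuous.comp (continuous_snd.prodMk hf)) _ continuous_fst
  have hzero : (fun v : KPow ι X => F (0, v)) = α.1 := funext fun v => F.apply_zero v
  have hone : (fun v : KPow ι X => F (1, v)) = fun _ => 1 :=
    funext fun v => (F.apply_one v).trans CGMonoid.pt_eq
  refine ⟨⟨⟨⟨fun p => cutList D I L (fun v => F (p.1, v)) p.2, hcont.comp continuous_swap⟩,
    fun v => ?_, fun v => ?_⟩, fun t v hv => ?_⟩⟩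
  · exact congrArg (fun g => cutList D I L g v) hzero
  · exact (congrArg (fun g => cutList D I L g v) hone).trans (congrFun (cutList_one D I L) v)
  · refine (htrivial t v hv).trans ((htrivial 0 v hv).symm.trans ?_)
    exact congrArg (fun g => cutList D I L g v) hzero

theorem exists_rep_eq_one_on_fatWedge (D : X.NDRData) (I : HInverse M) {a : HClass (X.pow ι) M}
    (h : ∀ i, pullback M (X.coordMap (killIdx {i})) a = 1) :
    ∃ γ : PMap (X.pow ι) M, ⟦γ⟧ = a ∧ ∀ v ∈ fatWedge X ι, γ.1 v = 1 := by
  classical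
  have := Fintype.ofFinite ι
  obtain ⟨α, rfl⟩ := Quotient.exists_rep a
  have hcut (L : List ι) : ∃ γ : PMap (X.pow ι) M, (⟦γ⟧ : HClass (X.pow ι) M) = ⟦α⟧ ∧
      ⇑γ.1 = cutList D I L α.1 := by
    induction L with
    | nil => exact ⟨α, rfl, rfl⟩
    | cons i L ih =>
      obtain ⟨γ, hclass, hγ⟩ := ih
      exact ⟨cutMap D I i 1 γ, by rw [mk_cutMap_one D I (by rw [hclass, h i]), hclass],
        congrArg (cut D I i 1) hγ⟩
  obtain ⟨γ, hclass, hγ⟩ := hcut Finset.univ.toList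
  refine ⟨γ, hclass, ?_⟩
  rintro v ⟨i, hi⟩
  rw [hγ]
  exact cutList_eq_one D I (Finset.mem_toList.2 (Finset.mem_univ i)) hi

end FatWedgeExtension

section Commute

variable {X M : PtdCG.{u}} [CGMonoid M] {ι : Type} [DecidableEq ι]
  (D : X.NDRData) (I : HInverse M) (i : ι) (f g : PMap (X.pow ι) M)

/-- The product of `f` and `g` at two points that differ in one coordinate, times the inverse of the
product in the other order, deformed to be trivial near the fat wedge in the two values of that
coordinate. -/
noncomputable def commFun (v : KPow ι X) (p : KPow (Fin 2) X) : M :=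
  if D.wedgeDist p ≤ 1 / 8 then
    I.homotopy (f.1 (setCoord v i (p 0)) * g.1 (setCoord v i (p 1)),
      projI (2 - 16 * D.wedgeDist p))
  else f.1 (setCoord v i (p 0)) * g.1 (setCoord v i (p 1)) *
    I.χ.1 (g.1 (setCoord v i (p 1)) * f.1 (setCoord v i (p 0)))

lemma commFun_eq_one (v : KPow ι X) {p : KPow (Fin 2) X} (hp : p ∈ fatWedge X (Fin 2)) :
    commFun D I i f g v p = 1 := by
  have hdist : D.wedgeDist p = 0 := NDRData.wedgeDist_eq_zero.2 hp
  rw [commFun, if_pos (by rw [hdist]; norm_num), hdist, projI_of_one_le (by norm_num),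
    I.homotopy_one]

/-- The function induced by `commFun` on the smash product. -/
noncomputable def commSmash (v : KPow ι X) : X.smash 2 → M :=
  smashLift (commFun D I i f g v) 1 fun _ => commFun_eq_one D I i f g v

variable {f g}

lemma commSmash_reducedDiagonal (hf : ∀ v : KPow ι X, D.ν (v i) ≤ 1 / 8 → f.1 v = 1)
    (hg : ∀ v : KPow ι X, D.ν (v i) ≤ 1 / 8 → g.1 v = 1) (v : KPow ι X) :
    commSmash D I i f g v (X.reducedDiagonal.1 (v i)) = f.1 v * g.1 v * I.χ.1 (g.1 v * f.1 v) := by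
  change commFun D I i f g v ⟨fun _ => v i⟩ = _
  simp only [commFun, setCoord_self]
  split_ifs with h
  · obtain ⟨_, hv⟩ := NDRData.wedgeDist_le_iff.1 h
    rw [hf v hv, hg v hv, mul_one, I.homotopy_unit, I.χ_one, mul_one]
  · rfl

lemma continuous_commFun (hf : ∀ v : KPow ι X, D.ν (v i) ≤ 1 / 8 → f.1 v = 1)
    (hg : ∀ v : KPow ι X, D.ν (v i) ≤ 1 / 8 → g.1 v = 1) {W : Type u} [TopologicalSpace W]
    [CompactlyGeneratedSpace W] {v : W → KPow ι X} {p : W → KPow (Fin 2) X} (hv : Continuous v)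
    (hp : Continuous p) : Continuous fun s => commFun D I i f g (v s) (p s) := by
  have hdist : Continuous fun s => D.wedgeDist (p s) := D.continuous_wedgeDist.comp hp
  have hfv : Continuous fun s => f.1 (setCoord (v s) i (p s 0)) :=
    f.1.continuous.comp (continuous_setCoord i hv ((continuous_coord 0).comp hp))
  have hgv : Continuous fun s => g.1 (setCoord (v s) i (p s 1)) :=
    g.1.continuous.comp (continuous_setCoord i hv ((continuous_coord 1).comp hp))
  have hfg := CGMonoid.continuous_mul hfv hgv
  refine Continuous.if_le ?_ ?_ hdist continuous_const fun s hs => ?_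
  · exact I.homotopy.continuous.comp (hfg.prodMk (by fun_prop))
  · exact CGMonoid.continuous_mul hfg (I.χ.1.continuous.comp (CGMonoid.continuous_mul hgv hfv))
  · rw [hs, projI_of_nonpos (by norm_num), I.homotopy_zero]
    obtain ⟨j, hj⟩ := NDRData.wedgeDist_le_iff.1 hs.le
    fin_cases j
    · rw [hf _ (by rwa [setCoord_same]), one_mul, mul_one]
    · rw [hg _ (by rwa [setCoord_same]), one_mul, mul_one]

lemma continuous_commSmash (hf : ∀ v : KPow ι X, D.ν (v i) ≤ 1 / 8 → f.1 v = 1)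
    (hg : ∀ v : KPow ι X, D.ν (v i) ≤ 1 / 8 → g.1 v = 1) {W : Type u} [TopologicalSpace W]
    [CompactlyGeneratedSpace W] {v : W → KPow ι X} {z : W → X.smash 2} (hv : Continuous v)
    (hz : Continuous z) : Continuous fun s => commSmash D I i f g (v s) (z s) := by
  refine continuous_from_compactlyGeneratedSpace _ fun S _ _ _ e he => ?_
  have hprod : Continuous fun p : S × X.smash 2 => commSmash D I i f g (v (e p.1)) p.2 := by
    refine isQuotientMap_smashMk.continuous_lift_prod_right ?_
    have := compactlyGenerated_prod_left S (KPow (Fin 2) X)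
    exact continuous_commFun D I i hf hg (hv.comp (he.comp continuous_fst)) continuous_snd
  exact hprod.comp (continuous_id.prodMk (hz.comp he))

omit [DecidableEq ι] in
lemma mul_mul_inv_homotopic_const (hcat : X.WeakCatLtTwo)
    (hf : ∀ v : KPow ι X, D.ν (v i) ≤ 1 / 8 → f.1 v = 1)
    (hg : ∀ v : KPow ι X, D.ν (v i) ≤ 1 / 8 → g.1 v = 1) :
    PMap.Homotopic ((f.mul g).mul (I.χ.comp (g.mul f))) (PMap.const _ _) := by
  classical
  obtain ⟨H⟩ := hcat
  have hpt (v : KPow ι X) : commSmash D I i f g v (X.smash 2).pt = 1 :=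
    commFun_eq_one D I i f g v ⟨0, rfl⟩
  refine PMap.homotopic_of_pow (fun p => commSmash D I i f g p.1 (H (p.2, p.1 i)))
    (continuous_commSmash D I i hf hg (W := KPow ι X × unitInterval) continuous_fst
      (H.continuous.comp (continuous_snd.prodMk ((continuous_coord i).comp continuous_fst))))
    (fun v => ?_) (fun v => ?_) fun t => ?_
  · dsimp only
    rw [H.apply_zero]
    exact commSmash_reducedDiagonal D I i hf hg v
  · dsimp only
    rw [H.apply_one]
    exact (hpt v).trans CGMonoid.pt_eq.symm
  · have hH : H (t, X.pt) = (X.smash 2).pt := H.eq_fst t rfl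
    change commSmash D I i f g (X.pow ι).pt (H (t, X.pt)) = 1
    rw [hH]
    exact hpt _

omit [DecidableEq ι] in
include D I in
theorem mul_comm_of_pullback_killIdx_eq_one (hcat : X.WeakCatLtTwo) {a b : HClass (X.pow ι) M}
    (ha : pullback M (X.coordMap (killIdx {i})) a = 1)
    (hb : pullback M (X.coordMap (killIdx {i})) b = 1) : a * b = b * a := by
  classical
  obtain ⟨f, rfl⟩ := Quotient.exists_rep a
  obtain ⟨g, rfl⟩ := Quotient.exists_rep b
  rw [← mk_cutMap_one D I ha, ← mk_cutMap_one D I hb]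
  set f' := cutMap D I i 1 f
  set g' := cutMap D I i 1 g
  have hcomm : (⟦(f'.mul g').mul (I.χ.comp (g'.mul f'))⟧ : HClass (X.pow ι) M) = 1 :=
    Quotient.sound (mul_mul_inv_homotopic_const D I i hcat
      (fun _ hv => cut_one_of_ν_le D I (by linarith))
      fun _ hv => cut_one_of_ν_le D I (by linarith))
  have hinv := I.mk_mul_mk_comp (g'.mul f')
  rw [← mk_mul_mk, ← mk_mul_mk] at hcomm
  rw [← mk_mul_mk] at hinv
  exact (I.isUnit ⟦I.χ.comp (g'.mul f')⟧).mul_right_cancel (hcomm.trans hinv.symm)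

end Commute

end PtdCG

namespace Cohen

open scoped commutatorElement

variable {G : Type*} [Group G] {ι : Type*}

lemma comm_eq_commutatorElement (a b : G) : comm a b = ⁅a⁻¹, b⁻¹⁆ := by
  rw [comm, commutatorElement_def, inv_inv, inv_inv]

lemma inv_comm (a b : G) : (comm a b)⁻¹ = comm b a := by
  simp only [comm_eq_commutatorElement, commutatorElement_inv]

lemma comm_eq_one_of_commute {a b : G} (h : Commute a b) : comm a b = 1 := by
  rw [comm_eq_commutatorElement, commutatorElement_eq_one_iff_commute]
  exact h.inv_inv

lemma comm_mem_left {N : Subgroup G} [N.Normal] {a : G} (ha : a ∈ N) (b : G) : comm a b ∈ N := by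
  rw [comm_eq_commutatorElement]
  exact Subgroup.commutator_le_left N ⊤
    (Subgroup.commutator_mem_commutator (N.inv_mem ha) (Subgroup.mem_top _))

lemma comm_mem_right {N : Subgroup G} [N.Normal] {b : G} (hb : b ∈ N) (a : G) : comm a b ∈ N := by
  rw [← inv_comm]
  exact N.inv_mem (comm_mem_left hb a)

lemma comm_zpow_left {a b : G} (h : Commute a (comm a b)) (m : ℤ) :
    comm (a ^ m) b = comm a b ^ m := by
  have hconj : b⁻¹ * a ^ m * b = (a * comm a b) ^ m := by
    rw [show a * comm a b = b⁻¹ * a * b⁻¹⁻¹ by rw [comm]; group, conj_zpow, inv_inv]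
  calc comm (a ^ m) b = (a ^ m)⁻¹ * (b⁻¹ * a ^ m * b) := by rw [comm]; group
    _ = comm a b ^ m := by rw [hconj, h.mul_zpow, inv_mul_cancel_left]

lemma comm_zpow_right {a b : G} (h : Commute b (comm a b)) (m : ℤ) :
    comm a (b ^ m) = comm a b ^ m := by
  rw [← inv_comm] at h ⊢
  rw [comm_zpow_left (by simpa using h), ← inv_zpow, inv_comm]

section AbelianNormal

variable {N : ι → Subgroup G} [∀ i, (N i).Normal] {x : ι → G}

lemma foldl_comm_eq_one (hN : ∀ i, ∀ a ∈ N i, ∀ b ∈ N i, Commute a b) (hx : ∀ i, x i ∈ N i)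
    (L : List ι) (a : G) (h : (∃ i ∈ L, a ∈ N i) ∨ ¬ L.Nodup) : (L.map x).foldl comm a = 1 := by
  induction L generalizing a with
  | nil => simp at h
  | cons j L ih =>
    rw [List.map_cons, List.foldl_cons]
    rw [List.nodup_cons, not_and_or, not_not] at h
    rcases h with ⟨i, hi, ha⟩ | hj | hL
    · rcases List.mem_cons.1 hi with rfl | hi
      · rw [comm_eq_one_of_commute (hN i _ ha _ (hx i)), foldl_comm_one]
      · exact ih _ (Or.inl ⟨i, hi, comm_mem_left ha _⟩)
    · exact ih _ (Or.inl ⟨j, hj, comm_mem_right (hx j) _⟩)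
    · exact ih _ (Or.inr hL)

lemma leftComm_eq_one_of_not_nodup (hN : ∀ i, ∀ a ∈ N i, ∀ b ∈ N i, Commute a b)
    (hx : ∀ i, x i ∈ N i) {L : List ι} (hL : ¬ L.Nodup) : leftComm (L.map x) = 1 := by
  cases L with
  | nil => simp at hL
  | cons i L =>
    rw [List.nodup_cons, not_and_or, not_not] at hL
    exact foldl_comm_eq_one hN hx L _ (hL.imp_left fun hi => ⟨i, hi, hx i⟩)

lemma foldl_comm_zpow (hN : ∀ i, ∀ a ∈ N i, ∀ b ∈ N i, Commute a b) (hx : ∀ i, x i ∈ N i)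
    (L : List (ι × ℤ)) {a : G} (ha : ∃ i, a ∈ N i) (m : ℤ) :
    (L.map fun p => x p.1 ^ p.2).foldl comm (a ^ m) =
      (L.map fun p => x p.1).foldl comm a ^ (m * (L.map Prod.snd).prod) := by
  induction L generalizing a m with
  | nil => simp
  | cons p L ih =>
    obtain ⟨i, hi⟩ := ha
    have hcomm : comm (a ^ m) (x p.1 ^ p.2) = comm a (x p.1) ^ (m * p.2) := by
      have hright := hN p.1 _ (hx _) _ (comm_mem_right (hx p.1) (a ^ m))
      have hleft := hN i _ hi _ (comm_mem_left hi (x p.1))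
      rw [comm_zpow_right hright, comm_zpow_left hleft, zpow_mul]
    simp only [List.map_cons, List.foldl_cons, List.prod_cons]
    rw [hcomm, ih ⟨p.1, comm_mem_right (hx _) _⟩, mul_assoc]

lemma leftComm_zpow (hN : ∀ i, ∀ a ∈ N i, ∀ b ∈ N i, Commute a b) (hx : ∀ i, x i ∈ N i)
    (L : List (ι × ℤ)) : leftComm (L.map fun p => x p.1 ^ p.2) =
      leftComm (L.map fun p => x p.1) ^ (L.map Prod.snd).prod := by
  cases L with
  | nil => simp [leftComm]
  | cons p L => exact foldl_comm_zpow hN hx L ⟨p.1, hx p.1⟩ _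

end AbelianNormal

/-- The homomorphism from the Cohen group given by elements of abelian normal subgroups. -/
def K.lift {ι : Type} {N : ι → Subgroup G} [∀ i, (N i).Normal] {x : ι → G}
    (hN : ∀ i, ∀ a ∈ N i, ∀ b ∈ N i, Commute a b) (hx : ∀ i, x i ∈ N i) : K ι →* G :=
  PresentedGroup.toGroup (f := x) <| by
    rintro r (⟨L, hL, rfl⟩ | ⟨L, rfl⟩)
    · simpa [map_leftComm, Function.comp_def] using leftComm_eq_one_of_not_nodup hN hx hL
    · rw [map_mul, map_inv, mul_inv_eq_one]
      simpa [map_leftComm, Function.comp_def] using Cohen.leftComm_zpow hN hx L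

lemma K.lift_x {ι : Type} {N : ι → Subgroup G} [∀ i, (N i).Normal] {x : ι → G}
    (hN : ∀ i, ∀ a ∈ N i, ∀ b ∈ N i, Commute a b) (hx : ∀ i, x i ∈ N i) (i : ι) :
    K.lift hN hx (K.x i) = x i :=
  PresentedGroup.toGroup.of _

lemma K.map_x {ι κ : Type} (φ : ι → Option κ) (i : ι) : K.map φ (K.x i) = (φ i).elim 1 K.x :=
  PresentedGroup.toGroup.of _

lemma K.closure_range_x (ι : Type) : Subgroup.closure (Set.range (K.x : ι → K ι)) = ⊤ :=
  PresentedGroup.closure_range_of _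

end Cohen

namespace PtdCG

variable {X : PtdCG.{u}} {ι κ : Type}

lemma coordPullback_xClass (φ : ι → Option κ) (i : ι) :
    X.coordPullback φ (X.xClass i) = (φ i).elim 1 X.xClass := by
  have hcoord (v : KPow κ X) : ((X.coordMap φ).1 v).coord i = (φ i).elim X.pt v.coord := rfl
  cases h : φ i with
  | none =>
    refine congrArg (Quotient.mk _) (Subtype.ext (ContinuousMap.ext fun v => ?_))
    exact (congrArg X.letter ((hcoord v).trans (by rw [h]; rfl))).trans X.letter_pt
  | some k =>
    refine congrArg (Quotient.mk _) (Subtype.ext (ContinuousMap.ext fun v => ?_))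
    exact congrArg X.letter ((hcoord v).trans (by rw [h]; rfl))

/-- The class `x_i` as a unit of `[X^ι, J(X)]`. -/
noncomputable def xUnit (I : HInverse X.James) (i : ι) : (HClass (X.pow ι) X.James)ˣ :=
  (I.isUnit (X.xClass i)).unit

variable (X) in
/-- The group of classes that restrict trivially to the subspace where the `i`-th coordinate is the
base point. -/
noncomputable def killKer (i : ι) : Subgroup (HClass (X.pow ι) X.James)ˣ :=
  (Units.map (X.coordPullback (killIdx {i}))).ker

instance (i : ι) : (killKer X i).Normal := MonoidHom.normal_ker _

lemma mem_killKer {i : ι} {a : (HClass (X.pow ι) X.James)ˣ} :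
    a ∈ killKer X i ↔ X.coordPullback (killIdx {i}) a = 1 := by
  rw [killKer, MonoidHom.mem_ker, Units.ext_iff]
  rfl

variable (D : X.NDRData) (I : HInverse X.James) (hcat : X.WeakCatLtTwo)

lemma xUnit_mem_killKer (i : ι) : xUnit I i ∈ killKer X i := by
  rw [mem_killKer, xUnit, IsUnit.unit_spec, coordPullback_xClass]
  simp [killIdx]

include D I hcat in
lemma commute_of_mem_killKer (i : ι) (a) (ha : a ∈ killKer X i) (b)
    (hb : b ∈ killKer X i) : Commute a b :=
  Units.ext (mul_comm_of_pullback_killIdx_eq_one D I i hcat (mem_killKer.1 ha) (mem_killKer.1 hb))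

/-- The homomorphism from the Cohen group to the units of `[X^ι, J(X)]`. -/
noncomputable def cohenUnits : Cohen.K ι →* (HClass (X.pow ι) X.James)ˣ :=
  Cohen.K.lift (commute_of_mem_killKer D I hcat) (xUnit_mem_killKer I)

lemma cohenUnits_x (i : ι) : cohenUnits D I hcat (Cohen.K.x i) = xUnit I i :=
  Cohen.K.lift_x _ _ i

/-- The homomorphism `e_X` from the Cohen group to `[X^ι, J(X)]`. -/
noncomputable def cohenHom : Cohen.K ι →* HClass (X.pow ι) X.James :=
  (Units.coeHom _).comp (cohenUnits D I hcat)

lemma cohenHom_x (i : ι) : cohenHom D I hcat (Cohen.K.x i) = X.xClass i :=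
  congrArg Units.val (cohenUnits_x D I hcat i)

lemma cohenHom_mem_KGeo (α : Cohen.K ι) : cohenHom D I hcat α ∈ X.KGeo ι := by
  suffices h : (⊤ : Subgroup (Cohen.K ι)) ≤ (Subgroup.closure {a : (HClass (X.pow ι) X.James)ˣ |
      ∃ i : ι, a.val = X.xClass i}).comap (cohenUnits D I hcat) from
    ⟨cohenUnits D I hcat α, h (Subgroup.mem_top α), rfl⟩
  rw [← Cohen.K.closure_range_x, Subgroup.closure_le]
  rintro _ ⟨i, rfl⟩
  exact Subgroup.subset_closure ⟨i, cohenHom_x D I hcat i⟩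

lemma coordPullback_cohenHom (φ : ι → Option κ) (α : Cohen.K ι) :
    X.coordPullback φ (cohenHom D I hcat α) = cohenHom D I hcat (Cohen.K.map φ α) := by
  suffices h : (X.coordPullback φ).comp (cohenHom D I hcat) =
      (cohenHom D I hcat).comp (Cohen.K.map φ) from DFunLike.congr_fun h α
  refine MonoidHom.eq_of_eqOn_dense (Cohen.K.closure_range_x ι) ?_
  rintro _ ⟨i, rfl⟩
  change X.coordPullback φ (cohenHom D I hcat (Cohen.K.x i)) =
    cohenHom D I hcat (Cohen.K.map φ (Cohen.K.x i))
  rw [cohenHom_x, coordPullback_xClass, Cohen.K.map_x]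
  cases φ i with
  | none => exact (map_one _).symm
  | some k => exact (cohenHom_x D I hcat k).symm

/-! ### Stages of the James filtration -/

section Letters

variable {Z : PtdCG.{u}} {n : ℕ}

/-- The sequence of letters of a reduced word. -/
def letters (w : Z.Word) : List Z :=
  (FreeMonoid.toList (α := {x : Z // x ≠ Z.pt}) w).map Subtype.val

lemma letters_letter_mul {x : Z} (hx : x ≠ Z.pt) (w : Z.Word) :
    letters (Z.letter x * w) = x :: letters w := by
  rw [letter_of_ne Z hx]
  rfl

open Classical in
lemma letters_word (z : KPow (Fin n) Z) :
    letters (Z.word z) = (List.ofFn z.coord).filter (· ≠ Z.pt) := by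
  induction n with
  | zero =>
    rw [word_zero, List.ofFn_zero]
    rfl
  | succ n ih =>
    rw [word_succ, List.ofFn_succ]
    by_cases hx : z 0 = Z.pt
    · rw [List.filter_cons_of_neg (by simpa using hx), hx, letter_pt, one_mul, ih]
    · rw [List.filter_cons_of_pos (by simpa using hx), letters_letter_mul hx, ih]

lemma eq_of_word_eq {z z' : KPow (Fin n) Z} (hz : ∀ s, z s ≠ Z.pt) (h : Z.word z = Z.word z') :
    z = z' := by
  classical
  have hfilter : List.ofFn z.coord = (List.ofFn z'.coord).filter (· ≠ Z.pt) := by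
    rw [← letters_word, ← h, letters_word, List.filter_eq_self.2]
    simpa [List.forall_mem_ofFn_iff] using hz
  have hlength : ((List.ofFn z'.coord).filter (· ≠ Z.pt)).length =
      (List.ofFn z'.coord).length := by rw [← hfilter, List.length_ofFn, List.length_ofFn]
  exact congrArg KPow.mk
    (List.ofFn_injective (hfilter.trans (List.filter_sublist.eq_of_length hlength)))

lemma prod_map_letters_word {N : Type*} [Monoid N] {F : Z → N} (hF : F Z.pt = 1)
    (z : KPow (Fin n) Z) :
    ((letters (Z.word z)).map F).prod = (List.ofFn fun s => F (z s)).prod := by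
  induction n with
  | zero =>
    rw [word_zero, List.ofFn_zero]
    rfl
  | succ n ih =>
    rw [word_succ, List.ofFn_succ, List.prod_cons]
    by_cases hx : z 0 = Z.pt
    · rw [hx, hF, letter_pt, one_mul, one_mul, ih]
    · rw [letters_letter_mul hx, List.map_cons, List.prod_cons, ih]

lemma prod_ofFn_succAbove {N : Type*} [Monoid N] (f : Fin (n + 1) → N) {s : Fin (n + 1)}
    (h : f s = 1) : (List.ofFn f).prod = (List.ofFn fun i => f (s.succAbove i)).prod := by
  induction n with
  | zero =>
    obtain rfl : s = 0 := Fin.fin_one_eq_zero s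
    simp [h]
  | succ n ih =>
    induction s using Fin.cases with
    | zero => simp [h]
    | succ s =>
      rw [List.ofFn_succ (f := f), List.prod_cons, ih (fun i => f i.succ) h,
        List.ofFn_succ (f := fun i => f (s.succ.succAbove i)), List.prod_cons]
      simp only [Fin.succ_succAbove_zero, Fin.succ_succAbove_succ]

lemma word_succAbove (z : KPow (Fin (n + 1)) Z) {s : Fin (n + 1)} (h : z s = Z.pt) :
    Z.word z = Z.word (⟨fun i => z (s.succAbove i)⟩ : KPow (Fin n) Z) :=
  prod_ofFn_succAbove (fun i => Z.letter (z i)) (by rw [h, letter_pt])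

lemma word_coordMap_lastCases (z : KPow (Fin n) Z) :
    Z.word ((Z.coordMap (Fin.lastCases none some : Fin (n + 1) → Option (Fin n))).1 z) =
      Z.word z := by
  have hcoord (i : Fin (n + 1)) :
      ((Z.coordMap (Fin.lastCases none some : Fin (n + 1) → Option (Fin n))).1 z).coord i =
        (Fin.lastCases none some i : Option (Fin n)).elim Z.pt z.coord := rfl
  refine (word_succAbove _ ((hcoord (Fin.last n)).trans ?_)).trans
    (congrArg (fun c => Z.word (KPow.mk c)) (funext fun i => (hcoord _).trans ?_))
  · rw [Fin.lastCases_last]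
    rfl
  · rw [Fin.succAbove_last, Fin.lastCases_castSucc]
    rfl

/-- The inclusion of a stage of the James filtration in the next one. -/
noncomputable def stageIncl (Z : PtdCG.{u}) (n : ℕ) : PMap (Z.JamesFil n) (Z.JamesFil (n + 1)) :=
  ⟨⟨Quotient.map' (s₁ := Setoid.ker Z.word) (s₂ := Setoid.ker Z.word)
      (Z.coordMap (Fin.lastCases none some : Fin (n + 1) → Option (Fin n))).1
      fun v w (h : Z.word v = Z.word w) =>
        (word_coordMap_lastCases v).trans (h.trans (word_coordMap_lastCases w).symm),
    (Z.coordMap _).1.continuous.quotient_map' _⟩, congrArg (Quotient.mk _) (Z.coordMap _).2⟩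

lemma stageIncl_mk_eq_iff {z : KPow (Fin n) Z} {z' : KPow (Fin (n + 1)) Z} :
    (Z.stageIncl n).1 (Quotient.mk (Setoid.ker Z.word) z) = Quotient.mk (Setoid.ker Z.word) z' ↔
      Z.word z = Z.word z' :=
  (Quotient.eq (r := Setoid.ker (Z.word (k := n + 1)))).trans
    (Eq.congr_left (word_coordMap_lastCases z))

end Letters

section Blocks

variable {X : PtdCG.{u}} {l n : ℕ}

lemma smashMk_eq_pt (hl : 0 < l) {w : KPow (Fin l) X} :
    smashMk w = (X.smash l).pt ↔ w ∈ fatWedge X (Fin l) := by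
  have hpt : (⟨fun _ => X.pt⟩ : KPow (Fin l) X) ∈ fatWedge X (Fin l) := ⟨⟨0, hl⟩, rfl⟩
  refine smashMk_eq_iff.trans ⟨?_, fun h => Or.inr ⟨h, hpt⟩⟩
  rintro (rfl | h)
  · exact hpt
  · exact h.1

/-- The quotient map `X^{ln} → (X^{(l)})^n`. -/
def toBlocks (v : KPow (Fin n × Fin l) X) : KPow (Fin n) (X.smash l) :=
  ⟨fun s => smashMk ⟨fun j => v (s, j)⟩⟩

lemma continuous_toBlocks :
    Continuous (toBlocks : KPow (Fin n × Fin l) X → KPow (Fin n) (X.smash l)) :=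
  continuous_KPow fun s => isQuotientMap_smashMk.continuous.comp
    (continuous_KPow fun j => continuous_coord (s, j))

lemma surjective_toBlocks :
    Function.Surjective (toBlocks : KPow (Fin n × Fin l) X → KPow (Fin n) (X.smash l)) := by
  intro z
  choose w hw using fun s => isQuotientMap_smashMk.surjective (z s)
  exact ⟨⟨fun p => w p.1 p.2⟩, congrArg KPow.mk (funext hw)⟩

lemma isQuotientMap_toBlocks :
    IsQuotientMap (toBlocks : KPow (Fin n × Fin l) X → KPow (Fin n) (X.smash l)) := by
  have huncurry : Continuous fun w : KPow (Fin n) (KPow (Fin l) X) =>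
      (⟨fun p => w p.1 p.2⟩ : KPow (Fin n × Fin l) X) :=
    continuous_KPow fun p => (continuous_coord p.2).comp (continuous_coord p.1)
  refine ⟨isCoinducing_iff.2 fun U => ⟨fun h => ?_, fun h => h.preimage continuous_toBlocks⟩,
    surjective_toBlocks⟩
  refine continuous_Prop.1 (continuous_KPow_of_isQuotientMap (F := (· ∈ U))
    (isQuotientMap_smashMk (X := X) (l := l)) ?_)
  exact (continuous_Prop.2 h).comp huncurry

lemma isQuotientMap_quotMap : IsQuotientMap (X.quotMap l n).1 :=
  (isQuotientMap_quotient_mk' (s := Setoid.ker ((X.smash l).word (k := n)))).comp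
    isQuotientMap_toBlocks

/-- The reduced word in `X^{(l)}` represented by an element of `X^{ln}`. -/
noncomputable def blockWord (v : KPow (Fin n × Fin l) X) : (X.smash l).Word :=
  (X.smash l).word (toBlocks v)

lemma quotMap_eq_iff {v v' : KPow (Fin n × Fin l) X} :
    (X.quotMap l n).1 v = (X.quotMap l n).1 v' ↔ blockWord v = blockWord v' :=
  Quotient.eq (r := Setoid.ker ((X.smash l).word (k := n)))

lemma eq_of_blockWord_eq (hl : 0 < l) {v v' : KPow (Fin n × Fin l) X}
    (hv : v ∉ fatWedge X (Fin n × Fin l)) (h : blockWord v = blockWord v') : v = v' := by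
  have hne (s : Fin n) : toBlocks v s ≠ (X.smash l).pt := fun hs => by
    obtain ⟨j, hj⟩ := (smashMk_eq_pt hl).1 hs
    exact hv ⟨_, hj⟩
  refine congrArg KPow.mk (funext fun p => ?_)
  have hblock := congrArg (fun c : KPow (Fin n) (X.smash l) => c p.1) (eq_of_word_eq hne h)
  rcases smashMk_eq_iff.1 hblock with heq | ⟨⟨j, hj⟩, -⟩
  · exact congrArg (fun c : KPow (Fin l) X => c p.2) heq
  · exact (hv ⟨_, hj⟩).elim

lemma eq_or_mem_fatWedge_of_blockWord_eq (hl : 0 < l) {v v' : KPow (Fin n × Fin l) X}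
    (h : blockWord v = blockWord v') :
    v = v' ∨ v ∈ fatWedge X (Fin n × Fin l) ∧ v' ∈ fatWedge X (Fin n × Fin l) := by
  by_contra! hc
  by_cases hv : v ∈ fatWedge X (Fin n × Fin l)
  · exact hc.1 (eq_of_blockWord_eq hl (hc.2 hv) h.symm).symm
  · exact hc.1 (eq_of_blockWord_eq hl hv h)

lemma deleteBlock_self (s : Fin (n + 1)) (j : Fin l) : deleteBlock s (s, j) = none := by
  simp [deleteBlock]

lemma deleteBlock_succAbove (s : Fin (n + 1)) (i : Fin n) (j : Fin l) :
    deleteBlock s (s.succAbove i, j) = some (i, j) := by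
  rcases lt_or_ge i.castSucc s with h | h
  · rw [Fin.succAbove_of_castSucc_lt _ _ h, deleteBlock, dif_pos h]
    rfl
  · have h' : s < i.succ := Fin.lt_def.2 (Nat.lt_succ_of_le h)
    rw [Fin.succAbove_of_le_castSucc _ _ h, deleteBlock, dif_neg (not_lt.2 h'.le), dif_pos h']
    rfl

lemma toBlocks_deleteBlock_self (s : Fin (n + 1)) (v : KPow (Fin n × Fin l) X) :
    toBlocks ((X.coordMap (deleteBlock s)).1 v) s = (X.smash l).pt := by
  refine congrArg (fun w => smashMk (KPow.mk w)) (funext fun j => ?_)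
  change (deleteBlock (l := l) s (s, j)).elim X.pt v.coord = X.pt
  rw [deleteBlock_self]
  rfl

lemma toBlocks_deleteBlock_succAbove (s : Fin (n + 1)) (i : Fin n) (v : KPow (Fin n × Fin l) X) :
    toBlocks ((X.coordMap (deleteBlock s)).1 v) (s.succAbove i) = toBlocks v i := by
  refine congrArg (fun w => smashMk (KPow.mk w)) (funext fun j => ?_)
  change (deleteBlock (l := l) s (s.succAbove i, j)).elim X.pt v.coord = v (i, j)
  rw [deleteBlock_succAbove]
  rfl

lemma blockWord_deleteBlock (s : Fin (n + 1)) (v : KPow (Fin n × Fin l) X) :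
    blockWord ((X.coordMap (deleteBlock s)).1 v) = blockWord v :=
  (word_succAbove _ (toBlocks_deleteBlock_self s v)).trans
    (congrArg (fun z => (X.smash l).word (KPow.mk z))
      (funext fun i => toBlocks_deleteBlock_succAbove s i v))

/-- Remove the `s`-th block of coordinates. -/
def dropBlock (s : Fin (n + 1)) (v : KPow (Fin (n + 1) × Fin l) X) : KPow (Fin n × Fin l) X :=
  ⟨fun p => v (s.succAbove p.1, p.2)⟩

lemma continuous_dropBlock (s : Fin (n + 1)) :
    Continuous (dropBlock s : KPow (Fin (n + 1) × Fin l) X → KPow (Fin n × Fin l) X) :=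
  continuous_KPow fun p => continuous_coord (s.succAbove p.1, p.2)

lemma blockWord_dropBlock (hl : 0 < l) {p : Fin (n + 1) × Fin l}
    {v : KPow (Fin (n + 1) × Fin l) X} (h : v p = X.pt) :
    blockWord (dropBlock p.1 v) = blockWord v :=
  (word_succAbove (toBlocks v) ((smashMk_eq_pt hl).2 ⟨p.2, h⟩)).symm

/-- Apply a function to all coordinates. -/
def mapCoord {ι : Type} (φ : X → X) (v : KPow ι X) : KPow ι X := ⟨fun i => φ (v i)⟩

lemma mapCoord_pt {ι : Type} {φ : X → X} (hφ : φ X.pt = X.pt) :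
    mapCoord φ (X.pow ι).pt = (X.pow ι).pt :=
  congrArg KPow.mk (funext fun _ => hφ)

lemma continuous_mapCoord {ι : Type} {W : Type u} [TopologicalSpace W] [CompactlyGeneratedSpace W]
    {φ : W → X → X} (hφ : Continuous fun p : W × X => φ p.1 p.2) {v : W → KPow ι X}
    (hv : Continuous v) : Continuous fun s => mapCoord (φ s) (v s) :=
  continuous_KPow fun i => hφ.comp (continuous_id.prodMk ((continuous_coord i).comp hv))

lemma mapCoord_mem_fatWedge {ι : Type} {φ : X → X} (hφ : φ X.pt = X.pt) {v : KPow ι X}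
    (hv : v ∈ fatWedge X ι) : mapCoord φ v ∈ fatWedge X ι :=
  hv.imp fun _ hi => (congrArg φ hi).trans hφ

/-- The map of smash powers induced by a map that fixes the base point. -/
def smashMap {φ : X → X} (hφ : φ X.pt = X.pt) : X.smash l → X.smash l :=
  Quotient.map (sa := X.smashSetoid l) (sb := X.smashSetoid l) (mapCoord φ) fun v w h => by
    rcases h with rfl | ⟨hv, hw⟩
    · exact Or.inl rfl
    · exact Or.inr ⟨mapCoord_mem_fatWedge hφ hv, mapCoord_mem_fatWedge hφ hw⟩

lemma blockWord_mapCoord {φ : X → X} (hφ : φ X.pt = X.pt) {v v' : KPow (Fin n × Fin l) X}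
    (h : blockWord v = blockWord v') : blockWord (mapCoord φ v) = blockWord (mapCoord φ v') := by
  have hpt : (X.smash l).letter (smashMap hφ (X.smash l).pt) = 1 := by
    have : smashMap hφ (X.smash l).pt = (X.smash l).pt := congrArg smashMk (mapCoord_pt hφ)
    rw [this, letter_pt]
  have hmap (v : KPow (Fin n × Fin l) X) : blockWord (mapCoord φ v) =
      ((letters (blockWord v)).map fun z => (X.smash l).letter (smashMap hφ z)).prod :=
    (prod_map_letters_word (F := fun z => (X.smash l).letter (smashMap hφ z)) hpt
      (toBlocks v)).symm
  rw [hmap, hmap, h]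

end Blocks

section Stages

variable {Z : PtdCG.{u}} {n : ℕ}

lemma injective_stageIncl : Function.Injective (Z.stageIncl n).1 := by
  rintro ⟨z⟩ ⟨z'⟩ h
  exact Quotient.sound (s := Setoid.ker Z.word)
    ((stageIncl_mk_eq_iff.1 h).trans (word_coordMap_lastCases z'))

lemma JamesFil_zero_eq_pt (y : Z.JamesFil 0) : y = (Z.JamesFil 0).pt := by
  obtain ⟨z, rfl⟩ := Quotient.exists_rep y
  exact congrArg (fun c => Quotient.mk (Setoid.ker Z.word) (KPow.mk c)) (Subsingleton.elim _ _)

end Stages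

section Descent

variable {X Z : PtdCG.{u}} {l n : ℕ}

lemma stageIncl_quotMap_eq_iff {u : KPow (Fin n × Fin l) X} {v : KPow (Fin (n + 1) × Fin l) X} :
    ((X.smash l).stageIncl n).1 ((X.quotMap l n).1 u) = (X.quotMap l (n + 1)).1 v ↔
      blockWord u = blockWord v :=
  stageIncl_mk_eq_iff

lemma stageIncl_comp_quotMap (s : Fin (n + 1)) :
    ((X.smash l).stageIncl n).comp (X.quotMap l n) =
      (X.quotMap l (n + 1)).comp (X.coordMap (deleteBlock s)) :=
  Subtype.ext (ContinuousMap.ext fun v =>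
    stageIncl_quotMap_eq_iff.2 (blockWord_deleteBlock s v).symm)

lemma pt_mem_fatWedge {ι : Type} [Nonempty ι] : (X.pow ι).pt ∈ fatWedge X ι :=
  ⟨Classical.arbitrary ι, rfl⟩

lemma exists_descend_homotopy (hl : 0 < l) {c : PMap ((X.smash l).JamesFil n) Z}
    {F : KPow (Fin n × Fin l) X × unitInterval → Z} (hF : Continuous F)
    (zero : ∀ v, F (v, 0) = c.1 ((X.quotMap l n).1 v))
    (pt : ∀ t, F ((X.pow (Fin n × Fin l)).pt, t) = Z.pt)
    (congr : ∀ t, ∀ v ∈ fatWedge X (Fin n × Fin l), ∀ v' ∈ fatWedge X (Fin n × Fin l),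
      blockWord v = blockWord v' → F (v, t) = F (v', t)) :
    ∃ c' : PMap ((X.smash l).JamesFil n) Z, PMap.Homotopic c c' ∧
      ∀ v : KPow (Fin n × Fin l) X, c'.1 ((X.quotMap l n).1 v) = F (v, 1) := by
  have hq := isQuotientMap_quotMap (X := X) (l := l) (n := n)
  let G : (X.smash l).JamesFil n × unitInterval → Z := fun p =>
    F (Function.surjInv hq.surjective p.1, p.2)
  have hG (v : KPow (Fin n × Fin l) X) (t) : G ((X.quotMap l n).1 v, t) = F (v, t) := by
    have hword := quotMap_eq_iff.1 (Function.surjInv_eq hq.surjective ((X.quotMap l n).1 v))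
    rcases eq_or_mem_fatWedge_of_blockWord_eq hl hword with heq | ⟨hw, hv⟩
    · exact congrArg (fun w => F (w, t)) heq
    · exact congr t _ hw v hv hword
  have hGcont : Continuous G :=
    hq.continuous_lift_prod_left (hF.congr fun p => (hG p.1 p.2).symm)
  have hGpt (t) : G (((X.smash l).JamesFil n).pt, t) = Z.pt := by
    rw [← (X.quotMap l n).2]
    exact (hG _ t).trans (pt t)
  refine ⟨⟨⟨fun y => G (y, 1), hGcont.comp (by fun_prop)⟩, hGpt 1⟩, ?_, fun v => hG v 1⟩
  refine PMap.homotopic_of G hGcont (fun y => ?_) (fun _ => rfl) hGpt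
  obtain ⟨v, rfl⟩ := hq.surjective y
  exact (hG v 0).trans (zero v)

end Descent

section Extension

variable {X : PtdCG.{u}} {ι : Type} (D : X.NDRData)

lemma mapCoord_r_eq_pt {v : KPow ι X} {i : ι} (h : D.ν (v i) ≤ 1 / 2) :
    mapCoord D.r v i = X.pt :=
  D.r_eq_pt (h.trans_lt (by norm_num))

lemma continuous_mapCoord_r : Continuous (mapCoord D.r : KPow ι X → KPow ι X) :=
  continuous_mapCoord (φ := fun _ => D.r) (D.continuous_r.comp continuous_snd) continuous_id

variable [Fintype ι] [Nonempty ι]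

lemma mapCoord_r_mem_fatWedge {v : KPow ι X} (h : D.wedgeDist v ≤ 1 / 2) :
    mapCoord D.r v ∈ fatWedge X ι := by
  obtain ⟨i, hi⟩ := NDRData.wedgeDist_le_iff.1 h
  exact ⟨i, mapCoord_r_eq_pt D hi⟩

/-- The homotopy `A` on the fat wedge, slowed down to the constant homotopy `f` as the distance
to the fat wedge increases to `1 / 2`; near the fat wedge, points are moved into it by `D.r`. -/
noncomputable def extendHomotopy {T : Type u} (f : KPow ι X → T)
    (A : KPow ι X × unitInterval → T) (p : KPow ι X × unitInterval) : T :=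
  open Classical in
  if D.wedgeDist p.1 ≤ 1 / 2 then
    A (mapCoord D.r p.1, p.2 * projI (2 - 4 * D.wedgeDist p.1))
  else f (mapCoord D.r p.1)

variable {D} {T : Type u} {f : KPow ι X → T} {A : KPow ι X × unitInterval → T}

lemma extendHomotopy_zero (hAf : ∀ v ∈ fatWedge X ι, A (v, 0) = f v) (v : KPow ι X) :
    extendHomotopy D f A (v, 0) = f (mapCoord D.r v) := by
  rw [extendHomotopy]
  split_ifs with h
  · rw [zero_mul, hAf _ (mapCoord_r_mem_fatWedge D h)]
  · rfl

lemma extendHomotopy_of_mem_fatWedge {v : KPow ι X} (hv : v ∈ fatWedge X ι) (t : unitInterval) :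
    extendHomotopy D f A (v, t) = A (mapCoord D.r v, t) := by
  have hdist : D.wedgeDist v = 0 := NDRData.wedgeDist_eq_zero.2 hv
  rw [extendHomotopy, if_pos (by simp [hdist]), projI_of_one_le (by simp [hdist]), mul_one]

lemma continuous_extendHomotopy [TopologicalSpace T] (hf : Continuous f)
    (hA : ∀ i, ContinuousOn A {p | p.1 i = X.pt}) (hAf : ∀ v ∈ fatWedge X ι, A (v, 0) = f v) :
    Continuous (extendHomotopy D f A) := by
  have hdist : Continuous fun p : KPow ι X × unitInterval => D.wedgeDist p.1 :=
    D.continuous_wedgeDist.comp continuous_fst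
  have hr : Continuous fun p : KPow ι X × unitInterval => mapCoord D.r p.1 :=
    (continuous_mapCoord_r D).comp continuous_fst
  let cover : Option ι → Set (KPow ι X × unitInterval) := fun o =>
    o.elim {p | 1 / 2 ≤ D.wedgeDist p.1} fun i => {p | D.ν (p.1 i) ≤ 1 / 2}
  refine (locallyFinite_of_finite cover).continuous (Set.iUnion_eq_univ_iff.2 fun p => ?_) ?_ ?_
  · rcases le_total (1 / 2) (D.wedgeDist p.1) with h | h
    · exact ⟨none, h⟩
    · obtain ⟨i, hi⟩ := NDRData.wedgeDist_le_iff.1 h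
      exact ⟨some i, hi⟩
  · rintro (_ | i)
    · exact isClosed_le continuous_const hdist
    · exact isClosed_le (D.ν_continuous.comp ((continuous_coord i).comp continuous_fst))
        continuous_const
  · rintro (_ | i)
    · refine (hf.comp hr).continuousOn.congr fun p (hp : 1 / 2 ≤ D.wedgeDist p.1) => ?_
      rw [extendHomotopy]
      split_ifs with h
      · rw [le_antisymm h hp, projI_of_nonpos (by norm_num), mul_zero]
        exact hAf _ (mapCoord_r_mem_fatWedge D h)
      · rfl
    · have hslow : Continuous fun p : KPow ι X × unitInterval =>
          (mapCoord D.r p.1, p.2 * projI (2 - 4 * D.wedgeDist p.1)) := hr.prodMk (by fun_prop)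
      refine ((hA i).comp hslow.continuousOn fun p hp => mapCoord_r_eq_pt D hp).congr
        fun p hp => ?_
      exact if_pos (NDRData.wedgeDist_le_iff.2 ⟨i, hp⟩)

end Extension

section FilStages

variable {X Z : PtdCG.{u}} {l n : ℕ}

lemma exists_homotopic_comp_mapCoord_r (D : X.NDRData) (hl : 0 < l)
    (c : PMap ((X.smash l).JamesFil n) Z) :
    ∃ c' : PMap ((X.smash l).JamesFil n) Z, PMap.Homotopic c c' ∧
      ∀ v : KPow (Fin n × Fin l) X,
        c'.1 ((X.quotMap l n).1 v) = c.1 ((X.quotMap l n).1 (mapCoord D.r v)) := by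
  have hpt (t : unitInterval) : D.h (X.pt, t) = X.pt := D.h_pt t
  refine exists_descend_homotopy hl (c := c)
    (F := fun p => c.1 ((X.quotMap l n).1 (mapCoord (fun x => D.h (x, p.2)) p.1))) ?_
    (fun v => ?_) (fun t => ?_) fun t v _ v' _ h =>
      congrArg c.1 (quotMap_eq_iff.2 (blockWord_mapCoord (hpt t) h))
  · refine c.1.continuous.comp ((X.quotMap l n).1.continuous.comp (continuous_mapCoord
      (φ := fun (p : KPow (Fin n × Fin l) X × unitInterval) x => D.h (x, p.2))
      (by fun_prop) continuous_fst))
  · exact congrArg (fun w => c.1 ((X.quotMap l n).1 (KPow.mk w))) (funext fun i => D.h_zero (v i))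
  · exact (congrArg (fun v => c.1 ((X.quotMap l n).1 v)) (mapCoord_pt (hpt t))).trans
      ((congrArg c.1 (X.quotMap l n).2).trans c.2)

lemma exists_nullHomotopy_on_fatWedge (hl : 0 < l) {c : PMap ((X.smash l).JamesFil (n + 1)) Z}
    (hnull : PMap.Homotopic (c.comp ((X.smash l).stageIncl n)) (PMap.const _ _)) :
    ∃ A : KPow (Fin (n + 1) × Fin l) X × unitInterval → Z,
      (∀ p, ContinuousOn A {q | q.1 p = X.pt}) ∧
      (∀ t, A ((X.pow (Fin (n + 1) × Fin l)).pt, t) = Z.pt) ∧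
      (∀ t v v', blockWord v = blockWord v' → A (v, t) = A (v', t)) ∧
      ∀ v ∈ fatWedge X (Fin (n + 1) × Fin l),
        A (v, 0) = c.1 ((X.quotMap l (n + 1)).1 v) ∧ A (v, 1) = Z.pt := by
  have : Nonempty ((X.smash l).JamesFil n) := ⟨((X.smash l).JamesFil n).pt⟩
  obtain ⟨G⟩ := hnull
  let stage : (X.smash l).JamesFil (n + 1) → (X.smash l).JamesFil n :=
    Function.invFun ((X.smash l).stageIncl n).1
  have hstage (y) : stage (((X.smash l).stageIncl n).1 y) = y :=
    Function.leftInverse_invFun injective_stageIncl y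
  have hdrop {p : Fin (n + 1) × Fin l} {v : KPow (Fin (n + 1) × Fin l) X} (h : v p = X.pt) :
      ((X.smash l).stageIncl n).1 ((X.quotMap l n).1 (dropBlock p.1 v)) =
        (X.quotMap l (n + 1)).1 v := stageIncl_quotMap_eq_iff.2 (blockWord_dropBlock hl h)
  refine ⟨fun q => G (q.2, stage ((X.quotMap l (n + 1)).1 q.1)), fun p => ?_, fun t => ?_,
    fun t v v' h => ?_, fun v hv => ⟨?_, G.apply_one _⟩⟩
  · refine (G.continuous.comp (continuous_snd.prodMk ((X.quotMap l n).1.continuous.comp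
      ((continuous_dropBlock p.1).comp continuous_fst)))).continuousOn.congr fun q hq => ?_
    exact congrArg (fun y => G (q.2, y)) ((congrArg stage (hdrop hq)).symm.trans (hstage _))
  · have hpt : stage ((X.quotMap l (n + 1)).1 (X.pow (Fin (n + 1) × Fin l)).pt) =
        ((X.smash l).JamesFil n).pt := by
      rw [(X.quotMap l (n + 1)).2, ← ((X.smash l).stageIncl n).2, hstage]
    exact (congrArg (fun y => G (t, y)) hpt).trans ((G.eq_fst t rfl).trans (c.comp _).2)
  · exact congrArg (fun y => G (t, stage y)) (quotMap_eq_iff.2 h)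
  · obtain ⟨p, hp⟩ := hv
    refine (G.apply_zero _).trans (congrArg c.1 ?_)
    rw [← hdrop hp, hstage]

lemma exists_homotopic_eq_pt_on_fatWedge (D : X.NDRData) (hl : 0 < l)
    (c : PMap ((X.smash l).JamesFil (n + 1)) Z)
    (hnull : PMap.Homotopic (c.comp ((X.smash l).stageIncl n)) (PMap.const _ _)) :
    ∃ c' : PMap ((X.smash l).JamesFil (n + 1)) Z, PMap.Homotopic c c' ∧
      ∀ v ∈ fatWedge X (Fin (n + 1) × Fin l), c'.1 ((X.quotMap l (n + 1)).1 v) = Z.pt := by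
  have : NeZero l := ⟨hl.ne'⟩
  obtain ⟨A, hcont, hpt, hcongr, hA⟩ := exists_nullHomotopy_on_fatWedge hl hnull
  obtain ⟨c', hcc', hc'⟩ := exists_homotopic_comp_mapCoord_r D hl c
  have hzero : ∀ v ∈ fatWedge X (Fin (n + 1) × Fin l),
      A (v, 0) = c.1 ((X.quotMap l (n + 1)).1 v) := fun v hv => (hA v hv).1
  obtain ⟨c'', hcc'', hc''⟩ := exists_descend_homotopy hl (c := c')
    (continuous_extendHomotopy (D := D) (f := fun v => c.1 ((X.quotMap l (n + 1)).1 v))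
      (c.1.comp (X.quotMap l (n + 1)).1).continuous hcont hzero)
    (fun v => by rw [extendHomotopy_zero hzero, hc'])
    (fun t => (extendHomotopy_of_mem_fatWedge pt_mem_fatWedge t).trans
      ((congrArg (fun v => A (v, t)) (mapCoord_pt D.r_pt)).trans (hpt t)))
    fun t v hv v' hv' h => by
      rw [extendHomotopy_of_mem_fatWedge hv, extendHomotopy_of_mem_fatWedge hv']
      exact hcongr t _ _ (blockWord_mapCoord D.r_pt h)
  refine ⟨c'', ContinuousMap.HomotopicRel.trans hcc' hcc'', fun v hv => ?_⟩
  rw [hc'', extendHomotopy_of_mem_fatWedge hv]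
  exact (hA _ (mapCoord_mem_fatWedge D.r_pt hv)).2

end FilStages

section Injectivity

variable {X M : PtdCG.{u}} [CGMonoid M] {l n : ℕ}

lemma homotopic_const_of_eq_one_on_fatWedge (D : X.NDRData) (I : HInverse M) (hl : 0 < l)
    {c : PMap ((X.smash l).JamesFil (n + 1)) M}
    (hc : ∀ v ∈ fatWedge X (Fin (n + 1) × Fin l), c.1 ((X.quotMap l (n + 1)).1 v) = 1)
    (hnull : PMap.Homotopic (c.comp (X.quotMap l (n + 1))) (PMap.const _ _)) :
    PMap.Homotopic c (PMap.const _ _) := by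
  have : NeZero l := ⟨hl.ne'⟩
  obtain ⟨H⟩ := homotopicRel_fatWedge_of_null D I (α := c.comp (X.quotMap l (n + 1))) hc hnull
  have hH (t) {v} (hv : v ∈ fatWedge X (Fin (n + 1) × Fin l)) : H (t, v) = 1 :=
    (H.eq_fst t hv).trans (hc v hv)
  obtain ⟨c', hcc', hc'⟩ := exists_descend_homotopy hl (c := c) (F := fun p => H (p.2, p.1))
    (H.continuous.comp continuous_swap) H.apply_zero
    (fun t => (hH t pt_mem_fatWedge).trans CGMonoid.pt_eq.symm)
    fun t v hv v' hv' _ => (hH t hv).trans (hH t hv').symm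
  have hconst : c' = PMap.const _ _ := by
    refine Subtype.ext (ContinuousMap.ext fun y => ?_)
    obtain ⟨v, rfl⟩ := isQuotientMap_quotMap.surjective y
    exact (hc' v).trans ((H.apply_one v).trans CGMonoid.pt_eq.symm)
  rwa [hconst] at hcc'

lemma homotopic_const_of_quotMap (D : X.NDRData) (I : HInverse M) (hl : 0 < l)
    (c : PMap ((X.smash l).JamesFil n) M)
    (hc : PMap.Homotopic (c.comp (X.quotMap l n)) (PMap.const _ _)) :
    PMap.Homotopic c (PMap.const _ _) := by
  induction n with
  | zero =>
    have hconst : c = PMap.const _ _ := by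
      refine Subtype.ext (ContinuousMap.ext fun y => ?_)
      rw [JamesFil_zero_eq_pt y]
      exact c.2
    rw [hconst]
    exact ContinuousMap.HomotopicRel.refl _
  | succ n ih =>
    have hstage : PMap.Homotopic (c.comp ((X.smash l).stageIncl n)) (PMap.const _ _) := by
      refine ih _ ?_
      have hone : (⟦c.comp (X.quotMap l (n + 1))⟧ : HClass _ M) = 1 := Quotient.sound hc
      have hpull := congrArg (pullback M (X.coordMap (deleteBlock (l := l) (Fin.last n)))) hone
      rw [map_one] at hpull
      have hcomp : (c.comp ((X.smash l).stageIncl n)).comp (X.quotMap l n) =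
          (c.comp (X.quotMap l (n + 1))).comp (X.coordMap (deleteBlock (Fin.last n))) :=
        congrArg c.comp (stageIncl_comp_quotMap (Fin.last n))
      rw [hcomp]
      exact Quotient.exact hpull
    obtain ⟨c', hcc', hc'⟩ := exists_homotopic_eq_pt_on_fatWedge D hl c hstage
    have hclass : (⟦c⟧ : HClass ((X.smash l).JamesFil (n + 1)) M) = ⟦c'⟧ := Quotient.sound hcc'
    have hnull : PMap.Homotopic (c'.comp (X.quotMap l (n + 1))) (PMap.const _ _) :=
      Quotient.exact ((congrArg (pullback M (X.quotMap l (n + 1))) hclass).symm.trans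
        (Quotient.sound hc))
    exact ContinuousMap.HomotopicRel.trans hcc' (homotopic_const_of_eq_one_on_fatWedge D I hl
      (fun v hv => (hc' v hv).trans CGMonoid.pt_eq) hnull)

theorem injective_pullback_quotMap (D : X.NDRData) (I : HInverse M) (hl : 0 < l) :
    Function.Injective (pullback M (X.quotMap l n)) := by
  intro a b h
  obtain ⟨u, rfl⟩ := I.isUnit b
  have hker (d : HClass ((X.smash l).JamesFil n) M)
      (hd : pullback M (X.quotMap l n) d = 1) : d = 1 := by
    obtain ⟨c, rfl⟩ := Quotient.exists_rep d
    exact Quotient.sound (homotopic_const_of_quotMap D I hl c (Quotient.exact hd))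
  refine Units.mul_inv_eq_one.1 (hker _ ?_)
  rw [map_mul, h, ← map_mul, Units.mul_inv, map_one]

end Injectivity

section Subwords

variable {Z M : PtdCG.{u}} [CGMonoid M] {m n : ℕ}

lemma length_letters_word_le (z : KPow (Fin n) Z) : (letters (Z.word z)).length ≤ n := by
  classical
  rw [letters_word]
  exact (List.length_filter_le _ _).trans_eq List.length_ofFn

/-- The product of the values of `Γ` on the subwords of length `m`, as in the definition of the
James–Hopf invariants. -/
def subwordProd (m : ℕ) (Γ : List Z → M) (w : Z.Word) : M :=
  (((letters w).sublistsLen m).map Γ).prod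

lemma subwordProd_zero (Γ : List Z → M) (w : Z.Word) : subwordProd 0 Γ w = Γ [] := by
  simp [subwordProd]

lemma subwordProd_of_lt (Γ : List Z → M) {w : Z.Word} (h : (letters w).length < m) :
    subwordProd m Γ w = 1 := by
  rw [subwordProd, List.sublistsLen_of_length_lt h, List.map_nil, List.prod_nil]

lemma subwordProd_letter_mul {Γ : List Z → M} (hΓ : ∀ L, Z.pt ∈ L → Γ L = 1) (x : Z)
    (w : Z.Word) : subwordProd (m + 1) Γ (Z.letter x * w) =
      subwordProd (m + 1) Γ w * subwordProd m (fun L => Γ (x :: L)) w := by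
  by_cases hx : x = Z.pt
  · have hone : subwordProd m (fun L => Γ (Z.pt :: L)) w = 1 := by
      refine List.prod_eq_one fun a ha => ?_
      obtain ⟨L, -, rfl⟩ := List.mem_map.1 ha
      exact hΓ _ List.mem_cons_self
    rw [hx, hone, mul_one, letter_pt, one_mul]
  · rw [subwordProd, letters_letter_mul hx, List.sublistsLen_succ_cons, List.map_append,
      List.prod_append, List.map_map]
    rfl

lemma subwordProd_word {Γ : List Z → M} (hΓ : ∀ L, Z.pt ∈ L → Γ L = 1) (z : KPow (Fin m) Z) :
    subwordProd m Γ (Z.word z) = Γ (List.ofFn z.coord) := by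
  induction m generalizing Γ with
  | zero => rw [subwordProd_zero, List.ofFn_zero]
  | succ m ih =>
    rw [word_succ, subwordProd_letter_mul hΓ, ih fun L hL => hΓ _ (List.mem_cons_of_mem _ hL),
      subwordProd_of_lt _ (Nat.lt_succ_of_le (length_letters_word_le _)), one_mul,
      List.ofFn_succ]

lemma continuous_subwordProd_word {W : Type u} [TopologicalSpace W] [CompactlyGeneratedSpace W]
    {Γ : W → List Z → M} (hΓ : ∀ s L, Z.pt ∈ L → Γ s L = 1)
    (hcont : ∀ f : W → KPow (Fin m) Z, Continuous f →
      Continuous fun s => Γ s (List.ofFn (f s).coord))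
    {v : W → KPow (Fin n) Z} (hv : Continuous v) :
    Continuous fun s => subwordProd m (Γ s) (Z.word (v s)) := by
  induction n generalizing m Γ with
  | zero =>
    cases m with
    | zero =>
      simp only [subwordProd_zero]
      exact hcont (fun _ => ⟨Fin.elim0⟩) continuous_const
    | succ m =>
      refine continuous_const.congr fun s => (subwordProd_of_lt (Γ s) ?_).symm
      exact Nat.lt_succ_of_le ((length_letters_word_le _).trans m.zero_le)
  | succ n ih =>
    have htail : Continuous fun s => (⟨fun i => v s i.succ⟩ : KPow (Fin n) Z) :=
      continuous_KPow fun i => (continuous_coord i.succ).comp hv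
    cases m with
    | zero =>
      simp only [subwordProd_zero]
      exact hcont (fun _ => ⟨Fin.elim0⟩) continuous_const
    | succ m =>
      simp only [word_succ, subwordProd_letter_mul (hΓ _)]
      refine CGMonoid.continuous_mul (ih hΓ hcont htail)
        (ih (fun s L hL => hΓ s _ (List.mem_cons_of_mem _ hL)) (fun f hf => ?_) htail)
      have hcons : Continuous fun s =>
          (⟨Fin.cons (v s 0) (f s).coord⟩ : KPow (Fin (m + 1)) Z) :=
        continuous_KPow fun i => Fin.cases
          ((continuous_coord 0).comp hv : Continuous fun s => v s 0)
          (fun i => ((continuous_coord i).comp hf : Continuous fun s => f s i)) i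
      refine (hcont _ hcons).congr fun s => ?_
      rw [List.ofFn_succ]
      rfl

lemma exists_extend_word {γ : PMap (Z.pow (Fin m)) M}
    (hγ : ∀ z ∈ fatWedge Z (Fin m), γ.1 z = 1) :
    ∃ f : PMap Z.James M, ∀ z : KPow (Fin m) Z, f.1 (Z.word z) = γ.1 z := by
  classical
  let Γ : List Z → M := fun L => if Z.pt ∈ L then 1 else γ.1 ⟨fun i => L.getD i Z.pt⟩
  have hΓ (L) (hL : Z.pt ∈ L) : Γ L = 1 := if_pos hL
  have hΓγ (z : KPow (Fin m) Z) : Γ (List.ofFn z.coord) = γ.1 z := by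
    change ite _ _ _ = _
    split_ifs with h
    · obtain ⟨i, hi⟩ := (List.mem_ofFn' _ _).1 h
      exact (hγ z ⟨i, hi⟩).symm
    · refine congrArg γ.1 (congrArg KPow.mk (funext fun i => ?_))
      rw [List.getD_eq_getElem _ _ (by rw [List.length_ofFn]; exact i.2), List.getElem_ofFn]
  have hword (z : KPow (Fin m) Z) : subwordProd m Γ (Z.word z) = γ.1 z :=
    (subwordProd_word hΓ z).trans (hΓγ z)
  have hcont : Continuous (subwordProd m Γ) := continuous_from_word fun n => by
    refine continuous_subwordProd_word (Γ := fun _ => Γ) (fun _ => hΓ) (fun f hf => ?_)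
      continuous_id
    simp only [hΓγ]
    exact γ.1.continuous.comp hf
  have hpt : Z.word (⟨fun _ => Z.pt⟩ : KPow (Fin m) Z) = 1 := List.prod_eq_one fun a ha => by
    obtain ⟨i, rfl⟩ := (List.mem_ofFn' _ _).1 ha
    exact Z.letter_pt
  exact ⟨⟨⟨subwordProd m Γ, hcont⟩,
    (congrArg (subwordProd m Γ) hpt).symm.trans ((hword _).trans γ.2)⟩, hword⟩

end Subwords

section BlockWord

variable {X M : PtdCG.{u}} [CGMonoid M] {l n : ℕ}

/-- The inclusion `J_n(Z) → J(Z)`. -/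
noncomputable def jamesFilIncl (Z : PtdCG.{u}) (n : ℕ) : PMap (Z.JamesFil n) Z.James :=
  ⟨⟨Quotient.lift (s := Setoid.ker (Z.word (k := n))) Z.word fun _ _ h => h,
    (Z.continuous_word n).quotient_lift _⟩, List.prod_eq_one fun a ha => by
    obtain ⟨i, rfl⟩ := (List.mem_ofFn' _ _).1 ha
    exact Z.letter_pt⟩

/-- The pointed map `X^{ln} → J(X^{(l)})` that sends a point to the word formed by its blocks. -/
noncomputable def blockWordMap (X : PtdCG.{u}) (l n : ℕ) :
    PMap (X.pow (Fin n × Fin l)) (X.smash l).James :=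
  ((X.smash l).jamesFilIncl n).comp (X.quotMap l n)

lemma exists_extend_blockWord (hl : 0 < l) {γ : PMap (X.pow (Fin n × Fin l)) M}
    (hγ : ∀ v ∈ fatWedge X (Fin n × Fin l), γ.1 v = 1) :
    ∃ f : PMap (X.smash l).James M, f.comp (X.blockWordMap l n) = γ := by
  let γ' : KPow (Fin n) (X.smash l) → M :=
    fun z => γ.1 (Function.surjInv surjective_toBlocks z)
  have hγ' (v : KPow (Fin n × Fin l) X) : γ' (toBlocks v) = γ.1 v := by
    have hblocks := Function.surjInv_eq (surjective_toBlocks (X := X) (l := l)) (toBlocks v)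
    rcases eq_or_mem_fatWedge_of_blockWord_eq hl
      (congrArg (X.smash l).word hblocks) with heq | ⟨hw, hv⟩
    · exact congrArg γ.1 heq
    · exact (hγ _ hw).trans (hγ _ hv).symm
  have hcont : Continuous γ' :=
    isQuotientMap_toBlocks.continuous_iff.2 (γ.1.continuous.congr fun v => (hγ' v).symm)
  obtain ⟨f, hf⟩ := exists_extend_word
    (γ := ⟨⟨γ', hcont⟩, (hγ' (X.pow (Fin n × Fin l)).pt).trans γ.2⟩) (by
      rintro z ⟨i, hi⟩
      obtain ⟨v, rfl⟩ := surjective_toBlocks z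
      obtain ⟨j, hj⟩ := (smashMk_eq_pt hl).1 hi
      exact (hγ' v).trans (hγ v ⟨(i, j), hj⟩))
  exact ⟨f, Subtype.ext (ContinuousMap.ext fun v => (hf _).trans (hγ' v))⟩

lemma pullback_pullback {Y Y' Y'' : PtdCG.{u}} (g : PMap Y' Y) (g' : PMap Y'' Y')
    (a : HClass Y M) : pullback M g' (pullback M g a) = pullback M (g.comp g') a := by
  obtain ⟨f, rfl⟩ := Quotient.exists_rep a
  rfl

lemma coordMap_comp {ι κ μ : Type} (φ : ι → Option κ) (ψ : κ → Option μ) :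
    (X.coordMap φ).comp (X.coordMap ψ) = X.coordMap fun i => (φ i).bind ψ := by
  refine Subtype.ext (ContinuousMap.ext fun v => congrArg KPow.mk (funext fun i => ?_))
  change (φ i).elim X.pt (fun j => (ψ j).elim X.pt (KPow.coord v)) =
    ((φ i).bind ψ).elim X.pt (KPow.coord v)
  cases φ i <;> rfl

lemma toBlocks_killIdx_of_mem (hl : 0 < l) {A : Set (Fin n × Fin l)} {s : Fin n} {j : Fin l}
    (h : (s, j) ∈ A) (v : KPow (Fin n × Fin l) X) :
    toBlocks ((X.coordMap (killIdx A)).1 v) s = (X.smash l).pt := by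
  refine (smashMk_eq_pt hl).2 ⟨j, ?_⟩
  change (killIdx A (s, j)).elim X.pt v.coord = X.pt
  rw [killIdx, if_pos h]
  rfl

lemma toBlocks_killIdx_of_notMem {A : Set (Fin n × Fin l)} {s : Fin n} (h : ∀ j, (s, j) ∉ A)
    (v : KPow (Fin n × Fin l) X) :
    toBlocks ((X.coordMap (killIdx A)).1 v) s = toBlocks v s := by
  refine congrArg (fun w => smashMk (KPow.mk w)) (funext fun j => ?_)
  change (killIdx A (s, j)).elim X.pt v.coord = v (s, j)
  rw [killIdx, if_neg (h j)]
  rfl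

lemma toBlocks_killIdx_singleton (hl : 0 < l) (s : Fin n) (j : Fin l)
    (v : KPow (Fin n × Fin l) X) :
    toBlocks ((X.coordMap (killIdx {(s, j)})).1 v) =
      toBlocks ((X.coordMap (killIdx (block s))).1 v) := by
  refine congrArg KPow.mk (funext fun t => ?_)
  rcases eq_or_ne t s with rfl | ht
  · exact (toBlocks_killIdx_of_mem hl (A := {(t, j)}) (j := j) rfl v).trans
      (toBlocks_killIdx_of_mem hl (A := block t) (j := j) rfl v).symm
  · exact (toBlocks_killIdx_of_notMem (A := {(s, j)}) (fun _ h => ht (congrArg Prod.fst h)) v).trans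
      (toBlocks_killIdx_of_notMem (A := block s) (fun _ h => ht h) v).symm

lemma blockWordMap_comp_killIdx (hl : 0 < l) (s : Fin n) (j : Fin l) :
    (X.blockWordMap l n).comp (X.coordMap (killIdx {(s, j)})) =
      (X.blockWordMap l n).comp (X.coordMap (killIdx (block s))) :=
  Subtype.ext (ContinuousMap.ext fun v =>
    congrArg (X.smash l).word (toBlocks_killIdx_singleton hl s j v))

lemma blockWordMap_comp_deleteBlock (s : Fin (n + 1)) :
    (X.blockWordMap l (n + 1)).comp (X.coordMap (deleteBlock s)) = X.blockWordMap l n :=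
  Subtype.ext (ContinuousMap.ext fun v => blockWord_deleteBlock s v)

end BlockWord

section Index

variable {l n : ℕ}

lemma bind_deleteBlock_killIdx (s : Fin (n + 1)) (B : Set (Fin (n + 1) × Fin l)) :
    (fun p => (deleteBlock s p).bind (killIdx {q | (s.succAbove q.1, q.2) ∈ B})) =
      fun p => (killIdx B p).bind (deleteBlock s) := by
  funext ⟨i, j⟩
  rcases Fin.eq_self_or_eq_succAbove s i with rfl | ⟨i, rfl⟩
  · rw [deleteBlock_self, killIdx]
    split_ifs
    · rfl
    · exact (deleteBlock_self _ _).symm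
  · rw [deleteBlock_succAbove]
    by_cases hB : (s.succAbove i, j) ∈ B
    · rw [killIdx, if_pos hB]
      exact if_pos hB
    · rw [killIdx, if_neg hB]
      exact (if_neg hB).trans (deleteBlock_succAbove s i j).symm

lemma bind_deleteBlock_zero (s : Fin (n + 1)) :
    (fun p => (deleteBlock (l := l) (0 : Fin (n + 2)) p).bind (deleteBlock s)) =
      fun p => (deleteBlock (l := l) s.succ p).bind (deleteBlock (0 : Fin (n + 1))) := by
  have hsucc {n : ℕ} (i : Fin n) (j : Fin l) :
      deleteBlock (0 : Fin (n + 1)) (i.succ, j) = some (i, j) := deleteBlock_succAbove 0 i j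
  funext ⟨i, j⟩
  induction i using Fin.cases with
  | zero =>
    have hzero := deleteBlock_succAbove s.succ 0 j
    rw [Fin.succ_succAbove_zero] at hzero
    rw [hzero, deleteBlock_self]
    exact (deleteBlock_self _ _).symm
  | succ i =>
    rw [hsucc]
    rcases Fin.eq_self_or_eq_succAbove s i with rfl | ⟨i, rfl⟩
    · rw [deleteBlock_self]
      exact deleteBlock_self _ _
    · have hs := deleteBlock_succAbove s.succ i.succ j
      rw [Fin.succ_succAbove_succ] at hs
      rw [hs]
      exact (deleteBlock_succAbove s i j).trans (hsucc i j).symm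

lemma killIdx_block (s : Fin (n + 1)) : killIdx (block (l := l) s) =
    fun p => (deleteBlock s p).bind fun q => some (s.succAbove q.1, q.2) := by
  funext ⟨i, j⟩
  rw [killIdx]
  rcases Fin.eq_self_or_eq_succAbove s i with rfl | ⟨i, rfl⟩
  · rw [deleteBlock_self]
    exact if_pos rfl
  · rw [deleteBlock_succAbove]
    exact if_neg (Fin.succAbove_ne s i)

end Index

section Surjectivity

variable {X M : PtdCG.{u}} [CGMonoid M] {l n : ℕ}

variable (X M l n) in
/-- The classes on `X^{ln}` that satisfy the conditions (a) and (b) on restrictions, without the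
condition of being generated by the coordinates. -/
noncomputable def blockCompatible : Submonoid (HClass (X.pow (Fin n × Fin l)) M) where
  carrier := {α |
    (∀ s j, pullback M (X.coordMap (killIdx {(s, j)})) α =
      pullback M (X.coordMap (killIdx (block s))) α) ∧
    ∀ s t, pullback M (X.coordMap (deleteBlock s)) α = pullback M (X.coordMap (deleteBlock t)) α}
  mul_mem' hα hβ := ⟨fun s j => by rw [map_mul, map_mul, hα.1, hβ.1],
    fun s t => by rw [map_mul, map_mul, hα.2 s t, hβ.2 s t]⟩
  one_mem' := ⟨fun s j => by rw [map_one, map_one], fun s t => by rw [map_one, map_one]⟩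

lemma pullback_blockWordMap_mem (hl : 0 < l) (β : HClass (X.smash l).James M) :
    pullback M (X.blockWordMap l n) β ∈ blockCompatible X M l n := by
  refine ⟨fun s j => ?_, ?_⟩
  · rw [pullback_pullback, pullback_pullback, blockWordMap_comp_killIdx hl]
  · cases n with
    | zero => exact fun s => s.elim0
    | succ n =>
      intro s t
      refine (pullback_pullback _ _ β).trans (Eq.trans ?_ (pullback_pullback _ _ β).symm)
      exact congrArg (pullback M · β)
        ((blockWordMap_comp_deleteBlock s).trans (blockWordMap_comp_deleteBlock t).symm)

lemma pullback_coordMap_comm {ι κ κ' μ : Type} {φ : ι → Option κ} {ψ : κ → Option μ}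
    {φ' : ι → Option κ'} {ψ' : κ' → Option μ}
    (h : (fun i => (φ i).bind ψ) = fun i => (φ' i).bind ψ') (α : HClass (X.pow ι) M) :
    pullback M (X.coordMap ψ) (pullback M (X.coordMap φ) α) =
      pullback M (X.coordMap ψ') (pullback M (X.coordMap φ') α) := by
  rw [pullback_pullback, pullback_pullback, coordMap_comp, coordMap_comp, h]

lemma pullback_deleteBlock_zero_mem {α : HClass (X.pow (Fin (n + 1) × Fin l)) M}
    (hα : α ∈ blockCompatible X M l (n + 1)) :
    pullback M (X.coordMap (deleteBlock (0 : Fin (n + 1)))) α ∈ blockCompatible X M l n := by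
  refine ⟨fun s j => ?_, ?_⟩
  · have hsingle : ({(s, j)} : Set (Fin n × Fin l)) =
        {q | ((0 : Fin (n + 1)).succAbove q.1, q.2) ∈ ({(s.succ, j)} : Set _)} := by
      ext ⟨i, k⟩
      simp
    have hblock : (block s : Set (Fin n × Fin l)) =
        {q | ((0 : Fin (n + 1)).succAbove q.1, q.2) ∈ block s.succ} := by
      ext ⟨i, k⟩
      simp [block]
    rw [hsingle, hblock]
    refine (pullback_coordMap_comm (bind_deleteBlock_killIdx 0 _) α).trans (Eq.trans ?_
      (pullback_coordMap_comm (bind_deleteBlock_killIdx 0 _) α).symm)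
    exact congrArg _ (hα.1 s.succ j)
  · cases n with
    | zero => exact fun s => s.elim0
    | succ n =>
      intro s t
      refine (pullback_coordMap_comm (bind_deleteBlock_zero s) α).trans (Eq.trans ?_
        (pullback_coordMap_comm (bind_deleteBlock_zero t) α).symm)
      exact congrArg _ (hα.2 s.succ t.succ)

lemma pullback_killIdx_eq_one {α : HClass (X.pow (Fin (n + 1) × Fin l)) M}
    (hα : α ∈ blockCompatible X M l (n + 1))
    (hdelete : ∀ s : Fin (n + 1), pullback M (X.coordMap (deleteBlock s)) α = 1)
    (p : Fin (n + 1) × Fin l) : pullback M (X.coordMap (killIdx {p})) α = 1 := by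
  rw [hα.1 p.1 p.2, killIdx_block, ← coordMap_comp, ← pullback_pullback]
  exact (congrArg _ (hdelete p.1)).trans (map_one _)

theorem exists_pullback_blockWordMap (D : X.NDRData) (I : HInverse M) (hl : 0 < l)
    {α : HClass (X.pow (Fin n × Fin l)) M} (hα : α ∈ blockCompatible X M l n) :
    ∃ β, pullback M (X.blockWordMap l n) β = α := by
  induction n with
  | zero =>
    obtain ⟨f, rfl⟩ := Quotient.exists_rep α
    obtain ⟨g, hg⟩ := exists_extend_blockWord (n := 0) hl (γ := f) fun v ⟨p, _⟩ => p.1.elim0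
    exact ⟨⟦g⟧, congrArg (Quotient.mk _) hg⟩
  | succ n ih =>
    obtain ⟨β, hβ⟩ := ih (pullback_deleteBlock_zero_mem hα)
    obtain ⟨u, rfl⟩ := I.isUnit β
    have hdelete (s : Fin (n + 1)) : pullback M (X.coordMap (deleteBlock s))
        (α * pullback M (X.blockWordMap l (n + 1)) u⁻¹.val) = 1 := by
      have hinv : pullback M (X.coordMap (deleteBlock s))
          (pullback M (X.blockWordMap l (n + 1)) u⁻¹.val) =
            pullback M (X.blockWordMap l n) u⁻¹.val :=
        (pullback_pullback _ _ _).trans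
          (congrArg (pullback M · u⁻¹.val) (blockWordMap_comp_deleteBlock s))
      refine (map_mul _ _ _).trans ?_
      rw [hinv, hα.2 s 0]
      refine (congrArg (· * _) hβ.symm).trans ?_
      rw [← map_mul, Units.mul_inv, map_one]
    obtain ⟨γ, hγ, hγone⟩ := exists_rep_eq_one_on_fatWedge D I
      (pullback_killIdx_eq_one (mul_mem hα (pullback_blockWordMap_mem hl _)) hdelete)
    obtain ⟨f, hf⟩ := exists_extend_blockWord hl hγone
    refine ⟨⟦f⟧ * u.val, ?_⟩
    rw [map_mul, pullback_mk, hf, hγ, mul_assoc, ← map_mul, Units.inv_mul, map_one, mul_one]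

theorem exists_pullback_quotMap (D : X.NDRData) (I : HInverse M) (hl : 0 < l)
    {α : HClass (X.pow (Fin n × Fin l)) M} (hα : α ∈ blockCompatible X M l n) :
    ∃ β, pullback M (X.quotMap l n) β = α := by
  obtain ⟨β, rfl⟩ := exists_pullback_blockWordMap D I hl hα
  exact ⟨pullback M ((X.smash l).jamesFilIncl n) β, pullback_pullback _ _ β⟩

end Surjectivity

section CohenHom

variable {X : PtdCG.{u}} {l n : ℕ}

lemma cohenHom_mem_blockCompatible (D : X.NDRData) (I : HInverse X.James)
    (hcat : X.WeakCatLtTwo) (h : Cohen.H l n) :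
    cohenHom D I hcat (h : Cohen.K (Fin n × Fin l)) ∈ blockCompatible X X.James l n := by
  have hpull {κ : Type} [DecidableEq κ] (φ : Fin n × Fin l → Option κ) :
      pullback X.James (X.coordMap φ) (cohenHom D I hcat h.1) =
        cohenHom D I hcat (Cohen.K.map φ h.1) := coordPullback_cohenHom D I hcat φ h.1
  exact ⟨fun s j => by rw [hpull, hpull, h.2.1], fun s t => by rw [hpull, hpull, h.2.2 s t]⟩

theorem exists_hom_HGeo (D : X.NDRData) (I : HInverse X.James) (hcat : X.WeakCatLtTwo)
    (hl : 0 < l) : ∃ e : Cohen.H l n →* X.HGeo l n,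
      ∀ h, X.quotPullback l n (e h) = cohenHom D I hcat (h : Cohen.K (Fin n × Fin l)) := by
  have hinj : Function.Injective (X.quotPullback l n) := injective_pullback_quotMap D I hl
  choose β hβ using fun h : Cohen.H l n =>
    exists_pullback_quotMap D I hl (cohenHom_mem_blockCompatible D I hcat h)
  have hmem (h : Cohen.H l n) : β h ∈ X.HGeo l n := by
    have hcomp := cohenHom_mem_blockCompatible D I hcat h
    have hgen := cohenHom_mem_KGeo D I hcat h.1
    rw [← hβ h] at hcomp hgen
    exact ⟨hgen, hcomp⟩
  refine ⟨{ toFun := fun h => ⟨β h, hmem h⟩, map_one' := ?_, map_mul' := fun g h => ?_ }, hβ⟩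
  · refine Subtype.ext (hinj ((hβ 1).trans ?_))
    exact (map_one (cohenHom D I hcat)).trans (map_one (X.quotPullback l n)).symm
  · refine Subtype.ext (hinj ?_)
    calc pullback X.James (X.quotMap l n) (β (g * h))
        = cohenHom D I hcat g.1 * cohenHom D I hcat h.1 :=
          (hβ (g * h)).trans (map_mul (cohenHom D I hcat) g.1 h.1)
      _ = X.quotPullback l n (β g) * X.quotPullback l n (β h) :=
          (congrArg₂ (· * ·) (hβ g) (hβ h)).symm
      _ = X.quotPullback l n (β g * β h) := (map_mul (X.quotPullback l n) _ _).symm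

end CohenHom

end PtdCG

theorem proposition2p11 (X : PtdCG.{u}) [PathConnectedSpace X] (hX : X.Nondegenerate)
    (hcat : X.WeakCatLtTwo) (l n : ℕ) (hl : 0 < l) (hn : 0 < n) :
    (∀ a : PtdCG.HClass (X.pow (Fin n × Fin l)) X.James, IsUnit a) ∧
    (∀ b : PtdCG.HClass ((X.smash l).JamesFil n) X.James, IsUnit b) ∧
    ∃ (eK : Cohen.K (Fin n × Fin l) →* PtdCG.HClass (X.pow (Fin n × Fin l)) X.James)
      (eH : Cohen.H l n →* X.HGeo l n),
      (∀ i, eK (Cohen.K.x i) = X.xClass i) ∧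
      (∀ h : Cohen.H l n, X.quotPullback l n (eH h) = eK h) ∧
      (∀ h : Cohen.H l n, (∀ i, Cohen.K.map (killIdx {i}) (h : Cohen.K (Fin n × Fin l)) = 1) →
        ∀ i, X.coordPullback (killIdx {i}) (X.quotPullback l n (eH h)) = 1) := by
  obtain ⟨I⟩ := PtdCG.nonempty_hInverse_james hX hcat
  obtain ⟨D⟩ := hX.nonempty_NDRData
  obtain ⟨eH, heH⟩ := PtdCG.exists_hom_HGeo (n := n) D I hcat hl
  refine ⟨I.isUnit, I.isUnit, PtdCG.cohenHom D I hcat, eH, PtdCG.cohenHom_x D I hcat, heH,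
    fun h hh i => ?_⟩
  rw [heH, PtdCG.coordPullback_cohenHom, hh, map_one]
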